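/- Let $d\ge 1$, $q\ge 0$, let $\Theta\subset\mathbb{R}^q$ and let $\{f_\theta:\theta\in\Theta\}$ be a family of probability densities on $\mathbb{R}^d$ with distributions $P_\theta$. Let $\Theta_0\subset\operatorname{int}\Theta$ be a compact neighbourhood of $\theta_0$, put $g=f_{\theta_0}$, and suppose that for every $\theta\in\Theta_0$ the densities $f_\theta$ and $g$ vanish at the same points up to a Lebesgue null set, and that for every $\theta\in\Theta_0\setminus\{\theta_0\}$ the set $\{x: f_\theta(x)\ne g(x)\}$ has positive Lebesgue measure. Let $\xi,\xi_1,\xi_2,\dots$ be i.i.d. with density $g$. For $n\ge 2$ and $i\le n$ let $R_n(i)=\min_{j\le n,\,j\ne i}|\xi_i-\xi_j|$, let $B_n(\xi_i)$ be the closed ball with centre $\xi_i$ and radius $R_n(i)$, write $B_n(\xi)=B_n(\xi_1)$ (with $\xi=\xi_1$), and put $z_{i,n}(\theta)=nP_\theta(B_n(\xi_i))$. Let $h:(0,\infty)\to(-\infty,0]$ be one of $$h_1(x)=\ln x-x+1,\qquad h_2(x)=(1-x)\ln x,\qquad h_5(x)=\operatorname{sgn}(1-\alpha)(x^\alpha-\alpha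 x+\alpha-1),\ \ \alpha\in(0,1)\cup(1,2],$$ let $v(z)=h'(z)z$ and, with $\nabla$ the gradient in $\theta$, $$\psi_n(\xi_i,\theta)=v(z_{i,n}(\theta))\frac{1}{P_\theta(B_n(\xi_i))}\int_{B_n(\xi_i)}\nabla f_\theta(y)\,dy,\qquad \tilde\psi_n(\xi_i,\theta)=v\Big(z_{i,n}(\theta_0)\frac{f_\theta(\xi_i)}{g(\xi_i)}\Big)\frac{\nabla f_\theta(\xi_i)}{f_\theta(\xi_i)}.$$ For all large $n$ let $\theta_0^{(n)}\in\Theta_0$ be a point that maximizes $\theta\mapsto E[h(z_{1,n}(\theta))]\in[-\infty,0]$ over $\Theta_0$ (for the remaining $n$ let $\theta_0^{(n)}\in\mathbb{R}^q$ be arbitrary). Consider the following assumptions, where $\partial f_\theta$ stands for each of the partial derivatives $\partial f_\theta/\partial\theta_j$, $j=1,\dots,q$. - A2: $f_\theta(x)$ and its first and second order derivatives in $\theta$ exist for $\theta\in\Theta_0$, $x\in\mathbb{R}^d$, and are continuous in $(\theta,x)\in\Theta_0\times\mathbb{R}^d$. - A3: $E\big[\sup_{\theta\in\Theta_0}|\partial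 f_\theta(\xi)/g(\xi)|^2\big]<\infty$. - A4: the random variables $\sup_{\theta\in\Theta_0}\frac{1}{P_\theta(B_n(\xi))}\int_{B_n(\xi)}|\partial f_\theta(y)|\,dy$, $n\ge2$, are uniformly integrable. - A5: the random variables $\Big(\frac{1}{P_{\theta_0^{(n)}}(B_n(\xi))}\int_{B_n(\xi)}|\partial f_{\theta_0^{(n)}}(y)|\,dy\Big)^2$, $n\ge2$, are uniformly integrable. - A7: $E\big[\sup_{\theta\in\Theta_0}|\partial f_\theta(\xi)/g(\xi)|^4\big]<\infty$ and $E\big[\sup_{\theta\in\Theta_0}|f_\theta(\xi)/g(\xi)|^4\big]<\infty$. Then $$\frac1{\sqrt n}\sum_{i=1}^n\psi_n(\xi_i,\theta_0^{(n)})-\frac1{\sqrt n}\sum_{i=1}^n\tilde\psi_n(\xi_i,\theta_0)\to 0\quad\text{in probability as } n\to\infty$$ holds in each of the following cases: i) $h=h_1$, or $h=h_5$ with $\alpha\in(0,1)$, under A2, A3, A4, A5; ii) $h=h_2$, under A2, A3, A4, A5, A7; iii) $h=h_5$ with $\alpha\in(1,2]$, under A2, A3, A7. -/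

import Mathlib

open MeasureTheory ProbabilityTheory Filter Topology
open scoped ENNReal

noncomputable section

namespace GMSP

/-- `ℝ^k` with its Euclidean norm. -/
abbrev E (k : ℕ) : Type := EuclideanSpace ℝ (Fin k)

/-! ### The divergence functions -/

/-- `h₁(x) = ln x - x + 1`. -/
def h1 (x : ℝ) : ℝ := Real.log x - x + 1

/-- `h₂(x) = (1 - x) ln x`. -/
def h2 (x : ℝ) : ℝ := (1 - x) * Real.log x

/-- `h₅(x) = sgn(1 - α) (x ^ α - α x + α - 1)`. -/
def h5 (α : ℝ) (x : ℝ) : ℝ := Real.sign (1 - α) * (x ^ α - α * x + α - 1)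

/-- `v(z) = h'(z) z`. -/
def v (h : ℝ → ℝ) (z : ℝ) : ℝ := deriv h z * z

/-! ### The parametric model -/

variable {d q : ℕ}

/-- The gradient `∇ f_θ(x)` with respect to the parameter `θ`; its `j`-th coordinate is the partial
derivative of `f_θ(x)` with respect to `θ_j`. -/
def gradF (f : E q → E d → ℝ) (θ : E q) (x : E d) : E q := gradient (fun t => f t x) θ

/-- The probability distribution with density `f_θ` with respect to Lebesgue measure. -/
def law (f : E q → E d → ℝ) (θ : E q) : Measure (E d) :=
  volume.withDensity (fun x => ENNReal.ofReal (f θ x))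

/-- `{f_θ, θ ∈ Θ}` is a family of probability densities; `Θ₀` is a compact neighbourhood of `θ₀`
inside the parameter set, and on `Θ₀` all densities are positive at the same points as the true
density `f_θ₀` (up to Lebesgue null sets), so that the quotients `f_θ / f_θ₀` and `∇ f_θ / f_θ`
make sense and `P_θ(B) = ∫_B (f_θ / f_θ₀) dP_θ₀`. -/
structure IsModel (f : E q → E d → ℝ) (Θ Θ0 : Set (E q)) (θ0 : E q) : Prop where
  measurable : ∀ θ ∈ Θ, Measurable (f θ)
  nonneg : ∀ θ ∈ Θ, ∀ x, 0 ≤ f θ x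
  lintegral_eq_one : ∀ θ ∈ Θ, ∫⁻ x, ENNReal.ofReal (f θ x) = 1
  compact : IsCompact Θ0
  nhds : Θ0 ∈ 𝓝 θ0
  subset : Θ0 ⊆ interior Θ
  support : ∀ θ ∈ Θ0, ∀ᵐ x ∂(volume : Measure (E d)), f θ x = 0 ↔ f θ0 x = 0

/-- Weak identifiability: `μ{x : f_θ(x) ≠ f_θ₀(x)} > 0` for `θ ∈ Θ₀`, `θ ≠ θ₀`. -/
def Identifiable (f : E q → E d → ℝ) (Θ0 : Set (E q)) (θ0 : E q) : Prop :=
  ∀ θ ∈ Θ0, θ ≠ θ0 → 0 < (volume : Measure (E d)) {x | f θ x ≠ f θ0 x}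

/-! ### Nearest neighbour balls -/

variable {Ω : Type*}

/-- Nearest neighbour distance of `ξ_i` in the sample `ξ_0, …, ξ_{n-1}`. -/
def nnDist (ξ : ℕ → Ω → E d) (n i : ℕ) (ω : Ω) : ℝ :=
  ⨅ j : {j : ℕ // j < n ∧ j ≠ i}, dist (ξ i ω) (ξ j ω)

/-- Nearest neighbour ball `B_n(ξ_i)`. -/
def nnBall (ξ : ℕ → Ω → E d) (n i : ℕ) (ω : Ω) : Set (E d) :=
  Metric.closedBall (ξ i ω) (nnDist ξ n i ω)

/-- `P_θ(B_n(ξ_i)) = ∫_{B_n(ξ_i)} f_θ(y) dy`. -/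
def ballProb (f : E q → E d → ℝ) (ξ : ℕ → Ω → E d) (n i : ℕ) (θ : E q) (ω : Ω) : ℝ :=
  ∫ y in nnBall ξ n i ω, f θ y

/-- `z_{i,n}(θ) = n P_θ(B_n(ξ_i))`. -/
def z (f : E q → E d → ℝ) (ξ : ℕ → Ω → E d) (n i : ℕ) (θ : E q) (ω : Ω) : ℝ :=
  n * ballProb f ξ n i θ ω

/-- `ψ_n(ξ_i, θ) = v(z_{i,n}(θ)) P_θ(B_n(ξ_i))⁻¹ ∫_{B_n(ξ_i)} ∇ f_θ(y) dy`. -/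
def psi (h : ℝ → ℝ) (f : E q → E d → ℝ) (ξ : ℕ → Ω → E d) (n i : ℕ) (θ : E q) (ω : Ω) : E q :=
  (v h (z f ξ n i θ ω) * (ballProb f ξ n i θ ω)⁻¹) • ∫ y in nnBall ξ n i ω, gradF f θ y

/-- `ψ̃_n(ξ_i, θ) = v(z_{i,n}(θ₀) f_θ(ξ_i) / g(ξ_i)) ∇ f_θ(ξ_i) / f_θ(ξ_i)`, with true density
`g = f_θ₀`. -/
def psiTilde (h : ℝ → ℝ) (f : E q → E d → ℝ) (θ0 : E q) (ξ : ℕ → Ω → E d) (n i : ℕ)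
    (θ : E q) (ω : Ω) : E q :=
  (v h (z f ξ n i θ0 ω * (f θ (ξ i ω) / f θ0 (ξ i ω))) * (f θ (ξ i ω))⁻¹) • gradF f θ (ξ i ω)

/-- `P_θ(B_n(ξ_i))⁻¹ ∫_{B_n(ξ_i)} |∂ f_θ(y) / ∂ θ_j| dy`. -/
def absAvg (f : E q → E d → ℝ) (ξ : ℕ → Ω → E d) (j : Fin q) (n i : ℕ) (θ : E q) (ω : Ω) : ℝ :=
  (ballProb f ξ n i θ ω)⁻¹ * ∫ y in nnBall ξ n i ω, |gradF f θ y j|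

/-! ### The assumptions -/

/-- `f_θ(x)` and its first and second order derivatives with respect to the components of `θ`
exist for `θ ∈ Θ₀` and are continuous in `(θ, x)`. -/
structure A2 (f : E q → E d → ℝ) (Θ0 : Set (E q)) : Prop where
  continuousOn : ContinuousOn (fun p : E q × E d => f p.1 p.2) (Θ0 ×ˢ Set.univ)
  differentiableAt : ∀ θ ∈ Θ0, ∀ x, DifferentiableAt ℝ (fun t => f t x) θ
  continuousOn_grad : ContinuousOn (fun p : E q × E d => gradF f p.1 p.2) (Θ0 ×ˢ Set.univ)
  differentiableAt_grad : ∀ θ ∈ Θ0, ∀ x, DifferentiableAt ℝ (fun t => gradF f t x) θ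
  continuousOn_hess : ContinuousOn
    (fun p : E q × E d => fderiv ℝ (fun t => gradF f t p.2) p.1) (Θ0 ×ˢ Set.univ)

/-- `E[sup_{Θ₀} |∂_j f_θ(ξ) / g(ξ)|²] < ∞` for all `j`. -/
def A3 (f : E q → E d → ℝ) (Θ0 : Set (E q)) (θ0 : E q) : Prop :=
  ∀ j : Fin q, ∫⁻ x, (⨆ θ ∈ Θ0, ‖gradF f θ x j / f θ0 x‖ₑ ^ 2) ∂(law f θ0) < ∞

/-- For all `j`, the random variables `sup_{Θ₀} P_θ(B_n(ξ))⁻¹ ∫_{B_n(ξ)} |∂_j f_θ(y)| dy`,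
`n ≥ 2`, are uniformly integrable. -/
def A4 [MeasurableSpace Ω] (P : Measure Ω) (f : E q → E d → ℝ) (Θ0 : Set (E q))
    (ξ : ℕ → Ω → E d) : Prop :=
  ∀ j : Fin q, UniformIntegrable
    (fun (n : {n : ℕ // 2 ≤ n}) (ω : Ω) => ⨆ θ : Θ0, absAvg f ξ j n 0 θ ω) 1 P

/-- For all `j`, the random variables `(P_θₙ(B_n(ξ))⁻¹ ∫_{B_n(ξ)} |∂_j f_θₙ(y)| dy)²`, `n ≥ 2`,
are uniformly integrable; here `θₙ` is the given sequence of parameters. -/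
def A5 [MeasurableSpace Ω] (P : Measure Ω) (f : E q → E d → ℝ) (θn : ℕ → E q)
    (ξ : ℕ → Ω → E d) : Prop :=
  ∀ j : Fin q, UniformIntegrable
    (fun (n : {n : ℕ // 2 ≤ n}) (ω : Ω) => (absAvg f ξ j n 0 (θn n) ω) ^ 2) 1 P

/-- `E[sup_{Θ₀} |∂_j f_θ(ξ) / g(ξ)|⁴] < ∞` for all `j`, and `E[sup_{Θ₀} |f_θ(ξ) / g(ξ)|⁴] < ∞`. -/
def A7 (f : E q → E d → ℝ) (Θ0 : Set (E q)) (θ0 : E q) : Prop :=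
  (∀ j : Fin q, ∫⁻ x, (⨆ θ ∈ Θ0, ‖gradF f θ x j / f θ0 x‖ₑ ^ 4) ∂(law f θ0) < ∞) ∧
    ∫⁻ x, (⨆ θ ∈ Θ0, ‖f θ x / f θ0 x‖ₑ ^ 4) ∂(law f θ0) < ∞

/-! ### The maximizers of the expected criterion and the conclusion -/

/-- `E[h(z_{i,n}(θ))]`, which does not depend on `i < n`, for a function `h ≤ 0` on `(0, ∞)`; it is
an extended real number in `[-∞, 0]`. -/
def expectedH [MeasurableSpace Ω] (P : Measure Ω) (h : ℝ → ℝ) (f : E q → E d → ℝ)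
    (ξ : ℕ → Ω → E d) (n : ℕ) (θ : E q) : EReal :=
  -((∫⁻ ω, ENNReal.ofReal (-h (z f ξ n 0 θ ω)) ∂P : ℝ≥0∞) : EReal)

/-- For all large `n`, the point `θₙ` lies in `Θ₀` and maximizes `θ ↦ E[h(z_{i,n}(θ))]` there. -/
def IsMaximizerSeq [MeasurableSpace Ω] (P : Measure Ω) (h : ℝ → ℝ) (f : E q → E d → ℝ)
    (Θ0 : Set (E q)) (ξ : ℕ → Ω → E d) (θn : ℕ → E q) : Prop :=
  ∀ᶠ n in atTop, θn n ∈ Θ0 ∧ IsMaxOn (expectedH P h f ξ n) Θ0 (θn n)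

/-- `n^{-1/2} ∑ ψ_n(ξ_i, θₙ) - n^{-1/2} ∑ ψ̃_n(ξ_i, θ₀) → 0` in probability. -/
def PsiApprox [MeasurableSpace Ω] (P : Measure Ω) (h : ℝ → ℝ) (f : E q → E d → ℝ)
    (θ0 : E q) (ξ : ℕ → Ω → E d) (θn : ℕ → E q) : Prop :=
  TendstoInMeasure P
    (fun (n : ℕ) (ω : Ω) =>
      (√(n : ℝ))⁻¹ • ∑ i ∈ Finset.range n, psi h f ξ n i (θn n) ω
        - (√(n : ℝ))⁻¹ • ∑ i ∈ Finset.range n, psiTilde h f θ0 ξ n i θ0 ω)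
    atTop (fun _ => 0)

end GMSP

end

open GMSP

/-! Let `u_i` be the mass of the nearest neighbour ball of `ξ_i` under the true law. Given `ξ_i`, it
is the minimum of `n - 1` independent uniform variables, and almost surely the ball is recovered
from its centre and `u_i` by a quantile function. So each coordinate of `ψ_n - ψ̃_n` is a function
`F_n` (`diffB`) of the pair `(ξ_i, u_i)`. By Chebyshev's inequality three facts suffice: `E F_n =
0`, `E F_n² → 0`, and `Var ∑ F_n(ξ_i, u_i) ≤ C n E F_n²` with `C` independent of `n`, the last after
a truncation (`IsNNKernel.measure_abs_nnSum_ge_le`).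

Variance. The Efron–Stein inequality alone does not give this: removing a point replaces some `u_i`
by the mass up to the second neighbour, whose density relative to that of `u_i` is of order `n s`,
so the increments are not controlled by `E F_n²`. Instead the indices are split into halves `A` and
`B`, and the points of `B` are integrated out of the sum over `A` one at a time. Each integration
replaces `F` by the smoother function `avgMin F`. The price of step `N` is a mean square increment
of `avgMin^[N] F`, bounded by an integral of `F²` with weight `9 + 6 n s (1 - s)^N`; since `∑ s (1 -
s)^N ≤ 1`, the prices add up to order `n` (`integral_sqIncr_le`,
`IsNNKernel.integral_sq_centerSum_union_le`). When `B` is used up, the smoothed function has bounded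
weights and Efron–Stein applies (`IsNNKernel.variance_centerSum_le`). The geometric input is that a
point can become the nearest neighbour of at most `γ` others, by dividing space into cones.

Mean. Fatou's lemma and strict concavity of `h` show that the maximizers converge to the true
parameter (`tendsto_of_critI_le`). They are thus eventually interior, so the score, being the
derivative of the criterion, has mean zero (`integral_scoreB_eq_zero`). The `ψ̃` part is a product
of two independent factors, one of which has mean zero because `∫ f_θ = 1` for all `θ`.

Second moment. The substitution `u = 1 - exp(-t/(n-1))` with `t` exponential puts all `n` on one
probability space, where `F_n → 0` almost everywhere by differentiation of measures. Stone's lemma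
bounds ball averages in `L¹` uniformly in `n`, which provides the domination for a version of
Vitali's theorem (`tendsto_lintegral_diffB_sq`).

The functions `h` enter through `IsCrit`, mainly the growth `|v(z)| ≤ a + c z + b z²`. The term `a`
leads to `absAvg` and needs A4 and A5; the term `b` leads to products of relative densities and
gradients and needs A7. The cases of the theorem differ only in which of `a` and `b` vanish. -/

namespace GMSP

/-! ### Bounded measurable functions -/

/-- Bounded measurable real functions. -/
structure BddMeas {α : Type*} [MeasurableSpace α] (Φ : α → ℝ) : Prop where
  measurable : Measurable Φ
  bdd : ∃ C, ∀ a, |Φ a| ≤ C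

namespace BddMeas

variable {α β : Type*} [MeasurableSpace α] [MeasurableSpace β] {Φ Ψ : α → ℝ}

theorem integrable (h : BddMeas Φ) (ν : Measure α) [IsFiniteMeasure ν] : Integrable Φ ν := by
  obtain ⟨C, hC⟩ := h.bdd
  exact Integrable.of_bound h.measurable.aestronglyMeasurable C (.of_forall hC)

theorem const (c : ℝ) : BddMeas (fun _ : α => c) := ⟨measurable_const, |c|, fun _ => le_rfl⟩

theorem add (h : BddMeas Φ) (h' : BddMeas Ψ) : BddMeas (fun a => Φ a + Ψ a) := by
  obtain ⟨C, hC⟩ := h.bdd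
  obtain ⟨D, hD⟩ := h'.bdd
  exact ⟨h.measurable.add h'.measurable, C + D,
    fun a => (abs_add_le _ _).trans (add_le_add (hC a) (hD a))⟩

theorem neg (h : BddMeas Φ) : BddMeas (fun a => -Φ a) := by
  obtain ⟨C, hC⟩ := h.bdd
  exact ⟨h.measurable.neg, C, fun a => by rw [abs_neg]; exact hC a⟩

theorem sub (h : BddMeas Φ) (h' : BddMeas Ψ) : BddMeas (fun a => Φ a - Ψ a) := by
  simpa only [sub_eq_add_neg] using h.add h'.neg

theorem mul (h : BddMeas Φ) (h' : BddMeas Ψ) : BddMeas (fun a => Φ a * Ψ a) := by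
  obtain ⟨C, hC⟩ := h.bdd
  obtain ⟨D, hD⟩ := h'.bdd
  refine ⟨h.measurable.mul h'.measurable, C * D, fun a => ?_⟩
  rw [abs_mul]
  exact mul_le_mul (hC a) (hD a) (abs_nonneg _) ((abs_nonneg _).trans (hC a))

theorem sq (h : BddMeas Φ) : BddMeas (fun a => Φ a ^ 2) := by
  simpa only [pow_two] using h.mul h

theorem sum {ι : Type*} (s : Finset ι) {Φ : ι → α → ℝ} (h : ∀ i ∈ s, BddMeas (Φ i)) :
    BddMeas (fun a => ∑ i ∈ s, Φ i a) := by
  classical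
  induction s using Finset.induction_on with
  | empty => simpa using const (α := α) 0
  | insert i s hi ih =>
    simp only [Finset.sum_insert hi]
    exact (h i (by simp)).add (ih fun j hj => h j (by simp [hj]))

theorem comp (h : BddMeas Φ) {g : β → α} (hg : Measurable g) : BddMeas (fun b => Φ (g b)) := by
  obtain ⟨C, hC⟩ := h.bdd
  exact ⟨h.measurable.comp hg, C, fun b => hC _⟩

theorem integral {Φ : α × β → ℝ} (h : BddMeas Φ) (ν : Measure β) [IsProbabilityMeasure ν] :
    BddMeas (fun a => ∫ b, Φ (a, b) ∂ν) := by
  obtain ⟨C, hC⟩ := h.bdd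
  refine ⟨(h.measurable.stronglyMeasurable.integral_prod_right' (ν := ν)).measurable, C,
    fun a => ?_⟩
  have := norm_integral_le_of_norm_le_const (μ := ν) (C := C) (f := fun b => Φ (a, b))
    (.of_forall fun b => hC (a, b))
  simpa using this

end BddMeas

/-- The square of a mean is at most the mean of the square. -/
theorem sq_integral_le_integral_sq {α : Type*} [MeasurableSpace α] {ν : Measure α}
    [IsProbabilityMeasure ν] {Φ : α → ℝ} (h : BddMeas Φ) :
    (∫ a, Φ a ∂ν) ^ 2 ≤ ∫ a, Φ a ^ 2 ∂ν := by
  have h0 : 0 ≤ ∫ a, (Φ a - ∫ b, Φ b ∂ν) ^ 2 ∂ν := integral_nonneg fun _ => sq_nonneg _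
  set m := ∫ b, Φ b ∂ν with hm
  have h1 : ∀ a, (Φ a - m) ^ 2 = Φ a ^ 2 - 2 * m * Φ a + m ^ 2 := fun a => by ring
  simp only [h1] at h0
  rw [integral_add ((h.sq.sub ((BddMeas.const (2 * m)).mul h)).integrable ν) (integrable_const _),
    integral_sub (h.sq.integrable ν) ((h.integrable ν).const_mul _), integral_const_mul,
    ← hm] at h0
  simp at h0
  nlinarith

/-! ### Resampling one coordinate of an i.i.d. sequence; the Efron–Stein inequality -/

section Resample

variable {X : Type*} [MeasurableSpace X] (μ : Measure X) [IsProbabilityMeasure μ]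

/-- The law of an i.i.d. sequence with marginal law `μ`. -/
noncomputable abbrev seqLaw : Measure (ℕ → X) := Measure.infinitePi (fun _ => μ)

theorem measurable_update_pair (k : ℕ) :
    Measurable (fun p : (ℕ → X) × X => Function.update p.1 k p.2) := by
  refine measurable_pi_iff.2 fun i => ?_
  by_cases h : i = k
  · subst h; simpa using measurable_snd
  · simp only [Function.update_of_ne h]
    exact (measurable_pi_apply i).comp measurable_fst

/-- On cylinder sets the factor of index `k` merely moves from the sequence to the fresh variable.
This is what makes `resample μ k` a conditional expectation. -/
theorem map_update_seqLaw (k : ℕ) :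
    ((seqLaw μ).prod μ).map (fun p => Function.update p.1 k p.2) = seqLaw μ := by
  refine Measure.eq_infinitePi _ fun s t ht => ?_
  rw [Measure.map_apply (measurable_update_pair k)
    (MeasurableSet.pi s.countable_toSet fun i _ => ht i)]
  have : (fun p : (ℕ → X) × X => Function.update p.1 k p.2) ⁻¹' (Set.pi s t) =
      (Set.pi (s.erase k : Finset ℕ) t) ×ˢ (if k ∈ s then t k else Set.univ) := by
    ext ⟨a, y⟩
    simp only [Set.mem_preimage, Set.mem_pi, Set.mem_prod, Finset.mem_coe, Finset.mem_erase]
    constructor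
    · intro h
      refine ⟨fun i hi => by simpa [Function.update_of_ne hi.1] using h i hi.2, ?_⟩
      split_ifs with hk
      · simpa using h k hk
      · trivial
    · rintro ⟨h1, h2⟩ i hi
      by_cases hik : i = k
      · subst hik; simpa [hi] using h2
      · simpa [Function.update_of_ne hik] using h1 i ⟨hik, hi⟩
  rw [this, Measure.prod_prod, Measure.infinitePi_pi _ (fun i _ => ht i)]
  split_ifs with hk
  · rw [mul_comm, Finset.mul_prod_erase s (fun i => μ (t i)) hk]
  · rw [Finset.erase_eq_of_notMem hk]; simp

/-- Integrate out the `k`-th coordinate. -/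
noncomputable def resample (k : ℕ) (Φ : (ℕ → X) → ℝ) (a : ℕ → X) : ℝ :=
  ∫ y, Φ (Function.update a k y) ∂μ

variable {μ} {Φ Y : (ℕ → X) → ℝ}

theorem BddMeas.resample (h : BddMeas Φ) (k : ℕ) : BddMeas (resample μ k Φ) :=
  (h.comp (measurable_update_pair k)).integral μ

theorem integral_resample (h : BddMeas Φ) (k : ℕ) :
    ∫ a, resample μ k Φ a ∂(seqLaw μ) = ∫ a, Φ a ∂(seqLaw μ) := by
  conv_rhs => rw [← map_update_seqLaw μ k]
  rw [integral_map (measurable_update_pair k).aemeasurable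
    h.measurable.aestronglyMeasurable,
    integral_prod _ ((h.comp (measurable_update_pair k)).integrable _)]
  rfl

omit [IsProbabilityMeasure μ] in
theorem resample_mul_left (k : ℕ) (hY : ∀ a y, Y (Function.update a k y) = Y a) (a : ℕ → X) :
    resample μ k (fun a => Y a * Φ a) a = Y a * resample μ k Φ a := by
  simp only [resample, hY, integral_const_mul]

theorem resample_sub (h : BddMeas Φ) (h' : BddMeas Y) (k : ℕ) (a : ℕ → X) :
    resample μ k (fun a => Φ a - Y a) a = resample μ k Φ a - resample μ k Y a := by
  have hm : Measurable (fun y : X => Function.update a k y) := measurable_update a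
  exact integral_sub ((h.comp hm).integrable μ) ((h'.comp hm).integrable μ)

theorem resample_sq_le (h : BddMeas Φ) (k : ℕ) :
    ∫ a, resample μ k Φ a ^ 2 ∂(seqLaw μ) ≤ ∫ a, Φ a ^ 2 ∂(seqLaw μ) := by
  rw [← integral_resample h.sq k]
  refine integral_mono ((h.resample k).sq.integrable _) ((h.sq.resample k).integrable _) fun a => ?_
  exact sq_integral_le_integral_sq (h.comp (measurable_update a))

/-- `resample μ k` is the orthogonal projection onto functions that do not see coordinate `k`, so
`Φ` and its projection have the same inner product with `Y`. Expanding both squares, the defect in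
the inequality is the squared distance of the projection from `Y`. -/
theorem integral_sq_le_resample_add (h : BddMeas Φ) (hY : BddMeas Y) (k : ℕ)
    (hYk : ∀ a y, Y (Function.update a k y) = Y a) :
    ∫ a, Φ a ^ 2 ∂(seqLaw μ) ≤ ∫ a, resample μ k Φ a ^ 2 ∂(seqLaw μ)
      + ∫ a, (Φ a - Y a) ^ 2 ∂(seqLaw μ) := by
  have hR := h.resample (μ := μ) k
  have e1 : ∫ a, Y a * Φ a ∂(seqLaw μ) = ∫ a, Y a * resample μ k Φ a ∂(seqLaw μ) := by
    rw [← integral_resample (hY.mul h) k]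
    exact integral_congr_ae (.of_forall fun a => resample_mul_left k hYk a)
  have e2 : ∀ Z : (ℕ → X) → ℝ, BddMeas Z → ∫ a, (Z a - Y a) ^ 2 ∂(seqLaw μ) =
      ∫ a, Z a ^ 2 ∂(seqLaw μ) - 2 * ∫ a, Y a * Z a ∂(seqLaw μ) + ∫ a, Y a ^ 2 ∂(seqLaw μ) := by
    intro Z hZ
    have : ∀ a, (Z a - Y a) ^ 2 = Z a ^ 2 - 2 * (Y a * Z a) + Y a ^ 2 := fun a => by ring
    simp only [this]
    rw [integral_add ((hZ.sq.sub ((BddMeas.const 2).mul (hY.mul hZ))).integrable _)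
      (hY.sq.integrable _),
      integral_sub (hZ.sq.integrable _) (((hY.mul hZ).integrable _).const_mul _),
      integral_const_mul]
  have h0 : 0 ≤ ∫ a, (resample μ k Φ a - Y a) ^ 2 ∂(seqLaw μ) :=
    integral_nonneg fun _ => sq_nonneg _
  rw [e2 _ h, e1]
  rw [e2 _ hR] at h0
  linarith

omit [IsProbabilityMeasure μ] in
theorem dependsOn_resample {A : Finset ℕ} {k : ℕ} (hk : k ∉ A)
    (hΦ : DependsOn Φ (insert k A : Finset ℕ)) : DependsOn (resample μ k Φ) (A : Set ℕ) := by
  intro a b hab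
  refine integral_congr_ae (.of_forall fun y => hΦ fun i hi => ?_)
  by_cases h : i = k
  · subst h; simp
  · simp only [Function.update_of_ne h]
    refine hab i ?_
    simpa [h] using hi

omit [IsProbabilityMeasure μ] in
theorem resample_update {k l : ℕ} (hkl : k ≠ l) (hY : ∀ a y, Y (Function.update a l y) = Y a)
    (a : ℕ → X) (y : X) : resample μ k Y (Function.update a l y) = resample μ k Y a := by
  refine integral_congr_ae (.of_forall fun z => ?_)
  simp only
  rw [Function.update_comm hkl.symm, hY]

/-- **Efron–Stein inequality**: `Y k` is any function of the coordinates other than `k`. -/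
theorem efron_stein (A : Finset ℕ) {Φ : (ℕ → X) → ℝ} (h : BddMeas Φ)
    (hΦ : DependsOn Φ (A : Set ℕ)) {Y : ℕ → (ℕ → X) → ℝ} (hY : ∀ k ∈ A, BddMeas (Y k))
    (hYk : ∀ k ∈ A, ∀ a y, Y k (Function.update a k y) = Y k a) :
    ∫ a, Φ a ^ 2 ∂(seqLaw μ) ≤ (∫ a, Φ a ∂(seqLaw μ)) ^ 2
      + ∑ k ∈ A, ∫ a, (Φ a - Y k a) ^ 2 ∂(seqLaw μ) := by
  induction A using Finset.induction_on generalizing Φ Y with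
  | empty =>
    have hX : Nonempty X := Measure.nonempty_of_neZero μ
    obtain ⟨c⟩ : Nonempty (ℕ → X) := inferInstance
    have : ∀ a, Φ a = Φ c := fun a => hΦ (by simp)
    simp [this]
  | insert k A hk ih =>
    -- Coordinate `k` is peeled off; the induction hypothesis is applied to the conditional
    -- expectation of `Φ`, with every `Y l` conditioned too. Since conditioning contracts in `L²`,
    -- the errors can be compared with the original ones.
    have h1 := integral_sq_le_resample_add (μ := μ) h (hY k (by simp)) k (hYk k (by simp))
    have h2 := ih (h.resample (μ := μ) k) (dependsOn_resample hk hΦ)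
      (Y := fun l => resample μ k (Y l)) (fun l hl => (hY l (by simp [hl])).resample k)
      (fun l hl => resample_update (by rintro rfl; exact hk hl) (hYk l (by simp [hl])))
    rw [integral_resample h] at h2
    rw [Finset.sum_insert hk]
    have h3 : ∑ l ∈ A, ∫ a, (resample μ k Φ a - resample μ k (Y l) a) ^ 2 ∂(seqLaw μ) ≤
        ∑ l ∈ A, ∫ a, (Φ a - Y l a) ^ 2 ∂(seqLaw μ) := by
      refine Finset.sum_le_sum fun l hl => ?_
      have hl' := hY l (by simp [hl])
      have := resample_sq_le (μ := μ) (h.sub hl') k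
      simpa only [resample_sub h hl'] using this
    linarith

end Resample

/-! ### Calculus on the unit interval: minima of uniform variables -/

/-- Measurable functions on `ℝ` that are bounded on `[0, 1]`. -/
structure BddUnit (f : ℝ → ℝ) : Prop where
  measurable : Measurable f
  bdd : ∃ C, ∀ u ∈ Set.Icc (0 : ℝ) 1, |f u| ≤ C

namespace BddUnit

variable {f g : ℝ → ℝ}

theorem of_continuous (hf : Continuous f) : BddUnit f := by
  refine ⟨hf.measurable, ?_⟩
  obtain ⟨C, hC⟩ := isCompact_Icc.exists_bound_of_continuousOn (s := Set.Icc (0 : ℝ) 1)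
    hf.continuousOn
  exact ⟨C, fun u hu => by simpa using hC u hu⟩

theorem of_bddMeas (hf : BddMeas f) : BddUnit f := by
  obtain ⟨C, hC⟩ := hf.bdd
  exact ⟨hf.measurable, C, fun u _ => hC u⟩

theorem add (h : BddUnit f) (h' : BddUnit g) : BddUnit (fun a => f a + g a) := by
  obtain ⟨C, hC⟩ := h.bdd
  obtain ⟨D, hD⟩ := h'.bdd
  exact ⟨h.measurable.add h'.measurable, C + D,
    fun a ha => (abs_add_le _ _).trans (add_le_add (hC a ha) (hD a ha))⟩

theorem mul (h : BddUnit f) (h' : BddUnit g) : BddUnit (fun a => f a * g a) := by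
  obtain ⟨C, hC⟩ := h.bdd
  obtain ⟨D, hD⟩ := h'.bdd
  refine ⟨h.measurable.mul h'.measurable, C * D, fun a ha => ?_⟩
  rw [abs_mul]
  exact mul_le_mul (hC a ha) (hD a ha) (abs_nonneg _) ((abs_nonneg _).trans (hC a ha))

theorem const (c : ℝ) : BddUnit (fun _ => c) := of_continuous continuous_const

theorem sub (h : BddUnit f) (h' : BddUnit g) : BddUnit (fun a => f a - g a) := by
  simpa [sub_eq_add_neg] using h.add ((const (-1)).mul h')

theorem sq (h : BddUnit f) : BddUnit (fun a => f a ^ 2) := by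
  simpa only [pow_two] using h.mul h

theorem one_sub_pow (N : ℕ) : BddUnit (fun u => (1 - u) ^ N) := of_continuous (by fun_prop)

theorem integrableOn (h : BddUnit f) {a b : ℝ} (ha : 0 ≤ a) (hb : b ≤ 1) :
    IntegrableOn f (Set.Ioc a b) := by
  obtain ⟨C, hC⟩ := h.bdd
  refine Measure.integrableOn_of_bounded (M := C) (by simp)
    h.measurable.aestronglyMeasurable ?_
  filter_upwards [ae_restrict_mem measurableSet_Ioc] with u hu
  exact hC u ⟨ha.trans hu.1.le, hu.2.trans hb⟩

/-- Integrals of a function of two variables over `(0, u]`. -/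
theorem setIntegral {Φ : ℝ × ℝ → ℝ} (hm : Measurable Φ)
    (hb : ∃ C, ∀ u ∈ Set.Icc (0 : ℝ) 1, ∀ w ∈ Set.Icc (0 : ℝ) 1, |Φ (u, w)| ≤ C) :
    BddUnit (fun u => ∫ w in Set.Ioc 0 u, Φ (u, w)) := by
  constructor
  · have : (fun u => ∫ w in Set.Ioc 0 u, Φ (u, w)) =
        fun u => ∫ w, ({p : ℝ × ℝ | 0 < p.2 ∧ p.2 ≤ p.1}.indicator Φ) (u, w) := by
      funext u
      rw [← integral_indicator measurableSet_Ioc]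
      rfl
    rw [this]
    refine (StronglyMeasurable.integral_prod_right' ?_).measurable
    refine (hm.indicator ?_).stronglyMeasurable
    exact (measurableSet_lt measurable_const measurable_snd).inter
      (measurableSet_le measurable_snd measurable_fst)
  · obtain ⟨C, hC⟩ := hb
    refine ⟨C, fun u hu => ?_⟩
    have hC0 : 0 ≤ C := (abs_nonneg _).trans (hC 0 (by simp) 0 (by simp))
    have := norm_setIntegral_le_of_norm_le_const (μ := volume) (s := Set.Ioc 0 u) (C := C)
      (f := fun w => Φ (u, w)) (by simp)
      (fun w hw => hC u hu w ⟨hw.1.le, hw.2.trans hu.2⟩)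
    refine (by simpa using this : |_| ≤ _).trans ?_
    rw [max_eq_left hu.1]
    nlinarith [hu.2]

theorem primitive (h : BddUnit f) : BddUnit (fun u => ∫ w in Set.Ioc 0 u, f w) := by
  obtain ⟨C, hC⟩ := h.bdd
  exact setIntegral (Φ := fun p => f p.2) (h.measurable.comp measurable_snd)
    ⟨C, fun u _ w hw => hC w hw⟩

end BddUnit

/-- Interchange of the order of integration over a triangle. -/
theorem integral_triangle_swap {f g : ℝ → ℝ} (hf : BddUnit f) (hg : BddUnit g) {c : ℝ}
    (hc : c ≤ 1) :
    ∫ u in Set.Ioc 0 c, f u * ∫ w in Set.Ioc 0 u, g w =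
      ∫ w in Set.Ioc 0 c, g w * ∫ u in Set.Ioc w c, f u := by
  set ν := (volume : Measure ℝ).restrict (Set.Ioc 0 c)
  have hswap := integral_integral_swap (μ := ν) (ν := ν)
    (f := fun u w => (Set.Iic u).indicator (fun w => f u * g w) w) ?_
  · convert hswap using 1
    · refine setIntegral_congr_fun measurableSet_Ioc fun u hu => ?_
      rw [integral_indicator measurableSet_Iic, Measure.restrict_restrict measurableSet_Iic,
        integral_const_mul]
      congr 3
      ext w; simp only [Set.mem_Ioc, Set.mem_inter_iff, Set.mem_Iic]
      exact ⟨fun h => ⟨h.2, h.1, h.2.trans hu.2⟩, fun h => ⟨h.2.1, h.1⟩⟩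
    · refine setIntegral_congr_fun measurableSet_Ioc fun w hw => ?_
      have : ∀ u, (Set.Iic u).indicator (fun w => f u * g w) w =
          (Set.Ici w).indicator (fun u => g w * f u) u := fun u => by
        simp only [Set.indicator, Set.mem_Iic, Set.mem_Ici, mul_comm]
      simp only [this]
      rw [integral_indicator measurableSet_Ici, Measure.restrict_restrict measurableSet_Ici,
        integral_const_mul]
      have : (∫ u in Set.Ioc w c, f u) = ∫ u in Set.Icc w c, f u :=
        (integral_Icc_eq_integral_Ioc).symm
      rw [this]
      congr 3
      ext u; simp only [Set.mem_Icc, Set.mem_inter_iff, Set.mem_Ici, Set.mem_Ioc]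
      exact ⟨fun h => ⟨h.1, hw.1.trans_le h.1, h.2⟩, fun h => ⟨h.1, h.2.2⟩⟩
  · obtain ⟨C, hC⟩ := hf.bdd
    obtain ⟨D, hD⟩ := hg.bdd
    have hm : Measurable (Function.uncurry fun u w =>
        (Set.Iic u).indicator (fun w => f u * g w) w) := by
      have : (Function.uncurry fun u w => (Set.Iic u).indicator (fun w => f u * g w) w) =
          {p : ℝ × ℝ | p.2 ≤ p.1}.indicator (fun p => f p.1 * g p.2) := by
        ext ⟨u, w⟩; rfl
      rw [this]
      exact ((hf.measurable.comp measurable_fst).mul (hg.measurable.comp measurable_snd)).indicator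
        (measurableSet_le measurable_snd measurable_fst)
    refine Integrable.of_bound hm.aestronglyMeasurable (C * D) ?_
    have hmem : ∀ᵐ p ∂(ν.prod ν), p ∈ Set.Ioc 0 c ×ˢ Set.Ioc 0 c := by
      rw [Measure.prod_restrict]
      exact ae_restrict_mem (measurableSet_Ioc.prod measurableSet_Ioc)
    filter_upwards [hmem] with p hp
    have hp1 : p.1 ∈ Set.Icc (0 : ℝ) 1 := ⟨hp.1.1.le, hp.1.2.trans hc⟩
    have hp2 : p.2 ∈ Set.Icc (0 : ℝ) 1 := ⟨hp.2.1.le, hp.2.2.trans hc⟩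
    refine (norm_indicator_le_norm_self (fun w => f p.1 * g w) p.2).trans ?_
    rw [Real.norm_eq_abs, abs_mul]
    exact mul_le_mul (hC _ hp1) (hD _ hp2) (abs_nonneg _) ((abs_nonneg _).trans (hC _ hp1))

theorem integral_one_sub_pow (N : ℕ) {a b : ℝ} (hab : a ≤ b) :
    ((N : ℝ) + 1) * ∫ u in Set.Ioc a b, (1 - u) ^ N = (1 - a) ^ (N + 1) - (1 - b) ^ (N + 1) := by
  rw [← intervalIntegral.integral_of_le hab,
    intervalIntegral.integral_comp_sub_left (fun x => x ^ N) 1, integral_pow]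
  field_simp

/-- Mean of `g (min u W)` for `W` uniformly distributed on `(0, 1)`. -/
noncomputable def avgMin (g : ℝ → ℝ) (u : ℝ) : ℝ := ∫ w in Set.Ioc 0 1, g (min u w)

theorem avgMin_eq {g : ℝ → ℝ} (hg : BddUnit g) {u : ℝ} (hu : u ∈ Set.Icc (0 : ℝ) 1) :
    avgMin g u = (∫ w in Set.Ioc 0 u, g w) + (1 - u) * g u := by
  have hcongr1 : Set.EqOn (fun w => g (min u w)) g (Set.Ioc 0 u) := fun w hw => by
    simp [min_eq_right hw.2]
  have hcongr2 : Set.EqOn (fun w => g (min u w)) (fun _ => g u) (Set.Ioc u 1) := fun w hw => by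
    simp [min_eq_left hw.1.le]
  rw [avgMin, ← Set.Ioc_union_Ioc_eq_Ioc hu.1 hu.2,
    setIntegral_union (Set.Ioc_disjoint_Ioc_of_le le_rfl) measurableSet_Ioc,
    setIntegral_congr_fun measurableSet_Ioc hcongr1,
    setIntegral_congr_fun measurableSet_Ioc hcongr2]
  · simp [hu.2]
  · exact (hg.integrableOn le_rfl hu.2).congr_fun hcongr1.symm measurableSet_Ioc
  · exact (integrableOn_const (by simp)).congr_fun hcongr2.symm measurableSet_Ioc

theorem avgMin_congr {g g' : ℝ → ℝ} (h : Set.EqOn g g' (Set.Icc 0 1)) :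
    Set.EqOn (avgMin g) (avgMin g') (Set.Icc 0 1) := fun u hu => by
  refine setIntegral_congr_fun measurableSet_Ioc fun w hw => ?_
  exact h ⟨le_min hu.1 hw.1.le, (min_le_left _ _).trans hu.2⟩

/-- The minimum of `N` uniform variables exceeds `u` with probability `(1 - u)^N` and otherwise has
density `N (1 - s)^(N - 1)`. For `N = 0` the truncated exponent is harmless because of the factor
`N`. -/
theorem iterate_avgMin_eq {g : ℝ → ℝ} (hg : BddUnit g) (N : ℕ) :
    ∀ u ∈ Set.Icc (0 : ℝ) 1, avgMin^[N] g u =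
      g u * (1 - u) ^ N + ∫ s in Set.Ioc 0 u, N * (g s * (1 - s) ^ (N - 1)) := by
  induction N with
  | zero => intro u _; simp
  | succ N ih =>
    intro u hu
    rw [Function.iterate_succ_apply', avgMin_congr ih hu]
    have hp : BddUnit fun s => N * (g s * (1 - s) ^ (N - 1)) :=
      (BddUnit.const _).mul (hg.mul (.one_sub_pow _))
    have hgp : BddUnit fun s => g s * (1 - s) ^ N := hg.mul (.one_sub_pow _)
    rw [avgMin_eq (hgp.add hp.primitive) hu,
      integral_add (hgp.integrableOn le_rfl hu.2) (hp.primitive.integrableOn le_rfl hu.2)]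
    -- The primitive of a primitive becomes one integral with kernel `u - w`.
    have hs := integral_triangle_swap (BddUnit.const 1) hp hu.2
    simp only [one_mul] at hs
    rw [hs]
    have h1 : ∀ w ∈ Set.Ioc 0 u, N * (g w * (1 - w) ^ (N - 1)) * ∫ _ in Set.Ioc w u, (1 : ℝ) =
        N * (g w * (1 - w) ^ (N - 1)) * (u - w) := fun w hw => by
      simp [hw.2]
    rw [setIntegral_congr_fun measurableSet_Ioc h1]
    have hq : BddUnit fun w => N * (g w * (1 - w) ^ (N - 1)) * (u - w) :=
      hp.mul (.of_continuous (by fun_prop))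
    have h2 : ∫ s in Set.Ioc 0 u, ((N + 1 : ℕ) : ℝ) * (g s * (1 - s) ^ (N + 1 - 1)) =
        ∫ s in Set.Ioc 0 u, (g s * (1 - s) ^ N + (N * (g s * (1 - s) ^ (N - 1)) * (u - s) +
          (1 - u) * (N * (g s * (1 - s) ^ (N - 1))))) := by
      refine setIntegral_congr_fun measurableSet_Ioc fun s _ => ?_
      rcases N with _ | N
      · simp
      · simp only [Nat.add_sub_cancel]; push_cast; ring
    rw [h2, integral_add (hgp.integrableOn le_rfl hu.2)
      ((hq.add ((BddUnit.const (1 - u)).mul hp)).integrableOn le_rfl hu.2),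
      integral_add (hq.integrableOn le_rfl hu.2)
      (((BddUnit.const (1 - u)).mul hp).integrableOn le_rfl hu.2), integral_const_mul (1 - u)]
    generalize (∫ s in Set.Ioc 0 u, N * (g s * (1 - s) ^ (N - 1)) * (u - s)) = A
    generalize (∫ s in Set.Ioc 0 u, N * (g s * (1 - s) ^ (N - 1))) = B
    generalize (∫ s in Set.Ioc 0 u, g s * (1 - s) ^ N) = D
    ring

theorem iterate_avgMin_one {g : ℝ → ℝ} (hg : BddUnit g) {N : ℕ} (hN : N ≠ 0) :
    avgMin^[N] g 1 = N * ∫ s in Set.Ioc 0 1, g s * (1 - s) ^ (N - 1) := by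
  rw [iterate_avgMin_eq hg N 1 (by simp), integral_const_mul]
  simp [hN]

/-- Cauchy–Schwarz inequality with a weight. -/
theorem sq_setIntegral_mul_le {f ρ : ℝ → ℝ} (hf : BddUnit f) (hρ : BddUnit ρ)
    (hρ0 : ∀ u ∈ Set.Icc (0 : ℝ) 1, 0 ≤ ρ u) {a b : ℝ} (ha : 0 ≤ a) (hb : b ≤ 1) :
    (∫ s in Set.Ioc a b, f s * ρ s) ^ 2 ≤
      (∫ s in Set.Ioc a b, f s ^ 2 * ρ s) * ∫ s in Set.Ioc a b, ρ s := by
  -- A quadratic polynomial in `c` that is nowhere negative has nonpositive discriminant.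
  have key : ∀ c : ℝ, 0 ≤ (∫ s in Set.Ioc a b, ρ s) * (c * c) +
      (-2 * ∫ s in Set.Ioc a b, f s * ρ s) * c + ∫ s in Set.Ioc a b, f s ^ 2 * ρ s := by
    intro c
    have h0 : 0 ≤ ∫ s in Set.Ioc a b, (f s - c) ^ 2 * ρ s :=
      setIntegral_nonneg measurableSet_Ioc fun s hs =>
        mul_nonneg (sq_nonneg _) (hρ0 s ⟨ha.trans hs.1.le, hs.2.trans hb⟩)
    have h1 : ∀ s, (f s - c) ^ 2 * ρ s = c * c * ρ s + (-2 * c) * (f s * ρ s) + f s ^ 2 * ρ s :=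
      fun s => by ring
    simp only [h1] at h0
    rw [integral_add ((((BddUnit.const _).mul hρ).add
        ((BddUnit.const _).mul (hf.mul hρ))).integrableOn ha hb)
        ((hf.sq.mul hρ).integrableOn ha hb),
      integral_add (((BddUnit.const _).mul hρ).integrableOn ha hb)
        (((BddUnit.const _).mul (hf.mul hρ)).integrableOn ha hb),
      integral_const_mul, integral_const_mul] at h0
    linarith
  have := discrim_le_zero key
  rw [discrim] at this
  nlinarith

theorem BddMeas.avgMin {X : Type*} [MeasurableSpace X] {G : X → ℝ → ℝ}
    (hG : BddMeas (fun p : X × ℝ => G p.1 p.2)) :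
    BddMeas (fun p : X × ℝ => avgMin (G p.1) p.2) := by
  have : IsProbabilityMeasure ((volume : Measure ℝ).restrict (Set.Ioc 0 1)) := ⟨by simp⟩
  exact BddMeas.integral (Φ := fun p : (X × ℝ) × ℝ => G p.1.1 (min p.1.2 p.2))
    (hG.comp (g := fun p : (X × ℝ) × ℝ => (p.1.1, min p.1.2 p.2)) (by fun_prop)) _

theorem BddMeas.iterate_avgMin {X : Type*} [MeasurableSpace X] {G : X → ℝ → ℝ}
    (hG : BddMeas (fun p : X × ℝ => G p.1 p.2)) (N : ℕ) :
    BddMeas (fun p : X × ℝ => GMSP.avgMin^[N] (G p.1) p.2) := by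
  induction N with
  | zero => simpa using hG
  | succ N ih => simp only [Function.iterate_succ_apply']; exact BddMeas.avgMin (G := fun x => GMSP.avgMin^[N] (G x)) ih

/-- Mean square of the change of `g u` when `u` is replaced by its minimum with an independent
uniform variable. -/
noncomputable def sqIncr (g : ℝ → ℝ) (u : ℝ) : ℝ :=
  ∫ w in Set.Ioc 0 1, (g (min u w) - g u) ^ 2

theorem BddMeas.sqIncr {X : Type*} [MeasurableSpace X] {G : X → ℝ → ℝ}
    (hG : BddMeas (fun p : X × ℝ => G p.1 p.2)) :
    BddMeas (fun p : X × ℝ => sqIncr (G p.1) p.2) := by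
  have : IsProbabilityMeasure ((volume : Measure ℝ).restrict (Set.Ioc 0 1)) := ⟨by simp⟩
  refine BddMeas.integral (Φ := fun p : (X × ℝ) × ℝ => (G p.1.1 (min p.1.2 p.2) - G p.1.1 p.1.2) ^ 2)
    (BddMeas.sq (BddMeas.sub ?_ ?_)) _
  · exact hG.comp (g := fun p : (X × ℝ) × ℝ => (p.1.1, min p.1.2 p.2)) (by fun_prop)
  · exact hG.comp (g := fun p : (X × ℝ) × ℝ => p.1) (by fun_prop)

theorem sqIncr_eq {g : ℝ → ℝ} (hg : BddUnit g) {u : ℝ} (hu : u ∈ Set.Icc (0 : ℝ) 1) :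
    sqIncr g u = ∫ w in Set.Ioc 0 u, (g w - g u) ^ 2 := by
  have hb : BddUnit fun w => (g w - g u) ^ 2 := (hg.sub (.const _)).sq
  have h1 : Set.EqOn (fun w => (g (min u w) - g u) ^ 2) (fun w => (g w - g u) ^ 2)
      (Set.Ioc 0 u) := fun w hw => by simp [min_eq_right hw.2]
  have h2 : Set.EqOn (fun w => (g (min u w) - g u) ^ 2) (fun _ => 0)
      (Set.Ioc u 1) := fun w hw => by simp [min_eq_left hw.1.le]
  rw [sqIncr, ← Set.Ioc_union_Ioc_eq_Ioc hu.1 hu.2,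
    setIntegral_union (Set.Ioc_disjoint_Ioc_of_le le_rfl) measurableSet_Ioc,
    setIntegral_congr_fun measurableSet_Ioc h1, setIntegral_congr_fun measurableSet_Ioc h2]
  · simp
  · exact (hb.integrableOn le_rfl hu.2).congr_fun h1.symm measurableSet_Ioc
  · exact (integrableOn_const (by simp)).congr_fun h2.symm measurableSet_Ioc

theorem setIntegral_natCast_mul_one_sub_pow_le (N : ℕ) {a b : ℝ} (hab : a ≤ b) (hb : b ≤ 1) :
    ∫ s in Set.Ioc a b, (N : ℝ) * (1 - s) ^ (N - 1) ≤ (1 - a) ^ N := by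
  rw [integral_const_mul]
  rcases N with _ | N
  · simp
  · have := integral_one_sub_pow N hab
    push_cast
    refine this.trans_le ?_
    have : 0 ≤ (1 - b) ^ (N + 1) := pow_nonneg (by linarith) _
    linarith

/-- By the closed form the difference consists of two boundary terms and an integral over `(w, u]`.
Cauchy–Schwarz with the weight `N (1 - s)^(N - 1)`, whose mass on `(w, u]` is at most `(1 - w)^N`,
handles the integral; the factor 3 comes from squaring three summands. -/
theorem sq_iterate_avgMin_sub_le {f : ℝ → ℝ} (hf : BddUnit f) (N : ℕ) {w u : ℝ} (hw : 0 ≤ w)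
    (hwu : w ≤ u) (hu : u ≤ 1) :
    (avgMin^[N] f w - avgMin^[N] f u) ^ 2 ≤ 3 * (f w ^ 2 * (1 - w) ^ (2 * N)
      + f u ^ 2 * (1 - u) ^ (2 * N)
      + (1 - w) ^ N * ∫ s in Set.Ioc w u, f s ^ 2 * (N * (1 - s) ^ (N - 1))) := by
  have hρ : BddUnit fun s => (N : ℝ) * (1 - s) ^ (N - 1) := (BddUnit.const _).mul (.one_sub_pow _)
  have hρ0 : ∀ s ∈ Set.Icc (0 : ℝ) 1, 0 ≤ (N : ℝ) * (1 - s) ^ (N - 1) := fun s hs =>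
    mul_nonneg (by positivity) (pow_nonneg (by linarith [hs.2]) _)
  have hcs := sq_setIntegral_mul_le hf hρ hρ0 hw hu
  have hI := setIntegral_natCast_mul_one_sub_pow_le N hwu hu
  have hnn : 0 ≤ ∫ s in Set.Ioc w u, f s ^ 2 * (N * (1 - s) ^ (N - 1)) :=
    setIntegral_nonneg measurableSet_Ioc fun s hs =>
      mul_nonneg (sq_nonneg _) (hρ0 s ⟨hw.trans hs.1.le, hs.2.trans hu⟩)
  have hcs' := hcs.trans (mul_le_mul_of_nonneg_left hI hnn)
  rw [iterate_avgMin_eq hf N w ⟨hw, hwu.trans hu⟩, iterate_avgMin_eq hf N u ⟨hw.trans hwu, hu⟩,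
    ← Set.Ioc_union_Ioc_eq_Ioc hw hwu, setIntegral_union (Set.Ioc_disjoint_Ioc_of_le le_rfl)
      measurableSet_Ioc]
  · have hc : ∫ s in Set.Ioc w u, (N : ℝ) * (f s * (1 - s) ^ (N - 1)) =
        ∫ s in Set.Ioc w u, f s * (N * (1 - s) ^ (N - 1)) := by
      congr 1; ext s; ring
    rw [hc]
    set D := ∫ s in Set.Ioc w u, f s * (N * (1 - s) ^ (N - 1))
    have e1 : f w ^ 2 * (1 - w) ^ (2 * N) = (f w * (1 - w) ^ N) ^ 2 := by ring
    have e2 : f u ^ 2 * (1 - u) ^ (2 * N) = (f u * (1 - u) ^ N) ^ 2 := by ring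
    rw [e1, e2]
    set A := f w * (1 - w) ^ N
    set B := f u * (1 - u) ^ N
    nlinarith [sq_nonneg (A + B), sq_nonneg (A + D), sq_nonneg (B - D)]
  · exact ((BddUnit.const _).mul (hf.mul (.one_sub_pow _))).integrableOn le_rfl (hwu.trans hu)
  · exact ((BddUnit.const _).mul (hf.mul (.one_sub_pow _))).integrableOn hw hu

/-- The bound for the squared difference is integrated over `w`. In the double integral Fubini
places `∫ w in (0, s], (1 - w)^N ≤ 1/(N + 1)` next to the factor `N`, which is thereby absorbed:
this is the gain from smoothing. -/
theorem sqIncr_iterate_avgMin_le {f : ℝ → ℝ} (hf : BddMeas f) (N : ℕ) {u : ℝ}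
    (hu : u ∈ Set.Icc (0 : ℝ) 1) :
    sqIncr (avgMin^[N] f) u ≤ 3 * ((∫ w in Set.Ioc 0 u, f w ^ 2 * (1 - w) ^ (2 * N))
      + f u ^ 2 * (1 - u) ^ (2 * N) * u
      + ∫ s in Set.Ioc 0 u, f s ^ 2 * (1 - s) ^ (N - 1)) := by
  have hfu : BddUnit f := .of_bddMeas hf
  have hg : BddUnit (avgMin^[N] f) := .of_bddMeas <|
    ((BddMeas.iterate_avgMin (X := Unit) (G := fun _ => f) (hf.comp measurable_snd) N).comp
      (g := fun u => ((), u)) (by fun_prop))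
  have hp : BddUnit fun s => f s ^ 2 * (N * (1 - s) ^ (N - 1)) :=
    hfu.sq.mul ((BddUnit.const _).mul (.one_sub_pow _))
  have hA : BddUnit fun w => f w ^ 2 * (1 - w) ^ (2 * N) := hfu.sq.mul (.one_sub_pow _)
  rw [sqIncr_eq hg hu]
  have hswap := integral_triangle_swap hp (.one_sub_pow N) hu.2
  have hprim : BddUnit fun w => ∫ s in Set.Ioc 0 w, f s ^ 2 * (N * (1 - s) ^ (N - 1)) :=
    hp.primitive
  -- the integral over `(w, u]` as a difference of primitives
  have hsub : ∀ w ∈ Set.Ioc 0 u, ∫ s in Set.Ioc w u, f s ^ 2 * (N * (1 - s) ^ (N - 1)) =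
      (∫ s in Set.Ioc 0 u, f s ^ 2 * (N * (1 - s) ^ (N - 1)))
        - ∫ s in Set.Ioc 0 w, f s ^ 2 * (N * (1 - s) ^ (N - 1)) := fun w hw => by
    rw [← Set.Ioc_union_Ioc_eq_Ioc hw.1.le hw.2, setIntegral_union
      (Set.Ioc_disjoint_Ioc_of_le le_rfl) measurableSet_Ioc
      (hp.integrableOn le_rfl (hw.2.trans hu.2)) (hp.integrableOn hw.1.le hu.2)]
    ring
  have hC : IntegrableOn (fun w => (1 - w) ^ N *
      ∫ s in Set.Ioc w u, f s ^ 2 * (N * (1 - s) ^ (N - 1))) (Set.Ioc 0 u) := by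
    refine IntegrableOn.congr_fun (f := fun w => (1 - w) ^ N *
      ((∫ s in Set.Ioc 0 u, f s ^ 2 * (N * (1 - s) ^ (N - 1)))
        - ∫ s in Set.Ioc 0 w, f s ^ 2 * (N * (1 - s) ^ (N - 1)))) ?_ ?_ measurableSet_Ioc
    · exact ((BddUnit.one_sub_pow N).mul ((BddUnit.const _).sub hprim)).integrableOn le_rfl hu.2
    · intro w hw; simp only; rw [hsub w hw]
  have hAI := hA.integrableOn le_rfl hu.2
  have hBI : IntegrableOn (fun _ => f u ^ 2 * (1 - u) ^ (2 * N)) (Set.Ioc 0 u) :=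
    integrableOn_const (by simp)
  calc ∫ w in Set.Ioc 0 u, (avgMin^[N] f w - avgMin^[N] f u) ^ 2
      ≤ ∫ w in Set.Ioc 0 u, 3 * (f w ^ 2 * (1 - w) ^ (2 * N) + f u ^ 2 * (1 - u) ^ (2 * N)
          + (1 - w) ^ N * ∫ s in Set.Ioc w u, f s ^ 2 * (N * (1 - s) ^ (N - 1))) := by
        refine setIntegral_mono_on ((hg.sub (.const _)).sq.integrableOn le_rfl hu.2) ?_
          measurableSet_Ioc fun w hw =>
            sq_iterate_avgMin_sub_le hfu N hw.1.le hw.2 hu.2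
        exact ((hAI.add hBI).add hC).const_mul 3
    _ = 3 * ((∫ w in Set.Ioc 0 u, f w ^ 2 * (1 - w) ^ (2 * N))
          + f u ^ 2 * (1 - u) ^ (2 * N) * u
          + ∫ s in Set.Ioc 0 u, f s ^ 2 * (N * (1 - s) ^ (N - 1)) *
              ∫ w in Set.Ioc 0 s, (1 - w) ^ N) := by
        have hABI : IntegrableOn (fun w => f w ^ 2 * (1 - w) ^ (2 * N)
            + f u ^ 2 * (1 - u) ^ (2 * N)) (Set.Ioc 0 u) := hAI.add hBI
        rw [integral_const_mul, integral_add hABI hC, integral_add hAI hBI, hswap]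
        congr 3
        rw [setIntegral_const, Real.volume_real_Ioc_of_le hu.1, smul_eq_mul, sub_zero, mul_comm]
    _ ≤ _ := by
        refine mul_le_mul_of_nonneg_left (add_le_add le_rfl ?_) (by norm_num)
        refine setIntegral_mono_on ?_ ?_ measurableSet_Ioc fun s hs => ?_
        · exact (hp.mul (BddUnit.one_sub_pow N).primitive).integrableOn le_rfl hu.2
        · exact (hfu.sq.mul (.one_sub_pow _)).integrableOn le_rfl hu.2
        · have h1 := integral_one_sub_pow N hs.1.le
          have h2 : (0 : ℝ) ≤ (1 - s) ^ (N + 1) := pow_nonneg (by linarith [hs.2, hu.2]) _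
          have h3 : (0 : ℝ) ≤ (1 - s) ^ (N - 1) := pow_nonneg (by linarith [hs.2, hu.2]) _
          have h4 : 0 ≤ ∫ w in Set.Ioc 0 s, (1 - w) ^ N :=
            setIntegral_nonneg measurableSet_Ioc fun w hw =>
              pow_nonneg (by linarith [hs.2, hu.2, hw.2]) _
          have h5 : N * ∫ w in Set.Ioc 0 s, (1 - w) ^ N ≤ 1 := by
            norm_num at h1
            linarith
          calc f s ^ 2 * (N * (1 - s) ^ (N - 1)) * ∫ w in Set.Ioc 0 s, (1 - w) ^ N
              = f s ^ 2 * (1 - s) ^ (N - 1) * (N * ∫ w in Set.Ioc 0 s, (1 - w) ^ N) := by ring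
            _ ≤ f s ^ 2 * (1 - s) ^ (N - 1) * 1 :=
                mul_le_mul_of_nonneg_left h5 (mul_nonneg (sq_nonneg _) h3)
            _ = _ := mul_one _

/-- Integration against the density of the minimum of `K` uniform variables. -/
theorem integral_primitive_mul_density {f : ℝ → ℝ} (hf : BddUnit f) {K : ℕ} (hK : K ≠ 0) :
    K * ∫ u in Set.Ioc 0 1, (∫ w in Set.Ioc 0 u, f w) * (1 - u) ^ (K - 1) =
      ∫ w in Set.Ioc 0 1, f w * (1 - w) ^ K := by
  have h := integral_triangle_swap (f := fun u => (1 - u) ^ (K - 1)) (.one_sub_pow _) hf le_rfl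
  have h' : ∀ u, (∫ w in Set.Ioc 0 u, f w) * (1 - u) ^ (K - 1) =
      (1 - u) ^ (K - 1) * ∫ w in Set.Ioc 0 u, f w := fun u => mul_comm _ _
  simp only [h']
  rw [h, ← integral_const_mul]
  refine setIntegral_congr_fun measurableSet_Ioc fun w hw => ?_
  obtain ⟨K, rfl⟩ := Nat.exists_eq_succ_of_ne_zero hK
  have := integral_one_sub_pow K hw.2
  simp only [Nat.succ_eq_add_one, Nat.add_sub_cancel]
  push_cast
  rw [mul_left_comm, this]
  simp

/-- The weight is the density of the minimum of `K` uniform variables. Against it the primitives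
turn back into plain integrals without a factor `K`; only the boundary term at `u` keeps one, as `K
s (1 - s)^N`. That factor becomes harmless after summation over `N`, or when `K` is at most of order
`N`. -/
theorem integral_sqIncr_le {f : ℝ → ℝ} (hf : BddMeas f) (hsupp : ∀ u, 1 / 2 < u → f u = 0)
    {K : ℕ} (hK : K ≠ 0) (N : ℕ) :
    K * ∫ u in Set.Ioc 0 1, sqIncr (avgMin^[N] f) u * (1 - u) ^ (K - 1) ≤
      9 * (∫ s in Set.Ioc 0 1, f s ^ 2 * (1 - s) ^ (K + N))
      + 6 * ∫ s in Set.Ioc 0 1, f s ^ 2 * (1 - s) ^ (K + N) * (K * (s * (1 - s) ^ N)) := by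
  have hfu : BddUnit f := .of_bddMeas hf
  have hS : BddUnit (sqIncr (avgMin^[N] f)) := .of_bddMeas <|
    ((BddMeas.sqIncr (X := Unit) (G := fun _ => avgMin^[N] f) (BddMeas.iterate_avgMin (X := Unit) (G := fun _ => f)
      (hf.comp measurable_snd) N)).comp (g := fun u => ((), u)) (by fun_prop))
  have hA : BddUnit fun w => f w ^ 2 * (1 - w) ^ (2 * N) := hfu.sq.mul (.one_sub_pow _)
  have hB : BddUnit fun u => f u ^ 2 * (1 - u) ^ (2 * N) * u :=
    hA.mul (.of_continuous continuous_id)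
  have hC : BddUnit fun s => f s ^ 2 * (1 - s) ^ (N - 1) := hfu.sq.mul (.one_sub_pow _)
  have hQ : BddUnit fun s => f s ^ 2 * (1 - s) ^ (K + N) := hfu.sq.mul (.one_sub_pow _)
  have hW : BddUnit fun s => f s ^ 2 * (1 - s) ^ (K + N) * (K * (s * (1 - s) ^ N)) :=
    hQ.mul (.of_continuous (by fun_prop))
  have hK1 : (0 : ℝ) < K := by positivity
  have I01 {g : ℝ → ℝ} (hg : BddUnit g) : IntegrableOn g (Set.Ioc 0 1) :=
    hg.integrableOn le_rfl le_rfl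
  have step1 : K * ∫ u in Set.Ioc 0 1, sqIncr (avgMin^[N] f) u * (1 - u) ^ (K - 1) ≤
      3 * ((∫ w in Set.Ioc 0 1, f w ^ 2 * (1 - w) ^ (2 * N) * (1 - w) ^ K)
        + (∫ u in Set.Ioc 0 1, K * (f u ^ 2 * (1 - u) ^ (2 * N) * u * (1 - u) ^ (K - 1)))
        + ∫ s in Set.Ioc 0 1, f s ^ 2 * (1 - s) ^ (N - 1) * (1 - s) ^ K) := by
    rw [← integral_primitive_mul_density hA hK, ← integral_primitive_mul_density hC hK,
      integral_const_mul, ← mul_add, ← mul_add, mul_left_comm]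
    refine mul_le_mul_of_nonneg_left ?_ hK1.le
    rw [← integral_add (I01 (hA.primitive.mul (.one_sub_pow _))) (I01 (hB.mul (.one_sub_pow _))),
      ← integral_add (I01 ((hA.primitive.mul (.one_sub_pow _)).add (hB.mul (.one_sub_pow _))))
        (I01 (hC.primitive.mul (.one_sub_pow _))), ← integral_const_mul]
    refine setIntegral_mono_on (I01 (hS.mul (.one_sub_pow _))) ?_ measurableSet_Ioc fun u hu => ?_
    · exact I01 ((BddUnit.const 3).mul (((hA.primitive.mul (.one_sub_pow _)).add
        (hB.mul (.one_sub_pow _))).add (hC.primitive.mul (.one_sub_pow _))))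
    · have := mul_le_mul_of_nonneg_right
        (sqIncr_iterate_avgMin_le hf N (u := u) ⟨hu.1.le, hu.2⟩)
        (pow_nonneg (by linarith [hu.2]) (K - 1) : (0 : ℝ) ≤ (1 - u) ^ (K - 1))
      refine this.trans (le_of_eq ?_)
      ring
  -- Two exponents come out one too small. On `s ≤ 1/2` a power of `1 - s` costs a factor 2, which
  -- is the purpose of the support condition.
  have hpow : ∀ s ∈ Set.Ioc (0 : ℝ) 1, ∀ n, f s ^ 2 * (1 - s) ^ (n - 1) ≤
      2 * (f s ^ 2 * (1 - s) ^ n) := fun s hs n => by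
    rcases lt_or_ge (1 / 2) s with h | h
    · simp [hsupp s h]
    · rcases n with _ | n
      · simp; nlinarith [sq_nonneg (f s)]
      · have h0 : (0 : ℝ) ≤ (1 - s) ^ n := pow_nonneg (by linarith) _
        have h1 : 0 ≤ f s ^ 2 * (1 - s) ^ n := mul_nonneg (sq_nonneg _) h0
        simp only [Nat.add_sub_cancel, pow_succ (1 - s)]
        nlinarith
  have b1 : (∫ w in Set.Ioc 0 1, f w ^ 2 * (1 - w) ^ (2 * N) * (1 - w) ^ K) ≤
      ∫ s in Set.Ioc 0 1, f s ^ 2 * (1 - s) ^ (K + N) := by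
    refine setIntegral_mono_on (I01 (hA.mul (.one_sub_pow _))) (I01 hQ) measurableSet_Ioc
      fun s hs => ?_
    rw [mul_assoc, ← pow_add]
    refine mul_le_mul_of_nonneg_left ?_ (sq_nonneg _)
    exact pow_le_pow_of_le_one (by linarith [hs.2]) (by linarith [hs.1]) (by omega)
  have b2 : (∫ u in Set.Ioc 0 1, K * (f u ^ 2 * (1 - u) ^ (2 * N) * u * (1 - u) ^ (K - 1))) ≤
      2 * ∫ s in Set.Ioc 0 1, f s ^ 2 * (1 - s) ^ (K + N) * (K * (s * (1 - s) ^ N)) := by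
    rw [← integral_const_mul]
    refine setIntegral_mono_on (I01 ((BddUnit.const _).mul (hB.mul (.one_sub_pow _))))
      (I01 ((BddUnit.const _).mul hW)) measurableSet_Ioc fun s hs => ?_
    have h0 : (0 : ℝ) ≤ K * (s * (1 - s) ^ (2 * N)) :=
      mul_nonneg hK1.le (mul_nonneg hs.1.le (pow_nonneg (by linarith [hs.2]) _))
    have := mul_le_mul_of_nonneg_right (hpow s hs K) h0
    calc (K : ℝ) * (f s ^ 2 * (1 - s) ^ (2 * N) * s * (1 - s) ^ (K - 1))
        = f s ^ 2 * (1 - s) ^ (K - 1) * (K * (s * (1 - s) ^ (2 * N))) := by ring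
      _ ≤ _ := this
      _ = _ := by ring
  have b3 : (∫ s in Set.Ioc 0 1, f s ^ 2 * (1 - s) ^ (N - 1) * (1 - s) ^ K) ≤
      2 * ∫ s in Set.Ioc 0 1, f s ^ 2 * (1 - s) ^ (K + N) := by
    rw [← integral_const_mul]
    refine setIntegral_mono_on (I01 (hC.mul (.one_sub_pow _)))
      (I01 ((BddUnit.const _).mul hQ)) measurableSet_Ioc fun s hs => ?_
    have h0 : (0 : ℝ) ≤ (1 - s) ^ K := pow_nonneg (by linarith [hs.2]) _
    have := mul_le_mul_of_nonneg_right (hpow s hs N) h0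
    refine this.trans (le_of_eq ?_)
    ring
  linarith

/-! ### Sums over nearest neighbour pairs: adding one point -/

section Variance

variable {X : Type*} [MeasurableSpace X]

/-- `κ x y` measures how far `y` is from `x`: for each `x` it is uniformly distributed when `y` has
law `μ`, and a point can be the nearest neighbour of at most `γ` points. -/
structure IsNNKernel (μ : Measure X) (κ : X → X → ℝ) (γ : ℕ) : Prop where
  measurable : Measurable (fun p : X × X => κ p.1 p.2)
  map_eq : ∀ x, μ.map (κ x) = (volume : Measure ℝ).restrict (Set.Ioc 0 1)
  card_le : ∀ (A : Finset ℕ) (a : ℕ → X) (y : X),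
    (A.filter fun i => ∀ j ∈ A, j ≠ i → κ (a i) y < κ (a i) (a j)).card ≤ γ

/-- The minimum of `κ x (a j)`, `j ∈ s`. -/
noncomputable def minOver (κ : X → X → ℝ) (s : Finset ℕ) (x : X) (a : ℕ → X) : ℝ :=
  s.fold min 1 (fun j => κ x (a j))

/-- The sum over `i ∈ A` of a function of `a i` and of the distance of `a i` to the other points with
index in `s`. -/
noncomputable def centerSum (κ : X → X → ℝ) (F : X → ℝ → ℝ) (A s : Finset ℕ) (a : ℕ → X) : ℝ :=
  ∑ i ∈ A, F (a i) (minOver κ (s.erase i) (a i) a)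

variable {μ : Measure X} {κ : X → X → ℝ} {γ : ℕ}

omit [MeasurableSpace X] in
@[simp] theorem minOver_empty (x : X) (a : ℕ → X) : minOver κ ∅ x a = 1 := rfl

omit [MeasurableSpace X] in
theorem minOver_insert {s : Finset ℕ} {b : ℕ} (hb : b ∉ s) (x : X) (a : ℕ → X) :
    minOver κ (insert b s) x a = min (minOver κ s x a) (κ x (a b)) := by
  rw [minOver, Finset.fold_insert hb, min_comm]; rfl

omit [MeasurableSpace X] in
theorem lt_minOver_iff {s : Finset ℕ} {x : X} {a : ℕ → X} {c : ℝ} :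
    c < minOver κ s x a ↔ c < 1 ∧ ∀ j ∈ s, c < κ x (a j) := Finset.lt_fold_min _

omit [MeasurableSpace X] in
theorem minOver_update {s : Finset ℕ} {b : ℕ} (hb : b ∉ s) (x : X) (a : ℕ → X) (y : X) :
    minOver κ s x (Function.update a b y) = minOver κ s x a := by
  refine Finset.fold_congr fun j hj => ?_
  rw [Function.update_of_ne (by rintro rfl; exact hb hj)]

namespace IsNNKernel

variable (hκ : IsNNKernel μ κ γ)
include hκ

theorem measurable_minOver (s : Finset ℕ) (i : ℕ) :
    Measurable fun a : ℕ → X => minOver κ s (a i) a := by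
  induction s using Finset.induction_on with
  | empty => simp
  | insert b s hb ih =>
    simp only [minOver_insert hb]
    have hab : Measurable fun a : ℕ → X => (a i, a b) :=
      (measurable_pi_apply i).prodMk (measurable_pi_apply b)
    exact ih.min (hκ.measurable.comp hab)

theorem bddMeas_term {F : X → ℝ → ℝ} (hF : BddMeas fun p : X × ℝ => F p.1 p.2) (s : Finset ℕ)
    (i : ℕ) : BddMeas fun a : ℕ → X => F (a i) (minOver κ s (a i) a) :=
  hF.comp (g := fun a : ℕ → X => (a i, minOver κ s (a i) a))
    ((measurable_pi_apply i).prodMk (hκ.measurable_minOver s i))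

theorem bddMeas_centerSum {F : X → ℝ → ℝ} (hF : BddMeas fun p : X × ℝ => F p.1 p.2)
    (A s : Finset ℕ) : BddMeas (centerSum κ F A s) :=
  BddMeas.sum A fun i _ => hκ.bddMeas_term hF (s.erase i) i

theorem integral_eq_avgMin {g : ℝ → ℝ} (hg : Measurable g) (x : X) (u : ℝ) :
    ∫ y, g (min u (κ x y)) ∂μ = avgMin g u := by
  have hm : Measurable (κ x) := hκ.measurable.comp (measurable_const.prodMk measurable_id)
  rw [avgMin, ← hκ.map_eq x, integral_map hm.aemeasurable]
  exact (hg.comp (measurable_const.min measurable_id)).aestronglyMeasurable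

variable [IsProbabilityMeasure μ]

/-- The law of the distance of a sample point to its nearest neighbour. -/
theorem integral_term (s : Finset ℕ) {i : ℕ} (hi : i ∉ s) {F : X → ℝ → ℝ}
    (hF : BddMeas fun p : X × ℝ => F p.1 p.2) :
    ∫ a, F (a i) (minOver κ s (a i) a) ∂(seqLaw μ) = ∫ x, avgMin^[s.card] (F x) 1 ∂μ := by
  induction s using Finset.induction_on generalizing F with
  | empty =>
    have h := measurePreserving_eval_infinitePi (fun _ : ℕ => μ) i
    have hm : BddMeas fun x => F x 1 := hF.comp (g := fun x => (x, (1 : ℝ))) (by fun_prop)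
    simp only [minOver_empty, Finset.card_empty, Function.iterate_zero, id]
    conv_rhs => rw [← h.map_eq]
    rw [integral_map h.measurable.aemeasurable hm.measurable.aestronglyMeasurable]
  | insert b s hb ih =>
    have hbi : b ≠ i := by rintro rfl; simp at hi
    have his : i ∉ s := fun h => hi (by simp [h])
    -- Given the other points, `κ (a i) (a b)` is uniform, so integrating out `a b` replaces `F` by
    -- `avgMin F`. The empty minimum is 1, whence the evaluation of the iterates at 1.
    rw [← integral_resample (hκ.bddMeas_term hF (insert b s) i) b, Finset.card_insert_of_notMem hb]
    simp only [Function.iterate_succ_apply]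
    rw [← ih his hF.avgMin]
    refine integral_congr_ae (.of_forall fun a => ?_)
    simp only [resample, Function.update_of_ne hbi.symm, minOver_insert hb, minOver_update hb,
      Function.update_self]
    exact hκ.integral_eq_avgMin
      (hF.measurable.comp (measurable_const.prodMk measurable_id)) _ _

theorem resample_centerSum {A s : Finset ℕ} (hAs : A ⊆ s) {b : ℕ} (hb : b ∉ s) {F : X → ℝ → ℝ}
    (hF : BddMeas fun p : X × ℝ => F p.1 p.2) (a : ℕ → X) :
    resample μ b (centerSum κ F A (insert b s)) a = centerSum κ (fun x => avgMin (F x)) A s a := by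
  simp only [resample, centerSum]
  rw [integral_finsetSum]
  · refine Finset.sum_congr rfl fun i hi => ?_
    have hbi : b ≠ i := by rintro rfl; exact hb (hAs hi)
    have hb' : b ∉ s.erase i := fun h => hb (Finset.mem_of_mem_erase h)
    simp only [Function.update_of_ne hbi.symm, Finset.erase_insert_of_ne hbi, minOver_insert hb',
      minOver_update hb', Function.update_self]
    exact hκ.integral_eq_avgMin
      (hF.measurable.comp (measurable_const.prodMk measurable_id)) _ _
  · intro i _
    exact ((hκ.bddMeas_term hF _ i).comp (measurable_update a)).integrable μ

/-- The new point affects only those terms whose nearest neighbour it becomes, and there are at most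
`γ` of them. So Cauchy–Schwarz costs only a factor `γ`, and each squared increment has conditional
mean `sqIncr`. -/
theorem integral_sq_centerSum_sub_le {A s : Finset ℕ} (hAs : A ⊆ s) {b : ℕ} (hb : b ∉ s)
    {F : X → ℝ → ℝ} (hF : BddMeas fun p : X × ℝ => F p.1 p.2) :
    ∫ a, (centerSum κ F A (insert b s) a - centerSum κ F A s a) ^ 2 ∂(seqLaw μ) ≤
      γ * A.card * ∫ x, avgMin^[s.card - 1] (sqIncr (F x)) 1 ∂μ := by
  classical
  set D : ℕ → (ℕ → X) → ℝ := fun i a =>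
    F (a i) (minOver κ ((insert b s).erase i) (a i) a) - F (a i) (minOver κ (s.erase i) (a i) a)
  have hD : ∀ i, BddMeas (D i) := fun i => (hκ.bddMeas_term hF _ i).sub (hκ.bddMeas_term hF _ i)
  have hbi : ∀ i ∈ A, b ≠ i := by rintro i hi rfl; exact hb (hAs hi)
  have hb' : ∀ i, b ∉ s.erase i := fun i h => hb (Finset.mem_of_mem_erase h)
  have hDeq : ∀ i ∈ A, ∀ a, D i a = F (a i) (min (minOver κ (s.erase i) (a i) a) (κ (a i) (a b)))
      - F (a i) (minOver κ (s.erase i) (a i) a) := fun i hi a => by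
    simp only [D]
    rw [Finset.erase_insert_of_ne (hbi i hi), minOver_insert (hb' i)]
  have hpt : ∀ a, (centerSum κ F A (insert b s) a - centerSum κ F A s a) ^ 2 ≤
      γ * ∑ i ∈ A, D i a ^ 2 := by
    intro a
    have h1 : centerSum κ F A (insert b s) a - centerSum κ F A s a = ∑ i ∈ A, D i a := by
      simp only [centerSum, D, Finset.sum_sub_distrib]
    set A' := A.filter fun i => ∀ j ∈ A, j ≠ i → κ (a i) (a b) < κ (a i) (a j)
    have h2 : ∑ i ∈ A, D i a = ∑ i ∈ A', D i a := by
      refine (Finset.sum_subset (Finset.filter_subset _ _) fun i hi hi' => ?_).symm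
      rw [hDeq i hi]
      -- Outside `A'` another point of `A` is already at least as near to `a i` as `a b`, so the
      -- minimum does not change.
      have hle : minOver κ (s.erase i) (a i) a ≤ κ (a i) (a b) := by
        by_contra hlt
        refine hi' (Finset.mem_filter.2 ⟨hi, fun j hj hji => ?_⟩)
        exact (lt_minOver_iff.1 (not_le.1 hlt)).2 j (Finset.mem_erase.2 ⟨hji, hAs hj⟩)
      rw [min_eq_left hle, sub_self]
    rw [h1, h2]
    refine sq_sum_le_card_mul_sum_sq.trans ?_
    refine mul_le_mul (by exact_mod_cast hκ.card_le A a (a b)) ?_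
      (Finset.sum_nonneg fun _ _ => sq_nonneg _) (by positivity)
    exact Finset.sum_le_sum_of_subset_of_nonneg (Finset.filter_subset _ _)
      fun _ _ _ => sq_nonneg _
  have hint : ∀ i ∈ A, ∫ a, D i a ^ 2 ∂(seqLaw μ) =
      ∫ x, avgMin^[s.card - 1] (sqIncr (F x)) 1 ∂μ := by
    intro i hi
    rw [← Finset.card_erase_of_mem (hAs hi),
      ← hκ.integral_term (s.erase i) (Finset.notMem_erase i s) hF.sqIncr,
      ← integral_resample (hD i).sq b]
    refine integral_congr_ae (.of_forall fun a => ?_)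
    simp only [resample, hDeq i hi, Function.update_of_ne (hbi i hi).symm,
      minOver_update (hb' i), Function.update_self]
    have hm : Measurable (κ (a i)) := hκ.measurable.comp (measurable_const.prodMk measurable_id)
    have hFm : Measurable (F (a i)) :=
      hF.measurable.comp (measurable_const.prodMk measurable_id)
    rw [sqIncr, ← hκ.map_eq (a i), integral_map hm.aemeasurable]
    exact (((hFm.comp (measurable_const.min measurable_id)).sub measurable_const).pow_const
      2).aestronglyMeasurable
  calc _ ≤ ∫ a, γ * ∑ i ∈ A, D i a ^ 2 ∂(seqLaw μ) := by
        refine integral_mono (((hκ.bddMeas_centerSum hF _ _).sub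
          (hκ.bddMeas_centerSum hF _ _)).sq.integrable _) ?_ hpt
        exact ((BddMeas.const _).mul (BddMeas.sum A fun i _ => (hD i).sq)).integrable _
    _ = _ := by
        rw [integral_const_mul, integral_finsetSum _ fun i _ => (hD i).sq.integrable _,
          Finset.sum_congr rfl hint, Finset.sum_const, nsmul_eq_mul, mul_assoc]

/-- Revealing the sample points with index in `B` one at a time. -/
theorem integral_sq_centerSum_union_le {A : Finset ℕ} (B : Finset ℕ) (hAB : Disjoint A B)
    {F : X → ℝ → ℝ} (hF : BddMeas fun p : X × ℝ => F p.1 p.2) :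
    ∫ a, centerSum κ F A (A ∪ B) a ∂(seqLaw μ) =
      ∫ a, centerSum κ (fun x => avgMin^[B.card] (F x)) A A a ∂(seqLaw μ) ∧
    ∫ a, centerSum κ F A (A ∪ B) a ^ 2 ∂(seqLaw μ) ≤
      ∫ a, centerSum κ (fun x => avgMin^[B.card] (F x)) A A a ^ 2 ∂(seqLaw μ)
      + γ * A.card * ∑ N ∈ Finset.range B.card,
        ∫ x, avgMin^[A.card + B.card - 2 - N] (sqIncr (avgMin^[N] (F x))) 1 ∂μ := by
  induction B using Finset.induction_on generalizing F with
  | empty => simp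
  | insert b B hb ih =>
    rw [Finset.disjoint_insert_right] at hAB
    have hbs : b ∉ A ∪ B := by simp [hAB.1, hb]
    have hAs : A ⊆ A ∪ B := Finset.subset_union_left
    obtain ⟨i1, i2⟩ := ih hAB.2 (F := fun x => avgMin (F x)) hF.avgMin
    have hr := hκ.resample_centerSum hAs hbs hF
    have hY : ∀ a y, centerSum κ F A (A ∪ B) (Function.update a b y) = centerSum κ F A (A ∪ B) a := by
      intro a y
      refine Finset.sum_congr rfl fun i hi => ?_
      rw [Function.update_of_ne (by rintro rfl; exact hAB.1 hi),
        minOver_update fun h => hbs (Finset.mem_of_mem_erase h)]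
    -- The comparison function is the sum without the point `b`. The conditional mean is the same
    -- sum for `avgMin F`, to which the induction hypothesis applies.
    have h1 := integral_sq_le_resample_add (μ := μ)
      (hκ.bddMeas_centerSum hF A (insert b (A ∪ B))) (hκ.bddMeas_centerSum hF A (A ∪ B)) b hY
    have h2 := hκ.integral_sq_centerSum_sub_le hAs hbs hF
    have h3 := integral_resample (μ := μ) (hκ.bddMeas_centerSum hF A (insert b (A ∪ B))) b
    simp only [hr] at h1 h3
    rw [Finset.card_union_of_disjoint hAB.2] at h2
    rw [Finset.union_insert, Finset.card_insert_of_notMem hb, Finset.sum_range_succ']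
    simp only [Function.iterate_succ_apply, Function.iterate_zero, id]
    refine ⟨by rw [← h3, i1], ?_⟩
    have e1 : A.card + (B.card + 1) - 2 - 0 = A.card + B.card - 1 := by omega
    have e2 : ∀ N, A.card + (B.card + 1) - 2 - (N + 1) = A.card + B.card - 2 - N := by
      intro N; omega
    simp only [e1, e2]
    rw [mul_add]
    linarith

end IsNNKernel

end Variance

/-! ### Monotonicity of the averages and geometric sums -/

theorem bddMeas_iterate_avgMin {f : ℝ → ℝ} (hf : BddMeas f) (N : ℕ) : BddMeas (avgMin^[N] f) :=
  (BddMeas.iterate_avgMin (X := Unit) (G := fun _ => f) (hf.comp measurable_snd) N).comp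
    (g := fun u => ((), u)) (by fun_prop)

theorem avgMin_mono {f g : ℝ → ℝ} (hf : BddMeas f) (hg : BddMeas g)
    (hfg : ∀ u ∈ Set.Icc (0 : ℝ) 1, f u ≤ g u) :
    ∀ u ∈ Set.Icc (0 : ℝ) 1, avgMin f u ≤ avgMin g u := fun u hu => by
  have hm : Measurable fun w : ℝ => min u w := by fun_prop
  refine setIntegral_mono_on ((hf.comp hm).integrable _) ((hg.comp hm).integrable _)
    measurableSet_Ioc fun w hw => ?_
  exact hfg _ ⟨le_min hu.1 hw.1.le, (min_le_left _ _).trans hu.2⟩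

theorem sq_iterate_avgMin_le {f : ℝ → ℝ} (hf : BddMeas f) (N : ℕ) :
    ∀ u ∈ Set.Icc (0 : ℝ) 1, avgMin^[N] f u ^ 2 ≤ avgMin^[N] (fun u => f u ^ 2) u := by
  induction N with
  | zero => simp
  | succ N ih =>
    intro u hu
    have hp : IsProbabilityMeasure ((volume : Measure ℝ).restrict (Set.Ioc 0 1)) := ⟨by simp⟩
    have hb := bddMeas_iterate_avgMin hf N
    rw [Function.iterate_succ_apply', Function.iterate_succ_apply']
    refine (sq_integral_le_integral_sq (hb.comp (g := fun w => min u w) (by fun_prop))).trans ?_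
    exact avgMin_mono hb.sq (bddMeas_iterate_avgMin hf.sq N) ih u hu

theorem iterate_avgMin_mono {f g : ℝ → ℝ} (hf : BddMeas f) (hg : BddMeas g)
    (hfg : ∀ u ∈ Set.Icc (0 : ℝ) 1, f u ≤ g u) (N : ℕ) :
    ∀ u ∈ Set.Icc (0 : ℝ) 1, avgMin^[N] f u ≤ avgMin^[N] g u := by
  induction N with
  | zero => simpa using hfg
  | succ N ih =>
    simp only [Function.iterate_succ_apply']
    exact avgMin_mono (bddMeas_iterate_avgMin hf N) (bddMeas_iterate_avgMin hg N) ih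

/-- `∑ s (1 - s) ^ N ≤ 1`. -/
theorem sum_mul_one_sub_pow_le (c : ℕ) {s : ℝ} (h1 : s ≤ 1) :
    ∑ N ∈ Finset.range c, s * (1 - s) ^ N ≤ 1 := by
  have : ∑ N ∈ Finset.range c, s * (1 - s) ^ N = 1 - (1 - s) ^ c := by
    rw [← Finset.mul_sum]
    have := mul_neg_geom_sum (1 - s) c
    rw [sub_sub_cancel] at this
    exact this
  rw [this]
  linarith [pow_nonneg (sub_nonneg.2 h1) c]

/-- The terms of the geometric sum decrease, so `N + 1` times the last one is at most the sum of the
first `N + 1`. -/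
theorem add_one_mul_mul_one_sub_pow_le (N : ℕ) {s : ℝ} (h0 : 0 ≤ s) (h1 : s ≤ 1) :
    (N + 1 : ℝ) * (s * (1 - s) ^ N) ≤ 1 := by
  refine le_trans ?_ (sum_mul_one_sub_pow_le (N + 1) h1)
  have : ∀ i ∈ Finset.range (N + 1), s * (1 - s) ^ N ≤ s * (1 - s) ^ i := fun i hi =>
    mul_le_mul_of_nonneg_left (pow_le_pow_of_le_one (by linarith) (by linarith)
      (Finset.mem_range_succ_iff.1 hi)) h0
  simpa using Finset.card_nsmul_le_sum _ _ _ this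

/-! ### The variance bound -/

section Variance

variable {X : Type*} [MeasurableSpace X] {μ : Measure X} [IsProbabilityMeasure μ] {κ : X → X → ℝ}
  {γ : ℕ}

theorem integral_sq_sub_integral {α : Type*} [MeasurableSpace α] {ν : Measure α}
    [IsProbabilityMeasure ν] {Φ : α → ℝ} (h : BddMeas Φ) :
    ∫ a, (Φ a - ∫ b, Φ b ∂ν) ^ 2 ∂ν = ∫ a, Φ a ^ 2 ∂ν - (∫ a, Φ a ∂ν) ^ 2 := by
  set m := ∫ b, Φ b ∂ν with hm
  have h1 : ∀ a, (Φ a - m) ^ 2 = Φ a ^ 2 - 2 * m * Φ a + m ^ 2 := fun a => by ring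
  simp only [h1]
  rw [integral_add ((h.sq.sub ((BddMeas.const (2 * m)).mul h)).integrable ν) (integrable_const _),
    integral_sub (h.sq.integrable ν) ((h.integrable ν).const_mul _), integral_const_mul, ← hm]
  simp
  ring

omit [MeasurableSpace X] in
theorem dependsOn_centerSum {F : X → ℝ → ℝ} (A : Finset ℕ) :
    DependsOn (centerSum κ F A A) (A : Set ℕ) := by
  intro a b hab
  refine Finset.sum_congr rfl fun i hi => ?_
  rw [hab i hi, minOver, minOver]
  congr 1
  exact Finset.fold_congr fun j hj => by rw [hab j (Finset.mem_of_mem_erase hj)]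

namespace IsNNKernel

variable (hκ : IsNNKernel μ κ γ)
include hκ

/-- Dropping point `k` loses its own term and changes those for which it is the nearest neighbour,
whence the two contributions. The second one requires `G` to be smooth in the mean square sense, so
the bound is used only after half of the sample has been integrated out. -/
theorem efron_stein_centerSum {A : Finset ℕ}
    {G : X → ℝ → ℝ} (hG : BddMeas fun p : X × ℝ => G p.1 p.2) :
    ∫ a, centerSum κ G A A a ^ 2 ∂(seqLaw μ) ≤ (∫ a, centerSum κ G A A a ∂(seqLaw μ)) ^ 2 +
      A.card * (2 * ∫ x, avgMin^[A.card - 1] (fun u => G x u ^ 2) 1 ∂μ +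
        2 * (γ * A.card * ∫ x, avgMin^[A.card - 2] (sqIncr (G x)) 1 ∂μ)) := by
  have hT := fun A s => hκ.bddMeas_centerSum hG A s
  refine (efron_stein A (hT A A) (dependsOn_centerSum A)
    (Y := fun k => centerSum κ G (A.erase k) (A.erase k)) (fun k _ => hT _ _)
    fun k hk a y => ?_).trans ?_
  · exact dependsOn_centerSum _ fun i hi => by
      rw [Function.update_of_ne (Finset.ne_of_mem_erase (Finset.mem_coe.1 hi))]
  refine add_le_add le_rfl ?_
  rw [← nsmul_eq_mul]
  refine Finset.sum_le_card_nsmul _ _ _ fun k hk => ?_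
  have hkk : k ∉ A.erase k := Finset.notMem_erase k A
  have hdec : ∀ a, centerSum κ G A A a = G (a k) (minOver κ (A.erase k) (a k) a)
      + centerSum κ G (A.erase k) (insert k (A.erase k)) a := fun a => by
    rw [Finset.insert_erase hk, centerSum, centerSum, ← Finset.add_sum_erase A _ hk]
  have h1 := hκ.integral_sq_centerSum_sub_le (Finset.Subset.refl (A.erase k)) hkk hG
  have hG2 : BddMeas fun p : X × ℝ => G p.1 p.2 ^ 2 := hG.sq
  have h2 := hκ.integral_term (A.erase k) hkk (F := fun x u => G x u ^ 2) hG2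
  have h3 : 0 ≤ ∫ x, avgMin^[A.card - 2] (sqIncr (G x)) 1 ∂μ := by
    refine integral_nonneg fun x => ?_
    have hz0 : avgMin (fun _ => (0 : ℝ)) = fun _ => 0 := by funext u; simp [avgMin]
    have hz : avgMin^[A.card - 2] (fun _ => (0 : ℝ)) 1 = 0 := by
      rw [Function.iterate_fixed hz0]
    have hsx : BddMeas (sqIncr (G x)) :=
      hG.sqIncr.comp (g := fun u : ℝ => (x, u)) (by fun_prop)
    have := iterate_avgMin_mono (BddMeas.const 0) hsx
      (fun u _ => integral_nonneg fun w => sq_nonneg _) (A.card - 2) 1 (by simp)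
    rw [hz] at this
    exact this
  have hcard : ((A.erase k).card : ℝ) ≤ A.card := by exact_mod_cast Finset.card_erase_le
  have hcard' : (A.erase k).card - 1 = A.card - 2 := by
    rw [Finset.card_erase_of_mem hk]; omega
  rw [hcard'] at h1
  rw [Finset.card_erase_of_mem hk] at h2
  have h4 := h1.trans (mul_le_mul_of_nonneg_right
    (mul_le_mul_of_nonneg_left hcard (Nat.cast_nonneg γ)) h3)
  have ht := hκ.bddMeas_term hG (A.erase k) k
  have hd := (hT (A.erase k) (insert k (A.erase k))).sub (hT (A.erase k) (A.erase k))
  calc _ ≤ ∫ a, (2 * G (a k) (minOver κ (A.erase k) (a k) a) ^ 2 +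
        2 * (centerSum κ G (A.erase k) (insert k (A.erase k)) a -
          centerSum κ G (A.erase k) (A.erase k) a) ^ 2) ∂(seqLaw μ) := by
        refine integral_mono (((hT _ _).sub (hT _ _)).sq.integrable _)
          ((((BddMeas.const 2).mul ht.sq).add ((BddMeas.const 2).mul hd.sq)).integrable _)
          fun a => ?_
        simp only
        rw [hdec]
        set p := G (a k) (minOver κ (A.erase k) (a k) a)
        set q := centerSum κ G (A.erase k) (insert k (A.erase k)) a
        set r := centerSum κ G (A.erase k) (A.erase k) a
        nlinarith [sq_nonneg (p - (q - r))]
    _ = 2 * (∫ a, G (a k) (minOver κ (A.erase k) (a k) a) ^ 2 ∂(seqLaw μ)) +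
        2 * ∫ a, (centerSum κ G (A.erase k) (insert k (A.erase k)) a -
          centerSum κ G (A.erase k) (A.erase k) a) ^ 2 ∂(seqLaw μ) := by
        rw [integral_add (((BddMeas.const 2).mul ht.sq).integrable _)
          (((BddMeas.const 2).mul hd.sq).integrable _), integral_const_mul, integral_const_mul]
    _ ≤ _ := by rw [h2]; linarith

end IsNNKernel

/-- Second moment of `F` against the density `(1 - s) ^ M`. -/
noncomputable def momentTwo (μ : Measure X) (F : X → ℝ → ℝ) (M : ℕ) : ℝ :=
  ∫ x, (∫ s in Set.Ioc 0 1, F x s ^ 2 * (1 - s) ^ M) ∂μ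

/-- The same as `momentTwo` with an additional weight. -/
noncomputable def momentTwoWeight (μ : Measure X) (F : X → ℝ → ℝ) (M : ℕ) (w : ℝ → ℝ) : ℝ :=
  ∫ x, (∫ s in Set.Ioc 0 1, F x s ^ 2 * (1 - s) ^ M * w s) ∂μ

theorem bddMeas_integral_sq {F : X → ℝ → ℝ} (hF : BddMeas fun p : X × ℝ => F p.1 p.2) (M : ℕ)
    {w : ℝ → ℝ} (hw : BddUnit w) :
    BddMeas fun x => ∫ s in Set.Ioc 0 1, F x s ^ 2 * (1 - s) ^ M * w s := by
  have hp : IsProbabilityMeasure ((volume : Measure ℝ).restrict (Set.Ioc 0 1)) := ⟨by simp⟩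
  obtain ⟨C, hC⟩ := ((BddUnit.one_sub_pow M).mul hw).bdd
  have hb : BddMeas fun s => (Set.Icc (0 : ℝ) 1).indicator (fun s => (1 - s) ^ M * w s) s := by
    refine ⟨((BddUnit.one_sub_pow M).mul hw).measurable.indicator measurableSet_Icc, C,
      fun s => ?_⟩
    by_cases h : s ∈ Set.Icc (0 : ℝ) 1
    · rw [Set.indicator_of_mem h]; exact hC s h
    · rw [Set.indicator_of_notMem h, abs_zero]; exact (abs_nonneg _).trans (hC 0 (by simp))
  have h1 := BddMeas.integral (Φ := fun p : X × ℝ => F p.1 p.2 ^ 2 *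
    (Set.Icc (0 : ℝ) 1).indicator (fun s => (1 - s) ^ M * w s) p.2)
    (hF.sq.mul (hb.comp measurable_snd)) ((volume : Measure ℝ).restrict (Set.Ioc 0 1))
  convert h1 using 2 with x
  refine setIntegral_congr_fun measurableSet_Ioc fun s hs => ?_
  simp only
  have hs' : s ∈ Set.Icc (0 : ℝ) 1 := ⟨hs.1.le, hs.2⟩
  rw [Set.indicator_of_mem hs', mul_assoc]

omit [IsProbabilityMeasure μ] in
theorem momentTwo_eq_weight (F : X → ℝ → ℝ) (M : ℕ) :
    momentTwo μ F M = momentTwoWeight μ F M (fun _ => 1) := by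
  simp [momentTwo, momentTwoWeight]

theorem momentTwoWeight_mono {F : X → ℝ → ℝ} (hF : BddMeas fun p : X × ℝ => F p.1 p.2) (M : ℕ)
    {w w' : ℝ → ℝ} (hw : BddUnit w) (hw' : BddUnit w')
    (h : ∀ s ∈ Set.Icc (0 : ℝ) 1, w s ≤ w' s) :
    momentTwoWeight μ F M w ≤ momentTwoWeight μ F M w' := by
  refine integral_mono ((bddMeas_integral_sq hF M hw).integrable _)
    ((bddMeas_integral_sq hF M hw').integrable _) fun x => ?_
  have hx : BddUnit fun s => F x s ^ 2 * (1 - s) ^ M :=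
    ((BddUnit.of_bddMeas (hF.comp (g := fun s : ℝ => (x, s)) (by fun_prop))).sq).mul
      (.one_sub_pow M)
  refine setIntegral_mono_on ((hx.mul hw).integrableOn le_rfl le_rfl)
    ((hx.mul hw').integrableOn le_rfl le_rfl) measurableSet_Ioc fun s hs => ?_
  exact mul_le_mul_of_nonneg_left (h s ⟨hs.1.le, hs.2⟩)
    (mul_nonneg (sq_nonneg _) (pow_nonneg (by linarith [hs.2]) _))

theorem momentTwoWeight_sum {ι : Type*} (S : Finset ι) {F : X → ℝ → ℝ}
    (hF : BddMeas fun p : X × ℝ => F p.1 p.2) (M : ℕ) {w : ι → ℝ → ℝ}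
    (hw : ∀ i, BddUnit (w i)) :
    ∑ i ∈ S, momentTwoWeight μ F M (w i) =
      momentTwoWeight μ F M (fun s => ∑ i ∈ S, w i s) := by
  simp only [momentTwoWeight]
  rw [← integral_finsetSum _ fun i _ => (bddMeas_integral_sq hF M (hw i)).integrable _]
  refine integral_congr_ae (.of_forall fun x => ?_)
  have hx : BddUnit fun s => F x s ^ 2 * (1 - s) ^ M :=
    ((BddUnit.of_bddMeas (hF.comp (g := fun s : ℝ => (x, s)) (by fun_prop))).sq).mul
      (.one_sub_pow M)
  simp only
  rw [← integral_finsetSum _ fun i _ => ((hx.mul (hw i)).integrableOn le_rfl le_rfl)]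
  simp only [Finset.mul_sum]

omit [IsProbabilityMeasure μ] in
theorem momentTwoWeight_const (F : X → ℝ → ℝ) (M : ℕ) (c : ℝ) :
    momentTwoWeight μ F M (fun _ => c) = c * momentTwo μ F M := by
  simp only [momentTwo, momentTwoWeight]
  rw [← integral_const_mul]
  refine integral_congr_ae (.of_forall fun x => ?_)
  simp only
  rw [integral_mul_const, mul_comm]

omit [IsProbabilityMeasure μ] in
theorem momentTwo_nonneg (F : X → ℝ → ℝ) (M : ℕ) : 0 ≤ momentTwo μ F M :=
  integral_nonneg fun _ => setIntegral_nonneg measurableSet_Ioc fun s hs =>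
    mul_nonneg (sq_nonneg _) (pow_nonneg (by linarith [hs.2]) _)

theorem integral_sqIncr_iterate_le {F : X → ℝ → ℝ} (hF : BddMeas fun p : X × ℝ => F p.1 p.2)
    (hsupp : ∀ x u, 1 / 2 < u → F x u = 0) {K N : ℕ} (hK : K ≠ 0) :
    ∫ x, avgMin^[K] (sqIncr (avgMin^[N] (F x))) 1 ∂μ ≤ 9 * momentTwo μ F (K + N)
      + 6 * momentTwoWeight μ F (K + N) (fun s => K * (s * (1 - s) ^ N)) := by
  have hw : BddUnit fun s => K * (s * (1 - s) ^ N) := .of_continuous (by fun_prop)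
  have hb1 := bddMeas_integral_sq hF (K + N) (BddUnit.const 1)
  have hb2 := bddMeas_integral_sq hF (K + N) hw
  have hb3 : BddMeas fun x => avgMin^[K] (sqIncr (avgMin^[N] (F x))) 1 :=
    (BddMeas.iterate_avgMin (G := fun x => sqIncr (avgMin^[N] (F x)))
      (BddMeas.sqIncr (G := fun x => avgMin^[N] (F x)) (hF.iterate_avgMin N)) K).comp
      (g := fun x => (x, (1 : ℝ))) (by fun_prop)
  rw [momentTwo_eq_weight, momentTwoWeight, momentTwoWeight, ← integral_const_mul,
    ← integral_const_mul, ← integral_add ((hb1.integrable _).const_mul _)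
      ((hb2.integrable _).const_mul _)]
  refine integral_mono (hb3.integrable _) (((hb1.integrable _).const_mul _).add
      ((hb2.integrable _).const_mul _)) fun x => ?_
  have hx : BddMeas (F x) := hF.comp (g := fun s : ℝ => (x, s)) (by fun_prop)
  have hS : BddMeas (sqIncr (avgMin^[N] (F x))) :=
    (BddMeas.sqIncr (G := fun x => avgMin^[N] (F x)) (hF.iterate_avgMin N)).comp
      (g := fun s : ℝ => (x, s)) (by fun_prop)
  have h := integral_sqIncr_le hx (hsupp x) hK N
  rw [← iterate_avgMin_one (.of_bddMeas hS) hK] at h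
  simpa using h

namespace IsNNKernel

variable (hκ : IsNNKernel μ κ γ)
include hκ

/-- The points of `B` are integrated out, at weights `n s (1 - s)^N` whose sum over `N` is at most
`n`; then Efron–Stein is applied with weight `(|A| - 2) s (1 - s)^|B|`, which is at most 1 since
`|A| - 2 ≤ |B| + 1`. Both increments give `15 = 9 + 6`; Efron–Stein contributes `2 + 30 γ` and the
integration `15 γ`. -/
theorem variance_centerSum_le {A B : Finset ℕ} (hAB : Disjoint A B) (hA : 3 ≤ A.card)
    (hAc : A.card ≤ B.card + 3) {F : X → ℝ → ℝ} (hF : BddMeas fun p : X × ℝ => F p.1 p.2)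
    (hsupp : ∀ x u, 1 / 2 < u → F x u = 0) {n : ℕ} (hn : A.card + B.card = n) :
    ∫ a, centerSum κ F A (A ∪ B) a ^ 2 ∂(seqLaw μ) ≤
      (∫ a, centerSum κ F A (A ∪ B) a ∂(seqLaw μ)) ^ 2 +
        (2 + 45 * γ) * n ^ 2 * momentTwo μ F (n - 2) := by
  obtain ⟨h1, h2⟩ := hκ.integral_sq_centerSum_union_le B hAB hF
  have hGb : BddMeas fun p : X × ℝ => avgMin^[B.card] (F p.1) p.2 := hF.iterate_avgMin B.card
  have h3 := hκ.efron_stein_centerSum (A := A) (G := fun x => avgMin^[B.card] (F x)) hGb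
  rw [← h1] at h3
  set Q := momentTwo μ F (n - 2) with hQdef
  have hQ : 0 ≤ Q := momentTwo_nonneg F _
  set c := B.card with hc
  set m := A.card with hm
  -- the second moment of a single term
  have hsq : ∫ x, avgMin^[m - 1] (fun u => avgMin^[c] (F x) u ^ 2) 1 ∂μ ≤ n * Q := by
    have hb1 : BddMeas fun x => avgMin^[m - 1] (fun u => avgMin^[c] (F x) u ^ 2) 1 :=
      (BddMeas.iterate_avgMin (G := fun x u => avgMin^[c] (F x) u ^ 2) hGb.sq (m - 1)).comp
        (g := fun x => (x, (1 : ℝ))) (by fun_prop)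
    have hb2 := bddMeas_integral_sq hF (n - 2) (BddUnit.const 1)
    rw [hQdef, momentTwo_eq_weight, momentTwoWeight, ← integral_const_mul]
    refine integral_mono (hb1.integrable _) ((hb2.integrable _).const_mul _) fun x => ?_
    have hx : BddMeas (F x) := hF.comp (g := fun s : ℝ => (x, s)) (by fun_prop)
    -- Jensen's inequality moves the square inside `c` averages; with the other `m - 1` there are `n
    -- - 1` in all, evaluated at 1.
    have e1 := iterate_avgMin_mono (bddMeas_iterate_avgMin hx c).sq
      (bddMeas_iterate_avgMin hx.sq c) (sq_iterate_avgMin_le hx c) (m - 1) 1 (by simp)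
    rw [← Function.iterate_add_apply, iterate_avgMin_one (.of_bddMeas hx.sq) (by omega)] at e1
    have e2 : m - 1 + c - 1 = n - 2 := by omega
    rw [e2] at e1
    refine e1.trans ?_
    simp only [mul_one]
    refine mul_le_mul_of_nonneg_right (by exact_mod_cast (by omega : m - 1 + c ≤ n)) ?_
    exact setIntegral_nonneg measurableSet_Ioc fun s hs =>
      mul_nonneg (sq_nonneg _) (pow_nonneg (by linarith [hs.2]) _)
  have hinc : ∫ x, avgMin^[m - 2] (sqIncr (avgMin^[c] (F x))) 1 ∂μ ≤ 15 * Q := by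
    have := integral_sqIncr_iterate_le (μ := μ) hF hsupp (K := m - 2) (N := c) (by omega)
    have e : m - 2 + c = n - 2 := by omega
    rw [e, ← hQdef] at this
    have hw := momentTwoWeight_mono (μ := μ) hF (n - 2)
      (w := fun s => ((m - 2 : ℕ) : ℝ) * (s * (1 - s) ^ c)) (w' := fun _ => 1)
      (.of_continuous (by fun_prop)) (.const 1) fun s hs => by
        refine le_trans ?_ (add_one_mul_mul_one_sub_pow_le c hs.1 hs.2)
        refine mul_le_mul_of_nonneg_right ?_
          (mul_nonneg hs.1 (pow_nonneg (by linarith [hs.2]) _))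
        exact_mod_cast (by omega : m - 2 ≤ c + 1)
    rw [momentTwoWeight_const, one_mul, ← hQdef] at hw
    linarith
  have hsum : ∑ N ∈ Finset.range c, ∫ x, avgMin^[m + c - 2 - N] (sqIncr (avgMin^[N] (F x))) 1 ∂μ
      ≤ 15 * n * Q := by
    have hterm : ∀ N ∈ Finset.range c,
        ∫ x, avgMin^[m + c - 2 - N] (sqIncr (avgMin^[N] (F x))) 1 ∂μ ≤
          9 * Q + 6 * momentTwoWeight μ F (n - 2) (fun s => n * (s * (1 - s) ^ N)) := by
      intro N hN
      have hN' := Finset.mem_range.1 hN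
      have := integral_sqIncr_iterate_le (μ := μ) hF hsupp (K := m + c - 2 - N) (N := N) (by omega)
      have e : m + c - 2 - N + N = n - 2 := by omega
      rw [e, ← hQdef] at this
      have hw := momentTwoWeight_mono (μ := μ) hF (n - 2)
        (w := fun s => ((m + c - 2 - N : ℕ) : ℝ) * (s * (1 - s) ^ N))
        (w' := fun s => n * (s * (1 - s) ^ N))
        (.of_continuous (by fun_prop)) (.of_continuous (by fun_prop)) fun s hs => by
          refine mul_le_mul_of_nonneg_right ?_
            (mul_nonneg hs.1 (pow_nonneg (by linarith [hs.2]) _))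
          exact_mod_cast (by omega : m + c - 2 - N ≤ n)
      linarith
    refine (Finset.sum_le_sum hterm).trans ?_
    rw [Finset.sum_add_distrib, ← Finset.mul_sum (Finset.range c) _ (6 : ℝ),
      momentTwoWeight_sum _ hF _ (w := fun N s => (n : ℝ) * (s * (1 - s) ^ N))
      fun N => .of_continuous (by fun_prop)]
    have hw := momentTwoWeight_mono (μ := μ) hF (n - 2)
      (w := fun s => ∑ N ∈ Finset.range c, (n : ℝ) * (s * (1 - s) ^ N)) (w' := fun _ => (n : ℝ))
      (.of_continuous (by fun_prop)) (.const _) fun s hs => by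
        rw [← Finset.mul_sum]
        have := mul_le_mul_of_nonneg_left (sum_mul_one_sub_pow_le c hs.2) (Nat.cast_nonneg n)
        simpa using this
    rw [momentTwoWeight_const, ← hQdef] at hw
    have hcn : (c : ℝ) * Q ≤ n * Q :=
      mul_le_mul_of_nonneg_right (by exact_mod_cast (by omega : c ≤ n)) hQ
    simp only [Finset.sum_const, Finset.card_range, nsmul_eq_mul]
    linarith
  have hmn : (m : ℝ) ≤ n := by exact_mod_cast (by omega : m ≤ n)
  have hm0 : (0 : ℝ) ≤ m := Nat.cast_nonneg m
  have hg0 : (0 : ℝ) ≤ γ := Nat.cast_nonneg γ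
  have hn0 : (0 : ℝ) ≤ n := Nat.cast_nonneg n
  have b1 : (γ : ℝ) * m * ∑ N ∈ Finset.range c,
      ∫ x, avgMin^[m + c - 2 - N] (sqIncr (avgMin^[N] (F x))) 1 ∂μ ≤ γ * n * (15 * n * Q) :=
    (mul_le_mul_of_nonneg_left hsum (by positivity)).trans
      (mul_le_mul_of_nonneg_right (by gcongr) (by positivity))
  have b2 : (m : ℝ) * (2 * ∫ x, avgMin^[m - 1] (fun u => avgMin^[c] (F x) u ^ 2) 1 ∂μ +
        2 * (γ * m * ∫ x, avgMin^[m - 2] (sqIncr (avgMin^[c] (F x))) 1 ∂μ)) ≤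
      n * (2 * (n * Q) + 2 * (γ * n * (15 * Q))) := by
    have b3 : (γ : ℝ) * m * ∫ x, avgMin^[m - 2] (sqIncr (avgMin^[c] (F x))) 1 ∂μ ≤
        γ * n * (15 * Q) :=
      (mul_le_mul_of_nonneg_left hinc (by positivity)).trans
        (mul_le_mul_of_nonneg_right (by gcongr) (by positivity))
    refine (mul_le_mul_of_nonneg_left (add_le_add (mul_le_mul_of_nonneg_left hsq (by norm_num))
      (mul_le_mul_of_nonneg_left b3 (by norm_num))) hm0).trans ?_
    exact mul_le_mul_of_nonneg_right hmn (by positivity)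
  calc _ ≤ _ := h2
    _ ≤ _ := add_le_add h3 b1
    _ ≤ _ := by
      rw [add_assoc]
      refine add_le_add le_rfl ((add_le_add b2 le_rfl).trans (le_of_eq ?_))
      ring

/-- **Variance bound** for sums of functions of nearest neighbour distances. -/
theorem variance_nnSum_le {n : ℕ} (hn : 6 ≤ n) {F : X → ℝ → ℝ}
    (hF : BddMeas fun p : X × ℝ => F p.1 p.2) (hsupp : ∀ x u, 1 / 2 < u → F x u = 0) :
    ∫ a, (centerSum κ F (Finset.range n) (Finset.range n) a -
        ∫ b, centerSum κ F (Finset.range n) (Finset.range n) b ∂(seqLaw μ)) ^ 2 ∂(seqLaw μ) ≤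
      4 * ((2 + 45 * γ) * n ^ 2 * momentTwo μ F (n - 2)) := by
  classical
  -- Each half serves as the reservoir of points for the other one. `6 ≤ n` gives both at least
  -- three points, and adding the two variances produces the factor 4.
  set A := Finset.range (n / 2)
  set B := Finset.Ico (n / 2) n
  have hAB : Disjoint A B := by
    rw [Finset.disjoint_left]; intro i hi; simp [A, B] at *; omega
  have hU : A ∪ B = Finset.range n := by ext i; simp [A, B]; omega
  have hAc : A.card = n / 2 := by simp [A]
  have hBc : B.card = n - n / 2 := by simp [B]
  have h1 := hκ.variance_centerSum_le hAB (by omega) (by omega) hF hsupp (n := n) (by omega)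
  have h2 := hκ.variance_centerSum_le hAB.symm (by omega) (by omega) hF hsupp (n := n) (by omega)
  rw [Finset.union_comm, hU] at h2
  rw [hU] at h1
  have hbA := hκ.bddMeas_centerSum hF A (Finset.range n)
  have hbB := hκ.bddMeas_centerSum hF B (Finset.range n)
  have v1 := integral_sq_sub_integral (ν := seqLaw μ) hbA
  have v2 := integral_sq_sub_integral (ν := seqLaw μ) hbB
  have hsum : ∀ a, centerSum κ F (Finset.range n) (Finset.range n) a =
      centerSum κ F A (Finset.range n) a + centerSum κ F B (Finset.range n) a := fun a => by
    conv_lhs => rw [centerSum, ← hU, Finset.sum_union hAB]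
    rw [hU]; rfl
  simp only [hsum]
  rw [integral_add (hbA.integrable _) (hbB.integrable _)]
  set mA := ∫ a, centerSum κ F A (Finset.range n) a ∂(seqLaw μ)
  set mB := ∫ a, centerSum κ F B (Finset.range n) a ∂(seqLaw μ)
  have dA := (hbA.sub (BddMeas.const mA)).sq
  have dB := (hbB.sub (BddMeas.const mB)).sq
  calc _ ≤ ∫ a, (2 * (centerSum κ F A (Finset.range n) a - mA) ^ 2 +
        2 * (centerSum κ F B (Finset.range n) a - mB) ^ 2) ∂(seqLaw μ) := by
        refine integral_mono ((((hbA.add hbB).sub (BddMeas.const _)).sq).integrable _)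
          ((((BddMeas.const 2).mul dA).add ((BddMeas.const 2).mul dB)).integrable _) fun a => ?_
        simp only
        nlinarith [sq_nonneg ((centerSum κ F A (Finset.range n) a - mA) -
          (centerSum κ F B (Finset.range n) a - mB))]
    _ = 2 * (∫ a, (centerSum κ F A (Finset.range n) a - mA) ^ 2 ∂(seqLaw μ)) +
        2 * ∫ a, (centerSum κ F B (Finset.range n) a - mB) ^ 2 ∂(seqLaw μ) := by
        rw [integral_add (((BddMeas.const 2).mul dA).integrable _)
          (((BddMeas.const 2).mul dB).integrable _), integral_const_mul, integral_const_mul]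
    _ ≤ _ := by rw [v1, v2]; linarith

end IsNNKernel

end Variance

/-! ### The law of the nearest neighbour pair and a deviation bound -/

section NNSum

variable {X : Type*} [MeasurableSpace X]

/-- The pair formed by a sample point and its distance to its nearest neighbour. -/
noncomputable def nnPair (κ : X → X → ℝ) (n i : ℕ) (a : ℕ → X) : X × ℝ :=
  (a i, minOver κ ((Finset.range n).erase i) (a i) a)

/-- The law of `nnPair`. -/
noncomputable def nnLaw (μ : Measure X) [IsProbabilityMeasure μ] (κ : X → X → ℝ) (n : ℕ) :
    Measure (X × ℝ) := (seqLaw μ).map (nnPair κ n 0)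

variable {μ : Measure X} [IsProbabilityMeasure μ] {κ : X → X → ℝ} {γ : ℕ}

namespace IsNNKernel

variable (hκ : IsNNKernel μ κ γ)
include hκ

omit [IsProbabilityMeasure μ] in
theorem measurable_nnPair (n i : ℕ) : Measurable (nnPair κ n i) :=
  (measurable_pi_apply i).prodMk (hκ.measurable_minOver _ i)

theorem isProbabilityMeasure_nnLaw (n : ℕ) : IsProbabilityMeasure (nnLaw μ κ n) :=
  Measure.isProbabilityMeasure_map (hκ.measurable_nnPair n 0).aemeasurable

theorem integral_nnPair {n i : ℕ} (hn : 2 ≤ n) (hi : i < n) {J : X × ℝ → ℝ} (hJ : BddMeas J) :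
    ∫ a, J (nnPair κ n i a) ∂(seqLaw μ) =
      (n - 1 : ℕ) * ∫ x, (∫ s in Set.Ioc 0 1, J (x, s) * (1 - s) ^ (n - 2)) ∂μ := by
  have h := hκ.integral_term ((Finset.range n).erase i) (Finset.notMem_erase i _)
    (F := fun x u => J (x, u)) hJ
  rw [Finset.card_erase_of_mem (Finset.mem_range.2 hi), Finset.card_range] at h
  refine h.trans ?_
  rw [← integral_const_mul]
  refine integral_congr_ae (.of_forall fun x => ?_)
  have hx : BddMeas fun u => J (x, u) := hJ.comp (g := fun s : ℝ => (x, s)) (by fun_prop)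
  simp only
  rw [iterate_avgMin_one (.of_bddMeas hx) (by omega)]
  rfl

theorem integral_nnLaw {n : ℕ} (hn : 2 ≤ n) {J : X × ℝ → ℝ} (hJ : BddMeas J) :
    ∫ p, J p ∂(nnLaw μ κ n) =
      (n - 1 : ℕ) * ∫ x, (∫ s in Set.Ioc 0 1, J (x, s) * (1 - s) ^ (n - 2)) ∂μ := by
  rw [nnLaw, integral_map (hκ.measurable_nnPair n 0).aemeasurable
    hJ.measurable.aestronglyMeasurable, hκ.integral_nnPair hn (by omega) hJ]

/-- The formula for the integral of a bounded function does not involve `i`. -/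
theorem map_nnPair {n i : ℕ} (hn : 2 ≤ n) (hi : i < n) :
    (seqLaw μ).map (nnPair κ n i) = nnLaw μ κ n := by
  have hm := hκ.measurable_nnPair n i
  have := Measure.isProbabilityMeasure_map (μ := seqLaw μ) hm.aemeasurable
  have := hκ.isProbabilityMeasure_nnLaw n
  refine Measure.ext fun S hS => ?_
  rw [← measureReal_eq_measureReal_iff]
  have hJ : BddMeas (S.indicator (fun _ => (1 : ℝ))) := by
    refine ⟨measurable_const.indicator hS, 1, fun p => ?_⟩
    by_cases h : p ∈ S <;> simp [h]
  have h1 : ∫ p, S.indicator (fun _ => (1 : ℝ)) p ∂((seqLaw μ).map (nnPair κ n i)) =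
      ∫ p, S.indicator (fun _ => (1 : ℝ)) p ∂(nnLaw μ κ n) := by
    rw [hκ.integral_nnLaw hn hJ, integral_map hm.aemeasurable hJ.measurable.aestronglyMeasurable,
      hκ.integral_nnPair hn hi hJ]
  simpa [integral_indicator_const _ hS] using h1

theorem momentTwo_le {n : ℕ} (hn : 2 ≤ n) {F : X → ℝ → ℝ}
    (hF : BddMeas fun p : X × ℝ => F p.1 p.2) :
    n * momentTwo μ F (n - 2) ≤ 2 * ∫ p, F p.1 p.2 ^ 2 ∂(nnLaw μ κ n) := by
  rw [hκ.integral_nnLaw hn hF.sq]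
  change n * momentTwo μ F (n - 2) ≤ 2 * ((n - 1 : ℕ) * momentTwo μ F (n - 2))
  rw [← mul_assoc]
  refine mul_le_mul_of_nonneg_right ?_ (momentTwo_nonneg F _)
  exact_mod_cast (by omega : n ≤ 2 * (n - 1))

theorem nnLaw_half {n : ℕ} (hn : 2 ≤ n) :
    (nnLaw μ κ n).real {p | 1 / 2 < p.2} = (1 / 2) ^ (n - 1) := by
  have := hκ.isProbabilityMeasure_nnLaw n
  have hS : MeasurableSet {p : X × ℝ | 1 / 2 < p.2} := measurableSet_lt measurable_const
    measurable_snd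
  have hJ : BddMeas ({p : X × ℝ | 1 / 2 < p.2}.indicator (fun _ => (1 : ℝ))) := by
    refine ⟨measurable_const.indicator hS, 1, fun p => ?_⟩
    by_cases h : p ∈ {p : X × ℝ | 1 / 2 < p.2}
    · rw [Set.indicator_of_mem h]; simp
    · rw [Set.indicator_of_notMem h]; simp
  have h1 := hκ.integral_nnLaw hn hJ
  rw [integral_indicator_const _ hS] at h1
  simp only [smul_eq_mul, mul_one] at h1
  rw [h1]
  have h2 : ∀ x : X, ∫ s in Set.Ioc (0 : ℝ) 1,
      {p : X × ℝ | 1 / 2 < p.2}.indicator (fun _ => (1 : ℝ)) (x, s) * (1 - s) ^ (n - 2) =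
      ∫ s in Set.Ioc (1 / 2 : ℝ) 1, (1 - s) ^ (n - 2) := by
    intro x
    have : ∀ s, {p : X × ℝ | 1 / 2 < p.2}.indicator (fun _ => (1 : ℝ)) (x, s) * (1 - s) ^ (n - 2)
        = (Set.Ioi (1 / 2 : ℝ)).indicator (fun s => (1 - s) ^ (n - 2)) s := fun s => by
      by_cases h : 1 / 2 < s
      · rw [Set.indicator_of_mem (by exact h), Set.indicator_of_mem (by exact h), one_mul]
      · rw [Set.indicator_of_notMem (by exact h), Set.indicator_of_notMem (by exact h), zero_mul]
    simp only [this]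
    rw [setIntegral_indicator measurableSet_Ioi]
    congr 2
    ext s; simp only [Set.mem_inter_iff, Set.mem_Ioc, Set.mem_Ioi]
    constructor
    · rintro ⟨h, h'⟩; exact ⟨h', h.2⟩
    · rintro ⟨h, h'⟩; exact ⟨⟨by linarith, h'⟩, h⟩
  simp only [h2]
  simp only [integral_const, probReal_univ, one_smul]
  have h3 := integral_one_sub_pow (n - 2) (by norm_num : (1 / 2 : ℝ) ≤ 1)
  have e1 : ((n - 1 : ℕ) : ℝ) = ((n - 2 : ℕ) : ℝ) + 1 := by
    rw [← Nat.cast_add_one]; congr 1; omega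
  have e2 : n - 2 + 1 = n - 1 := by omega
  rw [e1, h3, e2]
  have : n - 1 ≠ 0 := by omega
  norm_num [this]

/-- Deviation bound for a single `n`, in terms of the second moment of the summands. -/
theorem measure_abs_nnSum_ge_le {n : ℕ} (hn : 6 ≤ n) {F : X → ℝ → ℝ}
    (hF : Measurable fun p : X × ℝ => F p.1 p.2)
    (hF2 : Integrable (fun p : X × ℝ => F p.1 p.2 ^ 2) (nnLaw μ κ n))
    (hmean : ∫ p, F p.1 p.2 ∂(nnLaw μ κ n) = 0) {m : ℝ}
    (hm : m = ∫ p, F p.1 p.2 ^ 2 ∂(nnLaw μ κ n)) {ε : ℝ} (hε0 : 0 < ε)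
    (hε : 2 * (m + n * (1 / 2) ^ (n - 1)) ≤ ε) :
    (seqLaw μ).real {a | ε ≤ |(√(n : ℝ))⁻¹ * centerSum κ F (Finset.range n) (Finset.range n) a|} ≤
      m + n * (1 / 2) ^ (n - 1) + 32 * (2 + 45 * γ) * m / ε ^ 2 := by
  classical
  have hprob := hκ.isProbabilityMeasure_nnLaw n
  set ν := nnLaw μ κ n with hν
  have hn0 : (0 : ℝ) < n := by exact_mod_cast (by omega : 0 < n)
  have hn1 : (1 : ℝ) ≤ n := by exact_mod_cast (by omega : 1 ≤ n)
  have hm0 : 0 ≤ m := hm ▸ integral_nonneg fun _ => sq_nonneg _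
  -- The variance bound needs a bounded function supported in `u ≤ 1/2`. Cutting off on `T` achieves
  -- both, and some sample pair falls into `T` with probability at most `n ν(T)`.
  set T : Set (X × ℝ) := {p | n < |F p.1 p.2|} ∪ {p | 1 / 2 < p.2} with hT
  have hT1 : MeasurableSet {p : X × ℝ | n < |F p.1 p.2|} :=
    measurableSet_lt measurable_const (measurable_norm.comp hF)
  have hTm : MeasurableSet T :=
    hT1.union (measurableSet_lt measurable_const measurable_snd)
  -- the truncated function
  set F' : X → ℝ → ℝ := fun x u => Tᶜ.indicator (fun p => F p.1 p.2) (x, u) with hF'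
  have hF'b : BddMeas fun p : X × ℝ => F' p.1 p.2 := by
    refine ⟨hF.indicator hTm.compl, n, fun p => ?_⟩
    by_cases h : p ∈ T
    · simp [hF', h]
    · have : ¬ (n < |F p.1 p.2|) := fun h' => h (Or.inl h')
      simpa [hF', h] using this
  have hsupp : ∀ x u, 1 / 2 < u → F' x u = 0 := fun x u hu => by
    have : (x, u) ∈ T := Or.inr hu
    simp [hF', this]
  have hνT : n * ν.real T ≤ m + n * (1 / 2) ^ (n - 1) := by
    have h1 : n * ν.real {p : X × ℝ | n < |F p.1 p.2|} ≤ m := by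
      have hsub : {p : X × ℝ | n < |F p.1 p.2|} ⊆ {p | (n : ℝ) ^ 2 ≤ F p.1 p.2 ^ 2} := by
        intro p hp
        have hp' : (n : ℝ) < |F p.1 p.2| := hp
        change (n : ℝ) ^ 2 ≤ F p.1 p.2 ^ 2
        rw [← sq_abs (F p.1 p.2)]
        gcongr
      have h2 := mul_meas_ge_le_integral_of_nonneg (μ := ν) (.of_forall fun p => sq_nonneg _) hF2
        ((n : ℝ) ^ 2)
      have h3 := measureReal_mono (μ := ν) hsub
      rw [← hm] at h2
      refine le_trans ?_ h2
      calc (n : ℝ) * ν.real {p : X × ℝ | n < |F p.1 p.2|}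
          ≤ n ^ 2 * ν.real {p : X × ℝ | n < |F p.1 p.2|} :=
            mul_le_mul_of_nonneg_right (by nlinarith) measureReal_nonneg
        _ ≤ _ := mul_le_mul_of_nonneg_left h3 (by positivity)
    have h2 := hκ.nnLaw_half (n := n) (by omega)
    have h3 := measureReal_union_le (μ := ν) {p : X × ℝ | n < |F p.1 p.2|} {p | 1 / 2 < p.2}
    rw [← hν] at h2
    rw [h2] at h3
    nlinarith
  have hFint : Integrable (fun p : X × ℝ => F p.1 p.2) ν :=
    ((memLp_two_iff_integrable_sq hF.aestronglyMeasurable).2 hF2).integrable (by norm_num)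
  -- the mean of the truncated function
  have hmean' : √(n : ℝ) * |∫ p, F' p.1 p.2 ∂ν| ≤ (m + n * ν.real T) / 2 := by
    have h1 : ∫ p, F' p.1 p.2 ∂ν = -∫ p, T.indicator (fun p => F p.1 p.2) p ∂ν := by
      have hs := integral_add (hFint.indicator hTm.compl) (hFint.indicator hTm)
      have e : ∀ p, Tᶜ.indicator (fun p => F p.1 p.2) p + T.indicator (fun p => F p.1 p.2) p =
          F p.1 p.2 := fun p => congrFun (Set.indicator_compl_add_self T fun p => F p.1 p.2) p
      simp only [e, hmean] at hs
      change ∫ p, Tᶜ.indicator (fun p => F p.1 p.2) p ∂ν = _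
      linarith
    rw [h1, abs_neg]
    have h2 : |∫ p, T.indicator (fun p => F p.1 p.2) p ∂ν| ≤
        ∫ p, |T.indicator (fun p => F p.1 p.2) p| ∂ν := abs_integral_le_integral_abs
    refine (mul_le_mul_of_nonneg_left h2 (Real.sqrt_nonneg _)).trans ?_
    rw [← integral_const_mul]
    have h3 : (m + n * ν.real T) / 2 =
        ∫ p, (1 / 2 * F p.1 p.2 ^ 2 + n / 2 * T.indicator (fun _ => (1 : ℝ)) p) ∂ν := by
      rw [integral_add (hF2.const_mul _) (((integrable_const _).indicator hTm).const_mul _),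
        integral_const_mul, integral_const_mul, integral_indicator_const _ hTm, ← hm, smul_eq_mul]
      ring
    rw [h3]
    refine integral_mono ((hFint.indicator hTm).abs.const_mul _)
      ((hF2.const_mul _).add (((integrable_const _).indicator hTm).const_mul _)) fun p => ?_
    simp only
    by_cases hp : p ∈ T
    · simp only [Set.indicator_of_mem hp]
      -- On `T` one has `√n |F| ≤ (F² + n)/2`. As `F` is centred, this controls the mean created by
      -- the truncation.
      have e1 := Real.sq_sqrt hn0.le
      nlinarith [sq_nonneg (√(n : ℝ) - |F p.1 p.2|), sq_abs (F p.1 p.2)]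
    · simp only [Set.indicator_of_notMem hp, abs_zero, mul_zero, add_zero]
      positivity
  set S := centerSum κ F (Finset.range n) (Finset.range n)
  set S' := centerSum κ F' (Finset.range n) (Finset.range n)
  set M := ∫ b, S' b ∂(seqLaw μ)
  have hM : M = n * ∫ p, F' p.1 p.2 ∂ν := by
    change ∫ b, (∑ i ∈ Finset.range n, F' (nnPair κ n i b).1 (nnPair κ n i b).2) ∂(seqLaw μ) = _
    rw [integral_finsetSum _ fun i _ => (hF'b.comp (hκ.measurable_nnPair n i)).integrable _]
    have : ∀ i ∈ Finset.range n, ∫ b, F' (nnPair κ n i b).1 (nnPair κ n i b).2 ∂(seqLaw μ) =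
        ∫ p, F' p.1 p.2 ∂ν := fun i hi => by
      rw [hν, ← hκ.map_nnPair (by omega) (Finset.mem_range.1 hi),
        integral_map (hκ.measurable_nnPair n i).aemeasurable
          hF'b.measurable.aestronglyMeasurable]
    rw [Finset.sum_congr rfl this]
    simp
  have hs0 : 0 < √(n : ℝ) := Real.sqrt_pos.2 hn0
  have hMs : (√(n : ℝ))⁻¹ * |M| ≤ ε / 2 := by
    have : (√(n : ℝ))⁻¹ * |M| = √(n : ℝ) * |∫ p, F' p.1 p.2 ∂ν| := by
      rw [hM, abs_mul, abs_of_pos hn0, ← mul_assoc]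
      congr 1
      rw [inv_mul_eq_div, div_eq_iff hs0.ne', Real.mul_self_sqrt hn0.le]
    rw [this]
    have : (0 : ℝ) ≤ n * (1 / 2) ^ (n - 1) := by positivity
    linarith
  have hvar := hκ.variance_nnSum_le hn hF'b hsupp
  have hmom := hκ.momentTwo_le (n := n) (by omega) hF'b
  have hF'2 : ∫ p, F' p.1 p.2 ^ 2 ∂ν ≤ m := by
    rw [hm]
    refine integral_mono (hF'b.sq.integrable _) hF2 fun p => ?_
    by_cases h : p ∈ T
    · simp [hF', h, sq_nonneg]
    · simp [hF', h]
  have hS'b : BddMeas S' := hκ.bddMeas_centerSum hF'b _ _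
  -- If no pair lies in `T`, the two sums agree; the mean uses up `ε/2`, so `S'` must deviate from
  -- `M` by at least `√n ε/2`, and Chebyshev's inequality applies.
  set R : Set (ℕ → X) := {a | n * ε ^ 2 / 4 ≤ (S' a - M) ^ 2}
  have hsub : {a | ε ≤ |(√(n : ℝ))⁻¹ * S a|} ⊆
      (⋃ i ∈ Finset.range n, (nnPair κ n i) ⁻¹' T) ∪ R := by
    intro a ha
    by_cases hex : ∃ i ∈ Finset.range n, nnPair κ n i a ∈ T
    · obtain ⟨i, hi, hiT⟩ := hex
      exact Or.inl (Set.mem_biUnion hi hiT)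
    · push Not at hex
      right
      have hSS : S a = S' a := Finset.sum_congr rfl fun i hi => by
        have : (a i, minOver κ ((Finset.range n).erase i) (a i) a) ∉ T := hex i hi
        simp [hF', this]
      have ha' : ε ≤ |(√(n : ℝ))⁻¹ * S' a| := hSS ▸ ha
      rw [abs_mul, abs_of_pos (inv_pos.2 hs0)] at ha'
      have h1 : |S' a| ≤ |S' a - M| + |M| := by
        simpa using abs_add_le (S' a - M) M
      have h2 : (√(n : ℝ))⁻¹ * |S' a| ≤ (√(n : ℝ))⁻¹ * (|S' a - M| + |M|) :=
        mul_le_mul_of_nonneg_left h1 (inv_pos.2 hs0).le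
      have h3 : ε / 2 ≤ (√(n : ℝ))⁻¹ * |S' a - M| := by linarith [mul_add (√(n : ℝ))⁻¹ |S' a - M| |M|]
      rw [inv_mul_eq_div, le_div_iff₀ hs0] at h3
      have h4 : (ε / 2 * √(n : ℝ)) ^ 2 ≤ |S' a - M| ^ 2 := by gcongr
      rw [sq_abs, mul_pow, Real.sq_sqrt hn0.le] at h4
      change n * ε ^ 2 / 4 ≤ (S' a - M) ^ 2
      linarith
  have hU : (seqLaw μ).real (⋃ i ∈ Finset.range n, (nnPair κ n i) ⁻¹' T) ≤ n * ν.real T := by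
    refine (measureReal_biUnion_finset_le _ _).trans ?_
    have : ∀ i ∈ Finset.range n, (seqLaw μ).real ((nnPair κ n i) ⁻¹' T) = ν.real T := fun i hi => by
      rw [hν, ← hκ.map_nnPair (by omega) (Finset.mem_range.1 hi),
        map_measureReal_apply (hκ.measurable_nnPair n i) hTm]
    rw [Finset.sum_congr rfl this]
    simp
  have hR : (seqLaw μ).real R ≤ 32 * (2 + 45 * γ) * m / ε ^ 2 := by
    have h1 := mul_meas_ge_le_integral_of_nonneg (μ := seqLaw μ)
      (.of_forall fun a => sq_nonneg (S' a - M))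
      ((hS'b.sub (BddMeas.const M)).sq.integrable _) (n * ε ^ 2 / 4)
    have h2 := h1.trans hvar
    rw [le_div_iff₀ (by positivity)]
    have h3 : (n : ℝ) * ((seqLaw μ).real R * ε ^ 2) ≤ n * (32 * (2 + 45 * γ) * m) := by
      have h4 : (n : ℝ) * momentTwo μ F' (n - 2) ≤ 2 * m := hmom.trans (by linarith)
      have h5 := mul_le_mul_of_nonneg_left h4
        (by positivity : (0 : ℝ) ≤ 16 * (2 + 45 * γ) * n)
      linarith
    exact le_of_mul_le_mul_left h3 hn0
  have h1 := measureReal_mono (μ := seqLaw μ) hsub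
  have h2 := measureReal_union_le (μ := seqLaw μ)
    (⋃ i ∈ Finset.range n, (nnPair κ n i) ⁻¹' T) R
  linarith

end IsNNKernel

end NNSum

/-! ### Cones around a point -/

section Cells

/-- Unit vectors at distance less than 1 have inner product at least 1/2, so `‖x - x'‖² ≤ ‖x‖² +
‖x'‖² - ‖x‖ ‖x'‖ ≤ ‖x‖²`. -/
theorem dist_le_of_direction {V : Type*} [NormedAddCommGroup V] [InnerProductSpace ℝ V] {x x' : V}
    (hdir : ‖‖x‖⁻¹ • x - ‖x'‖⁻¹ • x'‖ < 1) (hle : ‖x'‖ ≤ ‖x‖) : ‖x - x'‖ ≤ ‖x‖ := by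
  by_cases hx' : x' = 0
  · simp [hx']
  have h' : 0 < ‖x'‖ := norm_pos_iff.2 hx'
  have h : 0 < ‖x‖ := h'.trans_le hle
  have e1 : ‖‖x‖⁻¹ • x - ‖x'‖⁻¹ • x'‖ ^ 2 = 2 - 2 * (‖x‖⁻¹ * ‖x'‖⁻¹ * inner ℝ x x') := by
    rw [norm_sub_sq_real, norm_smul, norm_smul, inner_smul_left, inner_smul_right]
    simp only [norm_inv, norm_norm, inv_mul_cancel₀ h.ne', inv_mul_cancel₀ h'.ne']
    simp
    ring
  have e2 : ‖‖x‖⁻¹ • x - ‖x'‖⁻¹ • x'‖ ^ 2 ≤ 1 := by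
    have := norm_nonneg (‖x‖⁻¹ • x - ‖x'‖⁻¹ • x')
    nlinarith
  have e3 : 1 / 2 ≤ ‖x‖⁻¹ * ‖x'‖⁻¹ * inner ℝ x x' := by linarith
  have e4 : ‖x‖ * ‖x'‖ / 2 ≤ inner ℝ x x' := by
    have := mul_le_mul_of_nonneg_left e3 (by positivity : 0 ≤ ‖x‖ * ‖x'‖)
    have e5 : ‖x‖ * ‖x'‖ * (‖x‖⁻¹ * ‖x'‖⁻¹ * inner ℝ x x') = inner ℝ x x' := by
      field_simp
    linarith
  refine le_of_sq_le_sq ?_ h.le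
  rw [norm_sub_sq_real]
  nlinarith

/-- Space around any point `y` can be divided into a fixed number of cones such that, of two points in
the same cone, the farther one from `y` is closer to the other than to `y`. -/
theorem exists_cells (V : Type*) [NormedAddCommGroup V] [InnerProductSpace ℝ V]
    [FiniteDimensional ℝ V] : ∃ (γ : ℕ) (cell : V → V → Fin γ), ∀ y x x',
      cell y x = cell y x' → dist x' y ≤ dist x y → dist x x' ≤ dist x y := by
  have := FiniteDimensional.proper_real V
  -- The ball is covered rather than the sphere because the zero vector normalizes to 0. Radius 1/2
  -- makes two directions in one cell differ by less than 1.
  obtain ⟨t, -, ht, hcov⟩ := (isCompact_closedBall (0 : V) 1).finite_cover_balls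
    (e := 1 / 2) (by norm_num)
  have hfin := ht.fintype
  have hdir : ∀ v : V, ‖v‖⁻¹ • v ∈ Metric.closedBall (0 : V) 1 := fun v => by
    rw [mem_closedBall_zero_iff, norm_smul, norm_inv, norm_norm]
    exact inv_mul_le_one
  have hex : ∀ v : V, ∃ c : t, ‖‖v‖⁻¹ • v - c‖ < 1 / 2 := fun v => by
    obtain ⟨c, hc, hvc⟩ := Set.mem_iUnion₂.1 (hcov (hdir v))
    exact ⟨⟨c, hc⟩, by rwa [← dist_eq_norm]⟩
  choose c hc using hex
  refine ⟨Fintype.card t, fun y x => Fintype.equivFin t (c (x - y)), fun y x x' h hle => ?_⟩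
  have hcc : c (x - y) = c (x' - y) := (Fintype.equivFin t).injective h
  have h1 := hc (x - y)
  have h2 := hc (x' - y)
  rw [← hcc] at h2
  rw [dist_eq_norm, dist_eq_norm] at *
  have h3 := dist_le_of_direction (x := x - y) (x' := x' - y) ?_ hle
  · rwa [sub_sub_sub_cancel_right] at h3
  · rw [← dist_eq_norm] at *
    have := dist_triangle_right (‖x - y‖⁻¹ • (x - y)) (‖x' - y‖⁻¹ • (x' - y)) (c (x - y) : V)
    linarith

end Cells

/-! ### The mass of balls and its quantile function -/

section Quantile

variable {X : Type*} [MetricSpace X] [MeasurableSpace X] [BorelSpace X]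
  [SecondCountableTopology X]

/-- The mass of the closed ball with centre `x` and radius `r`. -/
noncomputable def ballMass (μ : Measure X) (x : X) (r : ℝ) : ℝ := μ.real (Metric.closedBall x r)

/-- The mass of the smallest closed ball around `x` which contains `y`. -/
noncomputable def distMass (μ : Measure X) (x y : X) : ℝ := ballMass μ x (dist x y)

open Classical in
/-- The radius of the smallest closed ball around `x` of mass `s`, for `0 < s < 1`. -/
noncomputable def radius (μ : Measure X) (x : X) (s : ℝ) : ℝ :=
  if s ∈ Set.Ioo (0 : ℝ) 1 then sInf {r | 0 ≤ r ∧ s ≤ ballMass μ x r} else 0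

/-- All spheres are null sets. -/
def SpheresNull (μ : Measure X) : Prop := ∀ x r, μ (Metric.sphere x r) = 0

variable {μ : Measure X} [IsProbabilityMeasure μ]

omit [SecondCountableTopology X] [BorelSpace X] in
theorem ballMass_mono (x : X) : Monotone (ballMass μ x) := fun _ _ h =>
  measureReal_mono (Metric.closedBall_subset_closedBall h)

omit [SecondCountableTopology X] [BorelSpace X] in
theorem ballMass_mem (x : X) (r : ℝ) : ballMass μ x r ∈ Set.Icc (0 : ℝ) 1 :=
  ⟨measureReal_nonneg, measureReal_le_one⟩

theorem measurable_ballMass : Measurable fun p : X × ℝ => ballMass μ p.1 p.2 := by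
  have hS : MeasurableSet {p : (X × ℝ) × X | dist p.2 p.1.1 ≤ p.1.2} :=
    measurableSet_le (by fun_prop) (by fun_prop)
  exact (measurable_measure_prodMk_left (ν := μ) hS).ennreal_toReal

omit [SecondCountableTopology X] [BorelSpace X] in
theorem exists_lt_ballMass (x : X) {s : ℝ} (hs : s < 1) : ∃ r, 0 ≤ r ∧ s < ballMass μ x r := by
  have h1 : Tendsto (fun n : ℕ => μ (Metric.closedBall x n)) atTop (𝓝 (μ Set.univ)) := by
    rw [← Metric.iUnion_closedBall_nat x]
    exact tendsto_measure_iUnion_atTop fun m n h =>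
      Metric.closedBall_subset_closedBall (by exact_mod_cast h)
  have h2 : Tendsto (fun n : ℕ => ballMass μ x n) atTop (𝓝 1) := by
    have := (ENNReal.tendsto_toReal (measure_ne_top μ _)).comp h1
    rw [measure_univ, ENNReal.toReal_one] at this
    exact this
  obtain ⟨n, hn⟩ := (h2.eventually (lt_mem_nhds hs)).exists
  exact ⟨n, Nat.cast_nonneg n, hn⟩

namespace SpheresNull

variable (hμ : SpheresNull μ)
include hμ

-- Dominated convergence: as the radius tends to `r`, the indicators of the balls converge off the
-- sphere of radius `r`, which is a null set.
omit [SecondCountableTopology X] in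
theorem continuous_ballMass (x : X) : Continuous (ballMass μ x) := by
  have he : ballMass μ x = fun r => ∫ y, (Metric.closedBall x r).indicator (fun _ => (1 : ℝ)) y ∂μ := by
    funext r
    rw [integral_indicator_const _ Metric.isClosed_closedBall.measurableSet]
    simp [ballMass]
  rw [he, continuous_iff_continuousAt]
  intro r
  refine tendsto_integral_filter_of_dominated_convergence (fun _ => 1) ?_ ?_
    (integrable_const _) ?_
  · exact .of_forall fun s => (measurable_const.indicator
      Metric.isClosed_closedBall.measurableSet).aestronglyMeasurable
  · refine .of_forall fun s => .of_forall fun y => ?_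
    exact (norm_indicator_le_norm_self _ _).trans (by simp)
  · have : ∀ᵐ y ∂μ, y ∉ Metric.sphere x r := measure_eq_zero_iff_ae_notMem.1 (hμ x r)
    filter_upwards [this] with y hy
    rcases lt_or_gt_of_ne (fun h => hy h : dist y x ≠ r) with h | h
    · refine tendsto_const_nhds.congr' ?_
      filter_upwards [lt_mem_nhds h] with s hs
      rw [Set.indicator_of_mem (Metric.mem_closedBall.2 h.le),
        Set.indicator_of_mem (Metric.mem_closedBall.2 (le_of_lt hs))]
    · refine tendsto_const_nhds.congr' ?_
      filter_upwards [gt_mem_nhds h] with s hs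
      rw [Set.indicator_of_notMem (by simpa using h), Set.indicator_of_notMem (by simpa using hs)]

omit [SecondCountableTopology X] [BorelSpace X] [IsProbabilityMeasure μ] in
theorem ballMass_zero (x : X) : ballMass μ x 0 = 0 := by
  have := hμ x 0
  rw [Metric.sphere_zero] at this
  simp [ballMass, measureReal_def, this]

-- By continuity the set of admissible radii is closed, so its infimum is attained. This is the
-- usual adjunction of a distribution function and its quantile function.
omit [SecondCountableTopology X] in
theorem radius_le_iff (x : X) {s r : ℝ} (hs : s ∈ Set.Ioo (0 : ℝ) 1) (hr : 0 ≤ r) :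
    radius μ x s ≤ r ↔ s ≤ ballMass μ x r := by
  have hbdd : BddBelow {r | 0 ≤ r ∧ s ≤ ballMass μ x r} := ⟨0, fun r h => h.1⟩
  rw [radius, if_pos hs]
  constructor
  · intro h
    have hcl : IsClosed {r | 0 ≤ r ∧ s ≤ ballMass μ x r} :=
      (isClosed_le continuous_const continuous_id).inter
        (isClosed_le continuous_const (hμ.continuous_ballMass x))
    obtain ⟨r', h0, h1⟩ := exists_lt_ballMass (μ := μ) x hs.2
    have hmem := hcl.csInf_mem ⟨r', h0, h1.le⟩ hbdd
    exact hmem.2.trans (ballMass_mono x h)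
  · intro h
    exact csInf_le hbdd ⟨hr, h⟩

omit [SecondCountableTopology X] hμ [IsProbabilityMeasure μ] [BorelSpace X] in
theorem radius_nonneg (x : X) (s : ℝ) : 0 ≤ radius μ x s := by
  rw [radius]
  split_ifs
  · exact Real.sInf_nonneg fun r h => h.1
  · exact le_rfl

omit [SecondCountableTopology X] in
theorem ballMass_radius (x : X) {s : ℝ} (hs : s ∈ Set.Ioo (0 : ℝ) 1) :
    ballMass μ x (radius μ x s) = s := by
  refine le_antisymm ?_ ((hμ.radius_le_iff x hs (radius_nonneg x s)).1 le_rfl)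
  by_contra! hlt
  obtain ⟨r', h0, h1⟩ := exists_lt_ballMass (μ := μ) x hs.2
  have hivt := intermediate_value_Icc (radius_nonneg (μ := μ) x s)
    (hμ.continuous_ballMass x).continuousOn
  obtain ⟨r, hr, hrs⟩ := hivt ⟨by rw [hμ.ballMass_zero x]; exact hs.1.le, hlt.le⟩
  have h2 := (hμ.radius_le_iff x hs hr.1).2 hrs.ge
  have h3 : r = radius μ x s := le_antisymm hr.2 h2
  rw [h3] at hrs
  exact hlt.ne' hrs

omit [SecondCountableTopology X] in
theorem radius_pos (x : X) {s : ℝ} (hs : s ∈ Set.Ioo (0 : ℝ) 1) : 0 < radius μ x s := by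
  refine (radius_nonneg x s).lt_of_ne fun h => ?_
  have := hμ.ballMass_radius x hs
  rw [← h, hμ.ballMass_zero x] at this
  exact hs.1.ne this

theorem measurable_radius : Measurable fun p : X × ℝ => radius μ p.1 p.2 := by
  refine measurable_of_Iic fun r => ?_
  have hI : MeasurableSet {p : X × ℝ | p.2 ∈ Set.Ioo (0 : ℝ) 1} := measurable_snd measurableSet_Ioo
  rcases lt_or_ge r 0 with hr | hr
  · convert MeasurableSet.empty
    ext p
    simp only [Set.mem_preimage, Set.mem_Iic, Set.mem_empty_iff_false, iff_false, not_le]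
    exact hr.trans_le (radius_nonneg _ _)
  · have : (fun p : X × ℝ => radius μ p.1 p.2) ⁻¹' Set.Iic r =
        {p : X × ℝ | p.2 ∈ Set.Ioo (0 : ℝ) 1}ᶜ ∪ {p | p.2 ≤ ballMass μ p.1 r} := by
      ext p
      simp only [Set.mem_preimage, Set.mem_Iic, Set.mem_union, Set.mem_compl_iff]
      by_cases hp : p.2 ∈ Set.Ioo (0 : ℝ) 1
      · rw [hμ.radius_le_iff _ hp hr]
        exact ⟨fun h => Or.inr h, fun h => h.resolve_left (not_not.2 hp)⟩
      · refine ⟨fun _ => Or.inl hp, fun _ => ?_⟩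
        rw [radius, if_neg hp]; exact hr
    rw [this]
    refine hI.compl.union (measurableSet_le measurable_snd ?_)
    have hb : Measurable fun p : X × ℝ => (p.1, r) := by fun_prop
    exact (measurable_ballMass (μ := μ)).comp hb

-- The probability integral transform: for `0 < v < 1` the event `v ≤ distMass μ x y` is the
-- complement of an open ball, and that ball has mass `v` because spheres are null.
omit [SecondCountableTopology X] in
theorem map_distMass [SecondCountableTopology X] (x : X) :
    μ.map (distMass μ x) = (volume : Measure ℝ).restrict (Set.Ioc 0 1) := by
  have hm : Measurable (distMass μ x) :=
    (hμ.continuous_ballMass x).measurable.comp (measurable_const.dist measurable_id)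
  have hp1 : IsProbabilityMeasure (μ.map (distMass μ x)) :=
    Measure.isProbabilityMeasure_map hm.aemeasurable
  have hp2 : IsProbabilityMeasure ((volume : Measure ℝ).restrict (Set.Ioc 0 1)) := ⟨by simp⟩
  have hmid : ∀ v ∈ Set.Ioo (0 : ℝ) 1, μ.real {y | v ≤ distMass μ x y} = 1 - v := by
    intro v hv
    have : {y | v ≤ distMass μ x y} = (Metric.ball x (radius μ x v))ᶜ := by
      ext y
      change v ≤ ballMass μ x (dist x y) ↔ _
      rw [← hμ.radius_le_iff x hv dist_nonneg]
      simp [dist_comm]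
    rw [this, measureReal_compl Metric.isOpen_ball.measurableSet]
    have hb : μ.real (Metric.ball x (radius μ x v)) = v := by
      conv_rhs => rw [← hμ.ballMass_radius x hv]
      rw [ballMass, ← Metric.ball_union_sphere]
      refine le_antisymm (measureReal_mono Set.subset_union_left) ?_
      refine (measureReal_union_le _ _).trans ?_
      simp [measureReal_def, hμ x]
    simp [hb]
  refine Measure.ext_of_Ici _ _ fun v => ?_
  rw [← measureReal_eq_measureReal_iff, map_measureReal_apply hm measurableSet_Ici]
  change μ.real {y | v ≤ distMass μ x y} = _
  rw [measureReal_restrict_apply measurableSet_Ici]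
  rcases le_or_gt v 0 with h0 | h0
  · have e1 : {y | v ≤ distMass μ x y} = Set.univ :=
      Set.eq_univ_of_forall fun y => h0.trans (ballMass_mem x _).1
    have e2 : Set.Ici v ∩ Set.Ioc 0 1 = Set.Ioc (0 : ℝ) 1 :=
      Set.inter_eq_right.2 fun s hs => h0.trans hs.1.le
    rw [e1, e2]; simp
  · rcases lt_or_ge v 1 with h1 | h1
    · have e2 : Set.Ici v ∩ Set.Ioc 0 1 = Set.Icc v 1 := by
        ext s
        simp only [Set.mem_inter_iff, Set.mem_Ici, Set.mem_Ioc, Set.mem_Icc]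
        exact ⟨fun h => ⟨h.1, h.2.2⟩, fun h => ⟨h.1, h0.trans_le h.1, h.2⟩⟩
      rw [hmid v ⟨h0, h1⟩, e2, Real.volume_real_Icc_of_le h1.le]
    · have e2 : volume.real (Set.Ici v ∩ Set.Ioc (0 : ℝ) 1) = 0 := by
        refine le_antisymm ((measureReal_mono (s₂ := {(1 : ℝ)}) ?_ (by simp)).trans ?_)
          measureReal_nonneg
        · rintro s ⟨hs, hs'⟩
          exact le_antisymm hs'.2 (h1.trans hs)
        · simp [measureReal_def]
      rw [e2]
      -- For `v ≥ 1` there is no quantile; the event is contained in those for levels just below 1.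
      refine le_antisymm (le_of_forall_pos_le_add fun ε hε => ?_) measureReal_nonneg
      have hv' : max (1 - ε) (1 / 2) ∈ Set.Ioo (0 : ℝ) 1 :=
        ⟨by positivity, max_lt (by linarith) (by norm_num)⟩
      have h2 : μ.real {y | v ≤ distMass μ x y} ≤
          μ.real {y | max (1 - ε) (1 / 2) ≤ distMass μ x y} :=
        measureReal_mono fun y hy => (hv'.2.le.trans h1).trans hy
      rw [hmid _ hv'] at h2
      linarith [le_max_left (1 - ε) (1 / 2)]

/-- `ballMass μ x` may be constant on intervals, so `radius` inverts it only on the range of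
`radius`. The distance has the law of `radius` at a uniform variable and hence almost surely lies in
that range. -/
theorem ae_radius_distMass (x : X) : ∀ᵐ y ∂μ, radius μ x (distMass μ x y) = dist x y := by
  have hrm : Measurable (radius μ x) := hμ.measurable_radius.comp (measurable_const.prodMk
    measurable_id)
  have hbm : Measurable (ballMass μ x) := (hμ.continuous_ballMass x).measurable
  have hdm : Measurable (dist x) := measurable_const.dist measurable_id
  have hp1 : IsProbabilityMeasure (μ.map (dist x)) :=
    Measure.isProbabilityMeasure_map hdm.aemeasurable
  have hp2 : IsProbabilityMeasure ((volume : Measure ℝ).restrict (Set.Ioo 0 1)) := ⟨by simp⟩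
  have hp3 : IsProbabilityMeasure (((volume : Measure ℝ).restrict (Set.Ioo 0 1)).map
    (radius μ x)) := Measure.isProbabilityMeasure_map hrm.aemeasurable
  have hlaw : μ.map (dist x) = ((volume : Measure ℝ).restrict (Set.Ioo 0 1)).map (radius μ x) := by
    refine Measure.ext_of_Iic _ _ fun r => ?_
    rw [← measureReal_eq_measureReal_iff, map_measureReal_apply hdm measurableSet_Iic,
      map_measureReal_apply hrm measurableSet_Iic,
      measureReal_restrict_apply (hrm measurableSet_Iic)]
    rcases lt_or_ge r 0 with hr | hr
    · have e1 : dist x ⁻¹' Set.Iic r = ∅ := by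
        ext y; simpa using hr.trans_le dist_nonneg
      have e2 : radius μ x ⁻¹' Set.Iic r = ∅ := by
        ext y; simpa using hr.trans_le (radius_nonneg _ _)
      simp [e1, e2]
    · have e1 : dist x ⁻¹' Set.Iic r = Metric.closedBall x r := by
        ext y; simp [dist_comm]
      have e2 : radius μ x ⁻¹' Set.Iic r ∩ Set.Ioo 0 1 = Set.Iic (ballMass μ x r) ∩ Set.Ioo 0 1 := by
        ext s
        refine and_congr_left fun hs => ?_
        exact hμ.radius_le_iff x hs hr
      have hb := ballMass_mem (μ := μ) x r
      rw [e1, e2]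
      change ballMass μ x r = _
      refine le_antisymm ?_ ?_
      · calc ballMass μ x r = volume.real (Set.Ioo 0 (ballMass μ x r)) := by
              rw [Real.volume_real_Ioo_of_le hb.1, sub_zero]
          _ ≤ _ := measureReal_mono (s₁ := Set.Ioo 0 (ballMass μ x r))
              (s₂ := Set.Iic (ballMass μ x r) ∩ Set.Ioo 0 1)
              (fun s hs => ⟨hs.2.le, hs.1, hs.2.trans_le hb.2⟩)
              (measure_ne_top_of_subset Set.inter_subset_right (by simp))
      · calc _ ≤ volume.real (Set.Ioc 0 (ballMass μ x r)) :=
              measureReal_mono (fun s (hs : s ∈ Set.Iic _ ∩ Set.Ioo _ _) => ⟨hs.2.1, hs.1⟩) (by simp)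
          _ = _ := by rw [Real.volume_real_Ioc_of_le hb.1, sub_zero]
  have h1 : ∀ᵐ r ∂(μ.map (dist x)), radius μ x (ballMass μ x r) = r := by
    have hmeas : MeasurableSet {r | radius μ x (ballMass μ x r) = r} :=
      measurableSet_eq_fun (hrm.comp hbm) measurable_id
    rw [hlaw, ae_map_iff hrm.aemeasurable hmeas]
    filter_upwards [ae_restrict_mem measurableSet_Ioo] with s hs
    rw [hμ.ballMass_radius x hs]
  exact ae_of_ae_map hdm.aemeasurable h1

end SpheresNull

end Quantile

/-! ### Stone's lemma; recovering the ball from its mass -/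

section Stone

variable {X : Type*} [MetricSpace X] [MeasurableSpace X] [BorelSpace X]
  [SecondCountableTopology X] {μ : Measure X} [IsProbabilityMeasure μ] {γ : ℕ}

/-- The combinatorial property of a division of space into cones. -/
def IsCells (cell : X → X → Fin γ) : Prop := ∀ y x x',
  cell y x = cell y x' → dist x' y ≤ dist x y → dist x x' ≤ dist x y

omit [SecondCountableTopology X] in
/-- **Stone's lemma**: a point `y` belongs to the ball of mass `s` around `x` only for `x` in a set
of mass at most `γ s`. -/
theorem SpheresNull.measure_mem_ball_le (hμ : SpheresNull μ) {cell : X → X → Fin γ}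
    (hc : IsCells cell) (y : X) {s : ℝ} (hs : s ∈ Set.Ioo (0 : ℝ) 1) :
    μ {x | dist x y ≤ radius μ x s} ≤ γ * ENNReal.ofReal s := by
  set A : Fin γ → Set X := fun c => {x | dist x y ≤ radius μ x s ∧ cell y x = c}
  have hU : {x | dist x y ≤ radius μ x s} = ⋃ c, A c := by
    ext x; simp [A]
  -- Within one cone, the points no farther from `y` than `x` lie in the ball of mass `s` around
  -- `x`.
  have hball : ∀ c, ∀ x ∈ A c, μ {x' ∈ A c | dist x' y ≤ dist x y} ≤ ENNReal.ofReal s := by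
    intro c x hx
    have h1 : {x' ∈ A c | dist x' y ≤ dist x y} ⊆ Metric.closedBall x (radius μ x s) := by
      rintro x' ⟨hx', hle⟩
      rw [Metric.mem_closedBall, dist_comm]
      exact (hc y x x' (hx.2.trans hx'.2.symm) hle).trans hx.1
    refine (measure_mono h1).trans (le_of_eq ?_)
    rw [← hμ.ballMass_radius x hs]
    simp only [ballMass]
    rw [ofReal_measureReal, ← ballMass, hμ.ballMass_radius x hs]
  have hA : ∀ c, μ (A c) ≤ ENNReal.ofReal s := by
    intro c
    by_cases hmax : ∃ x ∈ A c, ∀ x' ∈ A c, dist x' y ≤ dist x y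
    · obtain ⟨x, hx, hx'⟩ := hmax
      refine le_trans (measure_mono fun x' h => ?_) (hball c x hx)
      exact ⟨h, hx' x' h⟩
    · push Not at hmax
      -- Without a farthest point, `A c` is exhausted by a countable increasing family of sublevel
      -- sets, so that its measure is a supremum.
      set I := {p : ℚ // ∃ x ∈ A c, (p : ℝ) ≤ dist x y}
      have hAU : A c = ⋃ p : I, {x' ∈ A c | dist x' y ≤ (p.1 : ℝ)} := by
        ext x'
        simp only [Set.mem_iUnion]
        refine ⟨fun h => ?_, fun ⟨_, h⟩ => h.1⟩
        obtain ⟨x, hx, hlt⟩ := hmax x' h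
        obtain ⟨p, hp1, hp2⟩ := exists_rat_btwn hlt
        exact ⟨⟨p, x, hx, hp2.le⟩, h, hp1.le⟩
      have hmono : Monotone fun p : I => {x' ∈ A c | dist x' y ≤ (p.1 : ℝ)} := fun p p' h x' hx' =>
        ⟨hx'.1, hx'.2.trans (by exact_mod_cast h)⟩
      rw [hAU, hmono.directed_le.measure_iUnion]
      refine iSup_le fun p => ?_
      obtain ⟨x, hx, hpx⟩ := p.2
      refine le_trans (measure_mono fun x' h => ?_) (hball c x hx)
      exact ⟨h.1, h.2.trans hpx⟩
  rw [hU]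
  refine (measure_iUnion_fintype_le μ A).trans ((Finset.sum_le_sum fun c _ => hA c).trans ?_)
  simp

/-- After exchanging the integrals, `ψ y` is weighted by the mass of those `x` whose ball contains
`y`, and Stone's lemma bounds this weight by `γ s`. -/
theorem SpheresNull.lintegral_ball_le (hμ : SpheresNull μ) {cell : X → X → Fin γ}
    (hc : IsCells cell) {ψ : X → ℝ≥0∞} (hψ : Measurable ψ) {s : ℝ} (hs : s ∈ Set.Ioo (0 : ℝ) 1) :
    ∫⁻ x, (∫⁻ y in Metric.closedBall x (radius μ x s), ψ y ∂μ) ∂μ ≤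
      γ * ENNReal.ofReal s * ∫⁻ y, ψ y ∂μ := by
  have hrm : Measurable fun x => radius μ x s := hμ.measurable_radius.comp (measurable_id.prodMk
    measurable_const)
  have hS : MeasurableSet {p : X × X | dist p.2 p.1 ≤ radius μ p.1 s} :=
    measurableSet_le (by fun_prop) (hrm.comp measurable_fst)
  have h1 : ∀ x, ∫⁻ y in Metric.closedBall x (radius μ x s), ψ y ∂μ =
      ∫⁻ y, {p : X × X | dist p.2 p.1 ≤ radius μ p.1 s}.indicator (fun p => ψ p.2) (x, y) ∂μ := by
    intro x
    rw [← lintegral_indicator Metric.isClosed_closedBall.measurableSet]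
    rfl
  have hm : Measurable ({p : X × X | dist p.2 p.1 ≤ radius μ p.1 s}.indicator (fun p => ψ p.2)) :=
    (hψ.comp measurable_snd).indicator hS
  simp only [h1]
  rw [lintegral_lintegral_swap (f := fun x y =>
    {p : X × X | dist p.2 p.1 ≤ radius μ p.1 s}.indicator (fun p => ψ p.2) (x, y))
    hm.aemeasurable, ← lintegral_const_mul _ hψ]
  refine lintegral_mono fun y => ?_
  have hSy : MeasurableSet {x | dist x y ≤ radius μ x s} :=
    measurableSet_le (by fun_prop) hrm
  have h2 : ∀ x, {p : X × X | dist p.2 p.1 ≤ radius μ p.1 s}.indicator (fun p => ψ p.2) (x, y) =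
      {x | dist x y ≤ radius μ x s}.indicator (fun _ => ψ y) x := fun x => by
    simp only [Set.indicator, Set.mem_ofPred_eq, dist_comm]
  simp only [h2]
  rw [lintegral_indicator_const hSy, mul_comm]
  exact mul_le_mul_left (hμ.measure_mem_ball_le hc y hs) _

/-- For the cardinality bound: if two points in the same cone both had `y` strictly nearer than each
other, the one farther from `y` would contradict the cone property. So such points are injected into
the `γ` cones. -/
theorem SpheresNull.isNNKernel (hμ : SpheresNull μ) {cell : X → X → Fin γ} (hc : IsCells cell) :
    IsNNKernel μ (distMass μ) γ where
  measurable := by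
    have : Measurable fun p : X × X => (p.1, dist p.1 p.2) := by fun_prop
    exact (measurable_ballMass (μ := μ)).comp this
  map_eq x := hμ.map_distMass x
  card_le A a y := by
    rw [← Fintype.card_fin γ, ← Finset.card_univ]
    refine Finset.card_le_card_of_injOn (fun i => cell y (a i)) (fun _ _ => Finset.mem_univ _) ?_
    intro i hi j hj hij
    by_contra hne
    simp only [Finset.coe_filter, Set.mem_ofPred_eq] at hi hj
    have key : ∀ i j, i ∈ A → j ∈ A → i ≠ j → cell y (a i) = cell y (a j) →
        dist (a j) y ≤ dist (a i) y →
        ¬ distMass μ (a i) y < distMass μ (a i) (a j) := fun i j _ _ _ h hle hlt =>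
      hlt.not_ge (ballMass_mono _ (hc y _ _ h hle))
    rcases le_total (dist (a j) y) (dist (a i) y) with h | h
    · exact key i j hi.1 hj.1 hne hij h (hi.2 j hj.1 (Ne.symm hne))
    · exact key j i hj.1 hi.1 (Ne.symm hne) hij.symm h (hj.2 i hi.1 hne)

theorem SpheresNull.ae_radius_seqLaw (hμ : SpheresNull μ) {i j : ℕ} (hij : i ≠ j) :
    ∀ᵐ a ∂(seqLaw μ), radius μ (a i) (distMass μ (a i) (a j)) = dist (a i) (a j) := by
  have hd : Measurable fun p : X × X => distMass μ p.1 p.2 := by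
    have : Measurable fun p : X × X => (p.1, dist p.1 p.2) := by fun_prop
    exact (measurable_ballMass (μ := μ)).comp this
  have hm : MeasurableSet {p : X × X | radius μ p.1 (distMass μ p.1 p.2) = dist p.1 p.2} := by
    have : Measurable fun p : X × X => (p.1, distMass μ p.1 p.2) := measurable_fst.prodMk hd
    exact measurableSet_eq_fun (hμ.measurable_radius.comp this) (by fun_prop)
  have hm' : MeasurableSet {a : ℕ → X |
      radius μ (a i) (distMass μ (a i) (a j)) = dist (a i) (a j)} := by
    have : Measurable fun a : ℕ → X => (a i, a j) := by fun_prop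
    exact this hm
  rw [← map_update_seqLaw μ j, ae_map_iff (measurable_update_pair j).aemeasurable hm']
  have hm2 : MeasurableSet {p : (ℕ → X) × X |
      radius μ (Function.update p.1 j p.2 i) (distMass μ (Function.update p.1 j p.2 i)
        (Function.update p.1 j p.2 j)) = dist (Function.update p.1 j p.2 i)
        (Function.update p.1 j p.2 j)} := measurable_update_pair j hm'
  refine (Measure.ae_prod_mem_iff_ae_ae_mem hm2).2 (.of_forall fun a => ?_)
  filter_upwards [hμ.ae_radius_distMass (a i)] with y hy
  simpa [Function.update_of_ne hij] using hy

omit [SecondCountableTopology X] [BorelSpace X] in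
/-- The nearest neighbour distance in terms of the mass of the nearest neighbour ball. -/
theorem ballMass_iInf_dist {n i : ℕ} (hn : 2 ≤ n) {a : ℕ → X}
    (ha : ∀ j, i ≠ j → radius μ (a i) (distMass μ (a i) (a j)) = dist (a i) (a j)) :
    minOver (distMass μ) ((Finset.range n).erase i) (a i) a =
        ballMass μ (a i) (⨅ j : {j : ℕ // j < n ∧ j ≠ i}, dist (a i) (a j)) ∧
      radius μ (a i) (minOver (distMass μ) ((Finset.range n).erase i) (a i) a) =
        ⨅ j : {j : ℕ // j < n ∧ j ≠ i}, dist (a i) (a j) := by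
  have hne : Nonempty {j : ℕ // j < n ∧ j ≠ i} := by
    rcases Nat.eq_zero_or_pos i with h | h
    · exact ⟨⟨1, by omega, by omega⟩⟩
    · exact ⟨⟨0, by omega, by omega⟩⟩
  have hfin : Finite {j : ℕ // j < n ∧ j ≠ i} :=
    Finite.of_injective (fun j : {j : ℕ // j < n ∧ j ≠ i} => (⟨j.1, j.2.1⟩ : Fin n)) fun j k h => by
      ext; simpa using h
  obtain ⟨j, hj⟩ := exists_eq_ciInf_of_finite
    (f := fun j : {j : ℕ // j < n ∧ j ≠ i} => dist (a i) (a j))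
  have hbdd : BddBelow (Set.range fun j : {j : ℕ // j < n ∧ j ≠ i} => dist (a i) (a j)) :=
    Set.finite_range _ |>.bddBelow
  have hmin : minOver (distMass μ) ((Finset.range n).erase i) (a i) a = distMass μ (a i) (a j) := by
    refine le_antisymm ?_ ?_
    · refine Finset.fold_min_le _ |>.2 (Or.inr ⟨j, ?_, le_rfl⟩)
      exact Finset.mem_erase.2 ⟨j.2.2, Finset.mem_range.2 j.2.1⟩
    · refine Finset.le_fold_min _ |>.2 ⟨(ballMass_mem _ _).2, fun k hk => ?_⟩
      obtain ⟨hki, hkn⟩ := Finset.mem_erase.1 hk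
      refine ballMass_mono _ ?_
      have := ciInf_le hbdd ⟨k, Finset.mem_range.1 hkn, hki⟩
      exact hj.le.trans this
  rw [hmin, ← hj]
  exact ⟨rfl, ha j j.2.2.symm⟩

end Stone

/-! ### Exponential coordinates for the mass of the ball -/

section Expo

/-- The standard exponential distribution. -/
noncomputable def expo : Measure ℝ :=
  (volume.restrict (Set.Ioi 0)).withDensity fun t => ENNReal.ofReal (Real.exp (-t))

theorem integral_expo (g : ℝ → ℝ) :
    ∫ t, g t ∂expo = ∫ t in Set.Ioi 0, Real.exp (-t) * g t := by
  rw [expo, integral_withDensity_eq_integral_toReal_smul (by fun_prop) (by simp)]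
  simp [ENNReal.toReal_ofReal (Real.exp_pos _).le]

theorem integrable_expo_iff {g : ℝ → ℝ} :
    Integrable g expo ↔ IntegrableOn (fun t => Real.exp (-t) * g t) (Set.Ioi 0) := by
  rw [expo, integrable_withDensity_iff_integrable_smul' (by fun_prop) (by simp)]
  simp [ENNReal.toReal_ofReal (Real.exp_pos _).le, IntegrableOn]

instance : IsProbabilityMeasure expo := by
  constructor
  rw [expo, withDensity_apply _ MeasurableSet.univ, Measure.restrict_univ,
    ← ofReal_integral_eq_lintegral_ofReal, integral_exp_neg_Ioi_zero, ENNReal.ofReal_one]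
  · exact integrableOn_exp_neg_Ioi 0
  · exact .of_forall fun t => (Real.exp_pos _).le

theorem ae_expo_pos : ∀ᵐ t ∂expo, 0 < t :=
  (withDensity_absolutelyContinuous _ _).ae_le (ae_restrict_mem measurableSet_Ioi)

theorem integrable_expo_rpow {p : ℝ} (hp : -1 < p) : Integrable (fun t : ℝ => t ^ p) expo := by
  rw [integrable_expo_iff]
  simpa using Real.GammaIntegral_convergent (s := p + 1) (by linarith)

/-- The substitution which turns a standard exponential variable into the minimum of `m` uniform
variables. -/
noncomputable def expMass (m : ℕ) (t : ℝ) : ℝ := 1 - Real.exp (-t / m)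

theorem expMass_mem {m : ℕ} (hm : m ≠ 0) {t : ℝ} (ht : 0 < t) : expMass m t ∈ Set.Ioo (0 : ℝ) 1 := by
  have hm' : (0 : ℝ) < m := by positivity
  refine ⟨?_, by simp [expMass, Real.exp_pos]⟩
  have : Real.exp (-t / m) < 1 := by
    rw [← Real.exp_zero]
    exact Real.exp_lt_exp.2 (div_neg_of_neg_of_pos (by linarith) hm')
  simp [expMass, this]

/-- If `s = expMass m t` then `(1 - s)^m = e^(-t)`, so a standard exponential variable becomes a
minimum of `m` uniform ones. All sample sizes then share one probability space, on which pointwise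
limits make sense. -/
theorem integral_expMass {m : ℕ} (hm : m ≠ 0) (g : ℝ → ℝ) :
    ∫ t, g (expMass m t) ∂expo = m * ∫ s in Set.Ioc 0 1, g s * (1 - s) ^ (m - 1) := by
  have hm' : (0 : ℝ) < m := by positivity
  have himg : expMass m '' Set.Ioi 0 = Set.Ioo 0 1 := by
    ext s
    constructor
    · rintro ⟨t, ht, rfl⟩; exact expMass_mem hm ht
    · intro hs
      refine ⟨-m * Real.log (1 - s), ?_, ?_⟩
      · have : Real.log (1 - s) < 0 := Real.log_neg (by linarith [hs.2]) (by linarith [hs.1])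
        simp only [Set.mem_Ioi]
        nlinarith
      · rw [expMass]
        have : -(-(m : ℝ) * Real.log (1 - s)) / m = Real.log (1 - s) := by field_simp
        rw [this, Real.exp_log (by linarith [hs.2])]
        ring
  have hinj : Set.InjOn (expMass m) (Set.Ioi 0) := by
    intro t _ t' _ h
    have h1 : Real.exp (-t / m) = Real.exp (-t' / m) := by simpa [expMass] using h
    have h2 := Real.exp_injective h1
    field_simp at h2
    linarith
  have hder : ∀ t ∈ Set.Ioi (0 : ℝ), HasDerivWithinAt (expMass m) (Real.exp (-t / m) / m)
      (Set.Ioi 0) t := by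
    intro t _
    have h1 : HasDerivAt (fun t : ℝ => -t / m) (-1 / m) t := ((hasDerivAt_id t).neg).div_const _
    have h2 := (h1.exp.const_sub 1).hasDerivWithinAt (s := Set.Ioi 0)
    refine h2.congr_deriv ?_
    ring
  have hcv := integral_image_eq_integral_abs_deriv_smul measurableSet_Ioi hder hinj
    (fun s => g s * (1 - s) ^ (m - 1))
  rw [himg] at hcv
  rw [integral_expo, integral_Ioc_eq_integral_Ioo, hcv, ← integral_const_mul]
  refine setIntegral_congr_fun measurableSet_Ioi fun t _ => ?_
  simp only [expMass, sub_sub_cancel, smul_eq_mul]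
  rw [abs_of_pos (div_pos (Real.exp_pos _) hm')]
  have : Real.exp (-t) = Real.exp (-t / m) * Real.exp (-t / m) ^ (m - 1) := by
    rw [← pow_succ', ← Real.exp_nat_mul]
    congr 1
    rw [Nat.sub_add_cancel (by omega)]
    field_simp
  rw [this]
  field_simp

theorem measurable_expMass (m : ℕ) : Measurable (expMass m) := by
  unfold expMass; fun_prop

theorem IsNNKernel.map_expMass {X : Type*} [MeasurableSpace X] {μ : Measure X}
    [IsProbabilityMeasure μ] {κ : X → X → ℝ} {γ : ℕ} (hκ : IsNNKernel μ κ γ) {n : ℕ} (hn : 2 ≤ n) :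
    (μ.prod expo).map (fun p => (p.1, expMass (n - 1) p.2)) = nnLaw μ κ n := by
  have hm : Measurable fun p : X × ℝ => (p.1, expMass (n - 1) p.2) :=
    measurable_fst.prodMk ((measurable_expMass _).comp measurable_snd)
  have := Measure.isProbabilityMeasure_map (μ := μ.prod expo) hm.aemeasurable
  have := hκ.isProbabilityMeasure_nnLaw n
  refine Measure.ext fun S hS => ?_
  rw [← measureReal_eq_measureReal_iff]
  have hJ : BddMeas (S.indicator (fun _ => (1 : ℝ))) := by
    refine ⟨measurable_const.indicator hS, 1, fun p => ?_⟩
    by_cases h : p ∈ S <;> simp [h]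
  have h1 : ∫ p, S.indicator (fun _ => (1 : ℝ)) p
        ∂((μ.prod expo).map (fun p => (p.1, expMass (n - 1) p.2))) =
      ∫ p, S.indicator (fun _ => (1 : ℝ)) p ∂(nnLaw μ κ n) := by
    rw [hκ.integral_nnLaw hn hJ, integral_map hm.aemeasurable hJ.measurable.aestronglyMeasurable,
      integral_prod _ ((hJ.comp hm).integrable _), ← integral_const_mul]
    refine integral_congr_ae (.of_forall fun x => ?_)
    exact integral_expMass (m := n - 1) (by omega) fun s => S.indicator (fun _ => (1 : ℝ)) (x, s)
  simpa [integral_indicator_const _ hS] using h1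

theorem mul_expMass_le {n : ℕ} (hn : 2 ≤ n) {t : ℝ} (ht : 0 ≤ t) :
    n * expMass (n - 1) t ≤ 2 * t := by
  have h1 : (1 : ℝ) ≤ (n - 1 : ℕ) := by exact_mod_cast (by omega : 1 ≤ n - 1)
  have h2 : (n : ℝ) ≤ 2 * (n - 1 : ℕ) := by exact_mod_cast (by omega : n ≤ 2 * (n - 1))
  have h3 : expMass (n - 1) t ≤ t / (n - 1 : ℕ) := by
    have := Real.add_one_le_exp (-t / (n - 1 : ℕ))
    rw [expMass]
    rw [neg_div] at this ⊢
    linarith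
  calc n * expMass (n - 1) t ≤ n * (t / (n - 1 : ℕ)) := by gcongr
    _ ≤ 2 * (n - 1 : ℕ) * (t / (n - 1 : ℕ)) := by gcongr
    _ = 2 * t := by field_simp

/-- From `1 - e^(-y) ≥ y e^(-y)` with `y = t/(n - 1)`. A lower bound is needed because `h` may be
singular at 0. -/
theorem le_mul_expMass {n : ℕ} (hn : 2 ≤ n) {t : ℝ} (ht : 0 ≤ t) :
    t * Real.exp (-t / (n - 1 : ℕ)) ≤ n * expMass (n - 1) t := by
  have h1 : (1 : ℝ) ≤ (n - 1 : ℕ) := by exact_mod_cast (by omega : 1 ≤ n - 1)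
  have h2 : ((n - 1 : ℕ) : ℝ) ≤ n := by exact_mod_cast (by omega : n - 1 ≤ n)
  have h3 : t / (n - 1 : ℕ) * Real.exp (-t / (n - 1 : ℕ)) ≤ expMass (n - 1) t := by
    have h4 := Real.add_one_le_exp (t / (n - 1 : ℕ))
    have h5 := mul_le_mul_of_nonneg_right h4 (Real.exp_pos (-t / (n - 1 : ℕ))).le
    rw [← Real.exp_add] at h5
    have : t / ((n - 1 : ℕ) : ℝ) + -t / (n - 1 : ℕ) = 0 := by ring
    rw [this, Real.exp_zero] at h5
    rw [expMass]
    linarith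
  have h6 : 0 ≤ expMass (n - 1) t := le_trans (by positivity) h3
  calc t * Real.exp (-t / (n - 1 : ℕ))
      = (n - 1 : ℕ) * (t / (n - 1 : ℕ) * Real.exp (-t / (n - 1 : ℕ))) := by field_simp
    _ ≤ (n - 1 : ℕ) * expMass (n - 1) t := by gcongr
    _ ≤ n * expMass (n - 1) t := by gcongr

theorem tendsto_expMass (t : ℝ) : Tendsto (fun n : ℕ => expMass (n - 1) t) atTop (𝓝 0) := by
  have h1 : Tendsto (fun n : ℕ => ((n - 1 : ℕ) : ℝ)) atTop atTop :=
    tendsto_natCast_atTop_atTop.comp (tendsto_sub_atTop_nat 1)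
  have h2 : Tendsto (fun n : ℕ => -t / ((n - 1 : ℕ) : ℝ)) atTop (𝓝 0) :=
    tendsto_const_nhds.div_atTop h1
  have h3 := (Real.continuous_exp.tendsto 0).comp h2
  have h4 := h3.const_sub 1
  simpa [expMass, Function.comp_def] using h4

theorem tendsto_mul_expMass {t : ℝ} (ht : 0 ≤ t) :
    Tendsto (fun n : ℕ => n * expMass (n - 1) t) atTop (𝓝 t) := by
  have h1 : Tendsto (fun n : ℕ => ((n - 1 : ℕ) : ℝ)) atTop atTop :=
    tendsto_natCast_atTop_atTop.comp (tendsto_sub_atTop_nat 1)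
  have h2 : Tendsto (fun n : ℕ => -t / ((n - 1 : ℕ) : ℝ)) atTop (𝓝 0) :=
    tendsto_const_nhds.div_atTop h1
  have h3 : Tendsto (fun n : ℕ => t * Real.exp (-t / ((n - 1 : ℕ) : ℝ))) atTop (𝓝 t) := by
    simpa using ((Real.continuous_exp.tendsto 0).comp h2).const_mul t
  have h4 : Tendsto (fun n : ℕ => t + t / ((n - 1 : ℕ) : ℝ)) atTop (𝓝 t) := by
    simpa using (tendsto_const_nhds (x := t)).add (tendsto_const_nhds.div_atTop h1)
  refine tendsto_of_tendsto_of_tendsto_of_le_of_le' h3 h4 ?_ ?_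
  · filter_upwards [eventually_ge_atTop 2] with n hn using le_mul_expMass hn ht
  · filter_upwards [eventually_ge_atTop 2] with n hn
    have h1 : (1 : ℝ) ≤ (n - 1 : ℕ) := by exact_mod_cast (by omega : 1 ≤ n - 1)
    have h5 : expMass (n - 1) t ≤ t / (n - 1 : ℕ) := by
      have := Real.add_one_le_exp (-t / (n - 1 : ℕ))
      rw [expMass]
      rw [neg_div] at this ⊢
      linarith
    have h6 : (n : ℝ) = (n - 1 : ℕ) + 1 := by
      rw [← Nat.cast_add_one]; congr 1; omega
    calc (n : ℝ) * expMass (n - 1) t ≤ n * (t / (n - 1 : ℕ)) := by gcongr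
      _ = t + t / (n - 1 : ℕ) := by rw [h6]; field_simp

end Expo

/-! ### Consequences of the model assumptions -/

section Model

variable {d q : ℕ} {f : E q → E d → ℝ} {Θ Θ0 : Set (E q)} {θ0 : E q}

namespace IsModel

variable (hM : IsModel f Θ Θ0 θ0)
include hM

theorem mem : θ0 ∈ Θ0 := mem_of_mem_nhds hM.nhds

theorem mem_param {θ : E q} (hθ : θ ∈ Θ0) : θ ∈ Θ := interior_subset (hM.subset hθ)

theorem nonneg_of_mem {θ : E q} (hθ : θ ∈ Θ0) (x : E d) : 0 ≤ f θ x := hM.nonneg θ (hM.mem_param hθ) x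

theorem measurable_of_mem {θ : E q} (hθ : θ ∈ Θ0) : Measurable (f θ) :=
  hM.measurable θ (hM.mem_param hθ)

theorem integrable {θ : E q} (hθ : θ ∈ Θ0) : Integrable (f θ) := by
  refine ⟨(hM.measurable_of_mem hθ).aestronglyMeasurable, ?_⟩
  rw [hasFiniteIntegral_iff_ofReal (.of_forall (hM.nonneg_of_mem hθ)),
    hM.lintegral_eq_one θ (hM.mem_param hθ)]
  exact ENNReal.one_lt_top

theorem integral_eq_one {θ : E q} (hθ : θ ∈ Θ0) : ∫ x, f θ x = 1 := by
  rw [integral_eq_lintegral_of_nonneg_ae (.of_forall (hM.nonneg_of_mem hθ))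
    (hM.measurable_of_mem hθ).aestronglyMeasurable, hM.lintegral_eq_one θ (hM.mem_param hθ),
    ENNReal.toReal_one]

theorem isProbabilityMeasure_law : IsProbabilityMeasure (law f θ0) := by
  constructor
  rw [law, withDensity_apply _ MeasurableSet.univ, Measure.restrict_univ,
    hM.lintegral_eq_one θ0 (hM.mem_param hM.mem)]

omit hM in
theorem law_absolutelyContinuous : law f θ0 ≪ volume := withDensity_absolutelyContinuous _ _

omit hM in
theorem spheresNull (hd : 0 < d) : SpheresNull (law f θ0) := fun x r => by
  have : Nonempty (Fin d) := ⟨⟨0, hd⟩⟩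
  have : Nontrivial (E d) := inferInstance
  exact law_absolutelyContinuous (Measure.addHaar_sphere _ x r)

theorem ae_pos : ∀ᵐ x ∂(law f θ0), 0 < f θ0 x := by
  have h1 := (ae_withDensity_iff (p := fun x => 0 < f θ0 x) (μ := (volume : Measure (E d)))
    (hM.measurable_of_mem hM.mem).ennreal_ofReal).2 (.of_forall fun x hx => by simpa using hx)
  exact h1

/-- Where `f θ0` vanishes the quotient is 0 by convention, so `u` must vanish there as well. -/
theorem setIntegral_div {u : E d → ℝ} (hu : ∀ᵐ x, f θ0 x = 0 → u x = 0) (B : Set (E d))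
    (hB : MeasurableSet B) :
    ∫ y in B, u y / f θ0 y ∂(law f θ0) = ∫ y in B, u y := by
  rw [law, setIntegral_withDensity_eq_setIntegral_toReal_smul₀
    (hM.measurable_of_mem hM.mem).ennreal_ofReal.aemeasurable (.of_forall fun x => by simp) _ hB]
  refine integral_congr_ae (ae_restrict_of_ae ?_)
  filter_upwards [hu] with x hx
  rw [ENNReal.toReal_ofReal (hM.nonneg_of_mem hM.mem x), smul_eq_mul]
  by_cases h : f θ0 x = 0
  · simp [h, hx h]
  · field_simp

theorem setLIntegral_div {u : E d → ℝ} (hu : ∀ᵐ x, f θ0 x = 0 → u x = 0) (hum : Measurable u)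
    (B : Set (E d)) (hB : MeasurableSet B) :
    ∫⁻ y in B, ‖u y / f θ0 y‖ₑ ∂(law f θ0) = ∫⁻ y in B, ‖u y‖ₑ := by
  have hg := hM.measurable_of_mem hM.mem
  have hm : Measurable fun y => ‖u y / f θ0 y‖ₑ := (hum.div hg).enorm
  rw [law, setLIntegral_withDensity_eq_setLIntegral_mul _ hg.ennreal_ofReal hm hB]
  refine lintegral_congr_ae (ae_restrict_of_ae ?_)
  filter_upwards [hu] with x hx
  have h0 := hM.nonneg_of_mem hM.mem x
  by_cases h : f θ0 x = 0
  · simp [h, hx h]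
  · simp only [Pi.mul_apply]
    rw [← Real.enorm_of_nonneg h0, ← enorm_mul]
    congr 1
    field_simp

theorem support_imp {θ : E q} (hθ : θ ∈ Θ0) : ∀ᵐ x, f θ0 x = 0 → f θ x = 0 := by
  filter_upwards [hM.support θ hθ] with x hx using hx.2

/-- In the interior of the parameter set, the gradient vanishes where the density does. -/
theorem gradF_eq_zero {θ : E q} (hθ : θ ∈ interior Θ0) :
    ∀ᵐ x, f θ0 x = 0 → gradF f θ x = 0 := by
  filter_upwards [hM.support_imp (interior_subset hθ)] with x hx h0
  have hmin : IsLocalMin (fun t => f t x) θ := by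
    filter_upwards [mem_interior_iff_mem_nhds.1 hθ] with t ht
    rw [hx h0]
    exact hM.nonneg_of_mem ht x
  rw [gradF, gradient, hmin.fderiv_eq_zero, map_zero]

end IsModel

namespace A2

variable (hA : A2 f Θ0)
include hA

theorem continuous {θ : E q} (hθ : θ ∈ Θ0) : Continuous (f θ) := by
  rw [← continuousOn_univ]
  exact hA.continuousOn.comp (f := fun x : E d => (θ, x)) (by fun_prop) fun x _ => ⟨hθ, trivial⟩

theorem continuous_grad {θ : E q} (hθ : θ ∈ Θ0) : Continuous (gradF f θ) := by
  rw [← continuousOn_univ]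
  exact hA.continuousOn_grad.comp (f := fun x : E d => (θ, x)) (by fun_prop) fun x _ => ⟨hθ, trivial⟩

theorem continuousOn_coord (j : Fin q) :
    ContinuousOn (fun p : E q × E d => gradF f p.1 p.2 j) (Θ0 ×ˢ Set.univ) :=
  (EuclideanSpace.proj (𝕜 := ℝ) j).continuous.comp_continuousOn hA.continuousOn_grad

theorem continuous_coord {θ : E q} (hθ : θ ∈ Θ0) (j : Fin q) :
    Continuous fun x => gradF f θ x j :=
  (EuclideanSpace.proj (𝕜 := ℝ) j).continuous.comp (hA.continuous_grad hθ)

theorem hasDerivAt_line {θ : E q} (x : E d) (j : Fin q) {t : ℝ}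
    (hθ : θ + t • EuclideanSpace.single j 1 ∈ Θ0) :
    HasDerivAt (fun s : ℝ => f (θ + s • EuclideanSpace.single j 1) x)
      (gradF f (θ + t • EuclideanSpace.single j 1) x j) t := by
  have h1 := (hA.differentiableAt _ hθ x).hasGradientAt.hasFDerivAt
  have h2 : HasDerivAt (fun s : ℝ => θ + s • EuclideanSpace.single j (1 : ℝ))
      (EuclideanSpace.single j (1 : ℝ)) t := by
    simpa using ((hasDerivAt_id t).smul_const (EuclideanSpace.single j (1 : ℝ))).const_add θ
  have h3 := h1.comp_hasDerivAt t h2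
  refine h3.congr_deriv ?_
  rw [InnerProductSpace.toDual_apply_apply, EuclideanSpace.inner_single_right]
  simp [gradF]

end A2

/-- Averages over shrinking balls of a function which is jointly continuous. -/
theorem tendsto_average_ball {F : E q × E d → ℝ}
    (hF : ContinuousOn F (Θ0 ×ˢ Set.univ)) {ι : Type*} {l : Filter ι} {θn : ι → E q} {θ : E q}
    (hθn : ∀ᶠ n in l, θn n ∈ Θ0) (hθ : θ ∈ Θ0) (hlim : Tendsto θn l (𝓝 θ)) {r : ι → ℝ}
    (hr : Tendsto r l (𝓝 0)) (hr0 : ∀ᶠ n in l, 0 < r n) (x : E d) :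
    Tendsto (fun n => (∫ y in Metric.closedBall x (r n), F (θn n, y)) /
      volume.real (Metric.closedBall x (r n))) l (𝓝 (F (θ, x))) := by
  rw [Metric.tendsto_nhds]
  intro ε hε
  have hc := hF (θ, x) ⟨hθ, trivial⟩
  have hev := (Metric.tendsto_nhds.1 hc (ε / 2) (half_pos hε))
  rw [eventually_nhdsWithin_iff, nhds_prod_eq] at hev
  obtain ⟨pa, hpa, pb, hpb, hab⟩ := eventually_prod_iff.1 hev
  obtain ⟨δ, hδ, hball⟩ := Metric.eventually_nhds_iff.1 hpb
  filter_upwards [hθn, hlim.eventually hpa, hr.eventually (gt_mem_nhds hδ), hr0] with n h1 h2 h3 h4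
  have hvol : 0 < volume.real (Metric.closedBall x (r n)) := by
    rw [measureReal_def]
    exact ENNReal.toReal_pos (Metric.measure_closedBall_pos _ _ h4).ne'
      measure_closedBall_lt_top.ne
  have hcont : Continuous fun y => F (θn n, y) := by
    rw [← continuousOn_univ]
    exact hF.comp (f := fun y : E d => (θn n, y)) (by fun_prop) fun y _ => ⟨h1, trivial⟩
  have hint : IntegrableOn (fun y => F (θn n, y)) (Metric.closedBall x (r n)) :=
    hcont.continuousOn.integrableOn_compact (isCompact_closedBall _ _)
  have hbd : ∀ y ∈ Metric.closedBall x (r n), ‖F (θn n, y) - F (θ, x)‖ ≤ ε / 2 := fun y hy => by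
    have hy' : dist y x < δ := (Metric.mem_closedBall.1 hy).trans_lt h3
    exact (hab h2 (hball hy') ⟨h1, trivial⟩).le
  have key := norm_setIntegral_le_of_norm_le_const (μ := (volume : Measure (E d)))
    measure_closedBall_lt_top hbd
  rw [integral_sub hint (integrableOn_const measure_closedBall_lt_top.ne), setIntegral_const,
    smul_eq_mul] at key
  rw [Real.dist_eq, div_sub' hvol.ne', abs_div, abs_of_pos hvol, div_lt_iff₀ hvol]
  rw [Real.norm_eq_abs] at key
  refine key.trans_lt ?_
  nlinarith

theorem IsModel.ballMass_eq (hM : IsModel f Θ Θ0 θ0) (x : E d) (r : ℝ) :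
    ballMass (law f θ0) x r = ∫ y in Metric.closedBall x r, f θ0 y := by
  have hB : MeasurableSet (Metric.closedBall x r) := Metric.isClosed_closedBall.measurableSet
  rw [ballMass, law, measureReal_def, withDensity_apply _ hB,
    integral_eq_lintegral_of_nonneg_ae (.of_forall fun y => hM.nonneg_of_mem hM.mem y)
      (hM.measurable_of_mem hM.mem).aestronglyMeasurable]

theorem IsModel.ballMass_pos (hM : IsModel f Θ Θ0 θ0) (hA : A2 f Θ0) {x : E d}
    (hx : 0 < f θ0 x) {r : ℝ} (hr : 0 < r) : 0 < ballMass (law f θ0) x r := by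
  have hP := hM.isProbabilityMeasure_law
  rw [ballMass, measureReal_def]
  refine ENNReal.toReal_pos ?_ (measure_ne_top _ _)
  intro h0
  have h1 : law f θ0 (Metric.ball x r ∩ {y | 0 < f θ0 y}) = 0 :=
    measure_mono_null (Set.inter_subset_left.trans Metric.ball_subset_closedBall) h0
  rw [law, withDensity_apply_eq_zero (hM.measurable_of_mem hM.mem).ennreal_ofReal] at h1
  have hopen : IsOpen (Metric.ball x r ∩ {y | 0 < f θ0 y}) :=
    Metric.isOpen_ball.inter (isOpen_lt continuous_const (hA.continuous hM.mem))
  have h2 := hopen.measure_pos (volume : Measure (E d)) ⟨x, Metric.mem_ball_self hr, hx⟩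
  refine h2.ne' (measure_mono_null (fun y hy => Set.mem_inter ?_ hy) h1)
  have : 0 < f θ0 y := hy.2
  simpa using this

/-- Every ball of positive radius around a point of positive density has positive mass, so a
vanishing mass forces a vanishing radius. -/
theorem IsModel.tendsto_radius (hM : IsModel f Θ Θ0 θ0) (hA : A2 f Θ0) (hd : 0 < d) {x : E d}
    (hx : 0 < f θ0 x) {ι : Type*} {l : Filter ι} {s : ι → ℝ}
    (hs : ∀ᶠ n in l, s n ∈ Set.Ioo (0 : ℝ) 1) (hs0 : Tendsto s l (𝓝 0)) :
    Tendsto (fun n => radius (law f θ0) x (s n)) l (𝓝 0) := by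
  have hP := hM.isProbabilityMeasure_law
  rw [Metric.tendsto_nhds]
  intro ε hε
  have hpos := hM.ballMass_pos hA hx (half_pos hε)
  filter_upwards [hs, hs0.eventually (gt_mem_nhds hpos)] with n h1 h2
  have h3 := ((IsModel.spheresNull hd).radius_le_iff x h1 (half_pos hε).le).2 h2.le
  rw [Real.dist_eq, sub_zero, abs_of_nonneg (SpheresNull.radius_nonneg _ _)]
  linarith

/-- Integrals over balls depend measurably on the ball. -/
theorem measurable_setIntegral_closedBall {u : E d → ℝ} (hu : Measurable u) :
    Measurable fun p : E d × ℝ => ∫ y in Metric.closedBall p.1 p.2, u y := by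
  have hS : MeasurableSet {p : (E d × ℝ) × E d | dist p.2 p.1.1 ≤ p.1.2} :=
    measurableSet_le (by fun_prop) (by fun_prop)
  have h : (fun p : E d × ℝ => ∫ y in Metric.closedBall p.1 p.2, u y) =
      fun p => ∫ y, {p : (E d × ℝ) × E d | dist p.2 p.1.1 ≤ p.1.2}.indicator
        (fun p => u p.2) (p, y) := by
    funext p
    rw [← integral_indicator Metric.isClosed_closedBall.measurableSet]
    rfl
  rw [h]
  exact (((hu.comp measurable_snd).indicator hS).stronglyMeasurable.integral_prod_right').measurable

end Model

/-! ### Averages over balls of given mass -/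

section QuantileBall

variable {d q : ℕ} {μ : Measure (E d)} [IsProbabilityMeasure μ]

/-- The closed ball around `p.1` of mass `p.2`. -/
def qBall (μ : Measure (E d)) (p : E d × ℝ) : Set (E d) := Metric.closedBall p.1 (radius μ p.1 p.2)

/-- Lebesgue integral over the ball around `p.1` of `μ`-mass `p.2`. -/
noncomputable def ballInt (μ : Measure (E d)) (φ : E d → ℝ) (p : E d × ℝ) : ℝ :=
  ∫ y in qBall μ p, φ y

/-- `μ`-average over the ball around `p.1` of `μ`-mass `p.2`. -/
noncomputable def avgB (μ : Measure (E d)) (Ψ : E d → ℝ≥0∞) (p : E d × ℝ) : ℝ≥0∞ :=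
  (∫⁻ y in qBall μ p, Ψ y ∂μ) / ENNReal.ofReal p.2

omit [IsProbabilityMeasure μ] in
theorem measurableSet_qBall (p : E d × ℝ) : MeasurableSet (qBall μ p) :=
  Metric.isClosed_closedBall.measurableSet

theorem measurable_ballInt (hμ : SpheresNull μ) {φ : E d → ℝ} (hφ : Measurable φ) :
    Measurable (ballInt μ φ) :=
  (measurable_setIntegral_closedBall hφ).comp (measurable_fst.prodMk hμ.measurable_radius)

theorem measurable_avgB (hμ : SpheresNull μ) {Ψ : E d → ℝ≥0∞} (hΨ : Measurable Ψ) :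
    Measurable (avgB μ Ψ) := by
  have hS : MeasurableSet {p : (E d × ℝ) × E d | dist p.2 p.1.1 ≤ radius μ p.1.1 p.1.2} :=
    measurableSet_le (by fun_prop) (hμ.measurable_radius.comp measurable_fst)
  have h : (fun p : E d × ℝ => ∫⁻ y in qBall μ p, Ψ y ∂μ) =
      fun p => ∫⁻ y, {p : (E d × ℝ) × E d | dist p.2 p.1.1 ≤ radius μ p.1.1 p.1.2}.indicator
        (fun p => Ψ p.2) (p, y) ∂μ := by
    funext p
    rw [← lintegral_indicator (measurableSet_qBall p)]
    rfl
  have h2 : Measurable fun p : E d × ℝ => ∫⁻ y in qBall μ p, Ψ y ∂μ := by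
    rw [h]
    exact ((hΨ.comp measurable_snd).indicator hS).lintegral_prod_right'
  exact h2.div (measurable_snd.ennreal_ofReal)

omit [IsProbabilityMeasure μ] in
theorem avgB_mono {Ψ Ψ' : E d → ℝ≥0∞} (h : ∀ᵐ y ∂μ, Ψ y ≤ Ψ' y) (p : E d × ℝ) :
    avgB μ Ψ p ≤ avgB μ Ψ' p :=
  ENNReal.div_le_div_right (lintegral_mono_ae (ae_restrict_of_ae h)) _

omit [IsProbabilityMeasure μ] in
theorem avgB_add {Ψ Ψ' : E d → ℝ≥0∞} (h : Measurable Ψ) (p : E d × ℝ) :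
    avgB μ (fun y => Ψ y + Ψ' y) p = avgB μ Ψ p + avgB μ Ψ' p := by
  rw [avgB, lintegral_add_left h, ENNReal.add_div, avgB, avgB]

theorem measure_qBall (hμ : SpheresNull μ) {p : E d × ℝ} (hp : p.2 ∈ Set.Ioo (0 : ℝ) 1) :
    μ (qBall μ p) = ENNReal.ofReal p.2 := by
  have h := hμ.ballMass_radius p.1 hp
  rw [ballMass, measureReal_def] at h
  conv_rhs => rw [← h]
  rw [ENNReal.ofReal_toReal (measure_ne_top _ _), qBall]

theorem avgB_const_le (hμ : SpheresNull μ) {p : E d × ℝ} (hp : p.2 ∈ Set.Ioo (0 : ℝ) 1)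
    (c : ℝ≥0∞) : avgB μ (fun _ => c) p ≤ c := by
  rw [avgB, setLIntegral_const, measure_qBall hμ hp]
  exact ENNReal.div_le_of_le_mul le_rfl

/-- Stone's lemma has a factor `s`, which division by the mass cancels. The result is uniform in `s`
and plays the role of a maximal inequality. -/
theorem lintegral_avgB_le (hμ : SpheresNull μ) {γ : ℕ} {cell : E d → E d → Fin γ}
    (hc : IsCells cell) {Ψ : E d → ℝ≥0∞} (hΨ : Measurable Ψ) {s : ℝ}
    (hs : s ∈ Set.Ioo (0 : ℝ) 1) : ∫⁻ x, avgB μ Ψ (x, s) ∂μ ≤ γ * ∫⁻ y, Ψ y ∂μ := by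
  have h0 : ENNReal.ofReal s ≠ 0 := by simpa using hs.1
  have h1 := hμ.lintegral_ball_le hc hΨ hs
  simp only [avgB, div_eq_mul_inv]
  rw [lintegral_mul_const' _ _ (ENNReal.inv_ne_top.2 h0), ← div_eq_mul_inv]
  refine ENNReal.div_le_of_le_mul (h1.trans (le_of_eq ?_))
  ring

/-- Cauchy–Schwarz against the constant 1; the ball has mass exactly `p.2`. -/
theorem avgB_sq_le (hμ : SpheresNull μ) {F : E d → ℝ≥0∞} (hF : Measurable F) {p : E d × ℝ}
    (hp : p.2 ∈ Set.Ioo (0 : ℝ) 1) : avgB μ F p ^ 2 ≤ avgB μ (fun y => F y ^ 2) p := by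
  have h0 : ENNReal.ofReal p.2 ≠ 0 := by simpa using hp.1
  have hpq : Real.HolderConjugate 2 2 := Real.HolderConjugate.two_two
  have h := ENNReal.lintegral_mul_le_Lp_mul_Lq (μ.restrict (qBall μ p)) hpq
    hF.aemeasurable (measurable_const (a := (1 : ℝ≥0∞))).aemeasurable
  simp only [Pi.mul_apply, mul_one, ENNReal.one_rpow, lintegral_const, one_mul,
    Measure.restrict_apply_univ, measure_qBall hμ hp] at h
  have h2 : (∫⁻ y in qBall μ p, F y ∂μ) ^ 2 ≤
      (∫⁻ y in qBall μ p, F y ^ 2 ∂μ) * ENNReal.ofReal p.2 := by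
    refine (pow_le_pow_left₀ (by positivity) h 2).trans (le_of_eq ?_)
    rw [mul_pow, ← ENNReal.rpow_natCast, ← ENNReal.rpow_mul, ← ENNReal.rpow_natCast,
      ← ENNReal.rpow_mul]
    norm_num
  rw [avgB, avgB, ENNReal.div_eq_inv_mul, mul_pow]
  calc (ENNReal.ofReal p.2)⁻¹ ^ 2 * (∫⁻ y in qBall μ p, F y ∂μ) ^ 2
      ≤ (ENNReal.ofReal p.2)⁻¹ ^ 2 * ((∫⁻ y in qBall μ p, F y ^ 2 ∂μ) * ENNReal.ofReal p.2) := by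
        gcongr
    _ = (∫⁻ y in qBall μ p, F y ^ 2 ∂μ) / ENNReal.ofReal p.2 *
        ((ENNReal.ofReal p.2)⁻¹ * ENNReal.ofReal p.2) := by
        rw [div_eq_mul_inv]; ring
    _ = _ := by rw [ENNReal.inv_mul_cancel h0 ENNReal.ofReal_ne_top, mul_one]

end QuantileBall

/-! ### Relative integrals over balls and moment majorants -/

section Bounds

variable {d q : ℕ} {f : E q → E d → ℝ} {Θ Θ0 : Set (E q)} {θ0 : E q}

theorem IsModel.ballInt_self (hM : IsModel f Θ Θ0 θ0) (hd : 0 < d) {p : E d × ℝ}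
    (hp : p.2 ∈ Set.Ioo (0 : ℝ) 1) : ballInt (law f θ0) (f θ0) p = p.2 := by
  have hP := hM.isProbabilityMeasure_law
  rw [ballInt, qBall, ← hM.ballMass_eq, (IsModel.spheresNull hd).ballMass_radius p.1 hp]

theorem IsModel.enorm_ballInt_div_le (hM : IsModel f Θ Θ0 θ0) {φ : E d → ℝ} (hφ : Measurable φ)
    (h0 : ∀ᵐ y, f θ0 y = 0 → φ y = 0) {p : E d × ℝ} (hp : p.2 ∈ Set.Ioo (0 : ℝ) 1) :
    ‖ballInt (law f θ0) φ p / p.2‖ₑ ≤ avgB (law f θ0) (fun y => ‖φ y / f θ0 y‖ₑ) p := by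
  rw [avgB, hM.setLIntegral_div h0 hφ _ (measurableSet_qBall p), div_eq_mul_inv, enorm_mul,
    div_eq_mul_inv, enorm_inv hp.1.ne', Real.enorm_of_nonneg hp.1.le]
  gcongr
  exact enorm_integral_le_lintegral_enorm _

theorem IsModel.sq_ballInt_div_le (hM : IsModel f Θ Θ0 θ0) (hd : 0 < d) {φ : E d → ℝ}
    (hφ : Measurable φ) (h0 : ∀ᵐ y, f θ0 y = 0 → φ y = 0) {Ψ : E d → ℝ≥0∞}
    (hΨ : ∀ y, ‖φ y / f θ0 y‖ₑ ^ 2 ≤ Ψ y) {p : E d × ℝ} (hp : p.2 ∈ Set.Ioo (0 : ℝ) 1)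
    (hfin : avgB (law f θ0) Ψ p ≠ ∞) :
    (ballInt (law f θ0) φ p / p.2) ^ 2 ≤ (avgB (law f θ0) Ψ p).toReal := by
  have hP := hM.isProbabilityMeasure_law
  have hμ : SpheresNull (law f θ0) := IsModel.spheresNull hd
  have hm : Measurable fun y => ‖φ y / f θ0 y‖ₑ :=
    (hφ.div (hM.measurable_of_mem hM.mem)).enorm
  have h1 : ‖ballInt (law f θ0) φ p / p.2‖ₑ ^ 2 ≤ avgB (law f θ0) Ψ p :=
    (pow_le_pow_left₀ (by positivity) (hM.enorm_ballInt_div_le hφ h0 hp) 2).trans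
      ((avgB_sq_le hμ hm hp).trans (avgB_mono (.of_forall hΨ) p))
  rw [← ENNReal.ofReal_le_iff_le_toReal hfin, ← sq_abs, ENNReal.ofReal_pow (abs_nonneg _),
    ← Real.enorm_eq_ofReal_abs]
  exact h1

theorem IsModel.pow_four_ballInt_div_le (hM : IsModel f Θ Θ0 θ0) (hd : 0 < d) {φ : E d → ℝ}
    (hφ : Measurable φ) (h0 : ∀ᵐ y, f θ0 y = 0 → φ y = 0) {Ψ : E d → ℝ≥0∞}
    (hΨ : ∀ y, ‖φ y / f θ0 y‖ₑ ^ 4 ≤ Ψ y) {p : E d × ℝ} (hp : p.2 ∈ Set.Ioo (0 : ℝ) 1)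
    (hfin : avgB (law f θ0) Ψ p ≠ ∞) :
    (ballInt (law f θ0) φ p / p.2) ^ 4 ≤ (avgB (law f θ0) Ψ p).toReal := by
  have hP := hM.isProbabilityMeasure_law
  have hμ : SpheresNull (law f θ0) := IsModel.spheresNull hd
  have hm : Measurable fun y => ‖φ y / f θ0 y‖ₑ :=
    (hφ.div (hM.measurable_of_mem hM.mem)).enorm
  have h1 : ‖ballInt (law f θ0) φ p / p.2‖ₑ ^ 4 ≤ avgB (law f θ0) Ψ p := by
    refine (pow_le_pow_left₀ (by positivity) (hM.enorm_ballInt_div_le hφ h0 hp) 4).trans ?_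
    rw [show 4 = 2 * 2 from rfl, pow_mul]
    refine (pow_le_pow_left₀ (by positivity) (avgB_sq_le hμ hm hp) 2).trans
      ((avgB_sq_le hμ (hm.pow_const 2) hp).trans (avgB_mono (.of_forall fun y => ?_) p))
    simp only [← pow_mul]
    exact hΨ y
  rw [← ENNReal.ofReal_le_iff_le_toReal hfin,
    show (ballInt (law f θ0) φ p / p.2) ^ 4 = |ballInt (law f θ0) φ p / p.2| ^ 4 by
      rw [show 4 = 2 * 2 from rfl, pow_mul, pow_mul, sq_abs], ENNReal.ofReal_pow (abs_nonneg _),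
    ← Real.enorm_eq_ofReal_abs]
  exact h1

/-- A measurable majorant of a family which is continuous in the parameter. -/
theorem exists_measurable_majorant {Θ0 : Set (E q)} (hne : Θ0.Nonempty)
    {F : E q → E d → ℝ≥0∞} (hF : ∀ θ ∈ Θ0, Measurable (F θ))
    (hc : ∀ x, ContinuousOn (fun θ => F θ x) Θ0) :
    ∃ Ψ : E d → ℝ≥0∞, Measurable Ψ ∧ (∀ x, Ψ x ≤ ⨆ θ ∈ Θ0, F θ x) ∧
      ∀ θ ∈ Θ0, ∀ x, F θ x ≤ Ψ x := by
  have := hne.to_subtype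
  -- A supremum over a dense sequence is measurable, and by continuity it dominates all parameters.
  refine ⟨fun x => ⨆ n, F (TopologicalSpace.denseSeq Θ0 n) x,
    .iSup fun n => hF _ (TopologicalSpace.denseSeq Θ0 n).2, fun x => iSup_le fun n => ?_,
    fun θ hθ x => ?_⟩
  · exact le_iSup₂ (f := fun θ (_ : θ ∈ Θ0) => F θ x) _ (TopologicalSpace.denseSeq Θ0 n).2
  · have h1 : Continuous fun θ : Θ0 => F θ x := continuousOn_iff_continuous_domRestrict.1 (hc x)
    have h2 : IsClosed {θ : Θ0 | F θ x ≤ ⨆ n, F (TopologicalSpace.denseSeq Θ0 n) x} :=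
      isClosed_le h1 continuous_const
    have h3 : Set.range (TopologicalSpace.denseSeq Θ0) ⊆
        {θ : Θ0 | F θ x ≤ ⨆ n, F (TopologicalSpace.denseSeq Θ0 n) x} := by
      rintro _ ⟨n, rfl⟩
      exact le_iSup (fun n => F (TopologicalSpace.denseSeq Θ0 n) x) n
    exact (h2.closure_subset_iff.2 h3) (TopologicalSpace.denseRange_denseSeq Θ0 ⟨θ, hθ⟩)

/-- `Ψ` dominates the squared relative derivatives, and under the fourth moment assumption also the
fourth powers of the relative derivatives and densities. -/
structure IsMajorant (f : E q → E d → ℝ) (Θ0 : Set (E q)) (θ0 : E q) (j : Fin q) (four : Prop)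
    (Ψ : E d → ℝ≥0∞) : Prop where
  measurable : Measurable Ψ
  lintegral_ne_top : ∫⁻ x, Ψ x ∂(law f θ0) ≠ ∞
  sq_le : ∀ θ ∈ Θ0, ∀ x, ‖gradF f θ x j / f θ0 x‖ₑ ^ 2 ≤ Ψ x
  grad_le : four → ∀ θ ∈ Θ0, ∀ x, ‖gradF f θ x j / f θ0 x‖ₑ ^ 4 ≤ Ψ x
  dens_le : four → ∀ θ ∈ Θ0, ∀ x, ‖f θ x / f θ0 x‖ₑ ^ 4 ≤ Ψ x

theorem IsModel.exists_isMajorant (hM : IsModel f Θ Θ0 θ0) (hA2 : A2 f Θ0) (hA3 : A3 f Θ0 θ0)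
    {four : Prop} (hA7 : four → A7 f Θ0 θ0) (j : Fin q) :
    ∃ Ψ, IsMajorant f Θ0 θ0 j four Ψ := by
  have hg := hM.measurable_of_mem hM.mem
  have hgm : ∀ θ ∈ Θ0, Measurable fun x => gradF f θ x j / f θ0 x := fun θ hθ =>
    (hA2.continuous_coord hθ j).measurable.div hg
  have hgc : ∀ x, ContinuousOn (fun θ => gradF f θ x j / f θ0 x) Θ0 := fun x =>
    ((hA2.continuousOn_coord j).comp (f := fun θ : E q => (θ, x)) (by fun_prop)
      fun θ hθ => ⟨hθ, trivial⟩).div_const _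
  have hfc : ∀ x, ContinuousOn (fun θ => f θ x / f θ0 x) Θ0 := fun x =>
    (hA2.continuousOn.comp (f := fun θ : E q => (θ, x)) (by fun_prop)
      fun θ hθ => ⟨hθ, trivial⟩).div_const _
  have henorm : ∀ k : ℕ, ∀ u : E q → ℝ, ContinuousOn u Θ0 → ContinuousOn (fun θ => ‖u θ‖ₑ ^ k) Θ0 :=
    fun k u hu => (ENNReal.continuous_pow k).comp_continuousOn (continuous_enorm.comp_continuousOn hu)
  obtain ⟨Ψ2, m2, l2, b2⟩ := exists_measurable_majorant ⟨θ0, hM.mem⟩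
    (F := fun θ x => ‖gradF f θ x j / f θ0 x‖ₑ ^ 2) (fun θ hθ => (hgm θ hθ).enorm.pow_const 2)
    fun x => henorm 2 _ (hgc x)
  have i2 : ∫⁻ x, Ψ2 x ∂(law f θ0) ≠ ∞ := ((lintegral_mono l2).trans_lt (hA3 j)).ne
  by_cases h4 : four
  · obtain ⟨Ψ4, m4, l4, b4⟩ := exists_measurable_majorant ⟨θ0, hM.mem⟩
      (F := fun θ x => ‖gradF f θ x j / f θ0 x‖ₑ ^ 4) (fun θ hθ => (hgm θ hθ).enorm.pow_const 4)
      fun x => henorm 4 _ (hgc x)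
    obtain ⟨Ψ5, m5, l5, b5⟩ := exists_measurable_majorant ⟨θ0, hM.mem⟩
      (F := fun θ x => ‖f θ x / f θ0 x‖ₑ ^ 4)
      (fun θ hθ => ((hM.measurable_of_mem hθ).div hg).enorm.pow_const 4)
      fun x => henorm 4 _ (hfc x)
    have i4 : ∫⁻ x, Ψ4 x ∂(law f θ0) ≠ ∞ := ((lintegral_mono l4).trans_lt ((hA7 h4).1 j)).ne
    have i5 : ∫⁻ x, Ψ5 x ∂(law f θ0) ≠ ∞ := ((lintegral_mono l5).trans_lt (hA7 h4).2).ne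
    refine ⟨fun x => Ψ2 x + (Ψ4 x + Ψ5 x), m2.add (m4.add m5), ?_, fun θ hθ x => ?_,
      fun _ θ hθ x => ?_, fun _ θ hθ x => ?_⟩
    · rw [lintegral_add_left m2, lintegral_add_left m4]
      exact ENNReal.add_ne_top.2 ⟨i2, ENNReal.add_ne_top.2 ⟨i4, i5⟩⟩
    · exact (b2 θ hθ x).trans le_self_add
    · exact (b4 θ hθ x).trans (le_self_add.trans le_add_self)
    · exact (b5 θ hθ x).trans (le_add_self.trans le_add_self)
  · exact ⟨Ψ2, m2, i2, b2, fun h => absurd h h4, fun h => absurd h h4⟩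

end Bounds

/-! ### Growth conditions and bounds for the score -/

/-- The properties of a divergence function `h` and of `v(z) = h'(z) z` which enter the asymptotics
of the score; the growth of `v` is governed by the constants `a`, `c` and `b`. -/
structure IsCrit (h : ℝ → ℝ) (a c b D : ℝ) : Prop where
  measurable : Measurable h
  differentiableAt : ∀ z, 0 < z → DifferentiableAt ℝ h z
  continuousOn_v : ContinuousOn (v h) (Set.Ioi 0)
  nonpos : ∀ z, 0 < z → h z ≤ 0
  lt_tangent : ∀ x r, 0 < x → 0 < r → r ≠ 1 → h (x * r) < h x + v h x * (r - 1)
  abs_v_le : ∀ z, 0 < z → |v h z| ≤ a + c * z + b * z ^ 2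
  abs_le : ∀ z, 0 < z → |h z| ≤ D * (z ^ (-(1 / 2) : ℝ) + 1 + z ^ 2)
  a_nonneg : 0 ≤ a
  c_nonneg : 0 ≤ c
  b_nonneg : 0 ≤ b
  D_nonneg : 0 ≤ D

/-- With `u` the mass of the ball, this is meant for `β = P_θ(B)/u`, `α = ∫_B ∂f_θ / u`, `w = n u`
and `V = v(w β)`. Dividing the growth bound by `β` leaves `a |α|/β`, `c w |α|` and `b w² |α| β`: the
first is controlled by `absAvg`, the second by second moments, the third by fourth moments. -/
theorem abs_score_le {a c b w α β M V : ℝ} (hc : 0 ≤ c) (hb : 0 ≤ b) (hw : 0 ≤ w)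
    (hβ : 0 < β) (hV : |V| ≤ a + c * (w * β) + b * (w * β) ^ 2) (hα : α ^ 2 ≤ M)
    (hαβ : b ≠ 0 → (α * β) ^ 2 ≤ M) :
    |V * β⁻¹ * α| ≤ a * (β⁻¹ * |α|) + (c + b) * (w + w ^ 2) * (1 + M) ∧
      (V * β⁻¹ * α) ^ 2 ≤
        3 * a ^ 2 * (β⁻¹ * |α|) ^ 2 + 3 * (c ^ 2 + b ^ 2) * (w ^ 2 + w ^ 4) * M := by
  have hM : 0 ≤ M := (sq_nonneg α).trans hα
  have hA : 0 ≤ |α| := abs_nonneg α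
  have hA2 : |α| ^ 2 ≤ M := by rwa [sq_abs]
  have hB2 : b ≠ 0 → (|α| * β) ^ 2 ≤ M := fun h => by
    have := hαβ h
    rwa [mul_pow, sq_abs, ← mul_pow]
  have h1 : |V * β⁻¹ * α| ≤ a * (β⁻¹ * |α|) + c * w * |α| + b * w ^ 2 * (|α| * β) := by
    rw [abs_mul, abs_mul, abs_of_pos (inv_pos.2 hβ)]
    calc |V| * β⁻¹ * |α| ≤ (a + c * (w * β) + b * (w * β) ^ 2) * β⁻¹ * |α| := by gcongr
      _ = _ := by field_simp
  have h2 : |α| ≤ 1 + M := by nlinarith [sq_nonneg (|α| - 1)]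
  have h3 : b * w ^ 2 * (|α| * β) ≤ b * w ^ 2 * (1 + M) := by
    rcases eq_or_ne b 0 with rfl | hb0
    · simp
    · have := hB2 hb0
      have : |α| * β ≤ 1 + M := by nlinarith [sq_nonneg (|α| * β - 1)]
      gcongr
  have h4 : c * w * |α| ≤ c * w * (1 + M) := by gcongr
  constructor
  · have : (c * w + b * w ^ 2) * (1 + M) ≤ (c + b) * (w + w ^ 2) * (1 + M) := by
      refine mul_le_mul_of_nonneg_right ?_ (by linarith)
      nlinarith [mul_nonneg hc (sq_nonneg w), mul_nonneg hb hw]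
    linarith
  · have h5 : (b * w ^ 2 * (|α| * β)) ^ 2 ≤ b ^ 2 * w ^ 4 * M := by
      rcases eq_or_ne b 0 with rfl | hb0
      · simp
      · have := hB2 hb0
        calc (b * w ^ 2 * (|α| * β)) ^ 2 = b ^ 2 * w ^ 4 * (|α| * β) ^ 2 := by ring
          _ ≤ _ := by gcongr
    have h6 : (c * w * |α|) ^ 2 ≤ c ^ 2 * w ^ 2 * M := by
      calc (c * w * |α|) ^ 2 = c ^ 2 * w ^ 2 * |α| ^ 2 := by ring
        _ ≤ _ := by gcongr
    have h7 := pow_le_pow_left₀ (abs_nonneg _) h1 2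
    rw [sq_abs] at h7
    refine h7.trans ?_
    set x := a * (β⁻¹ * |α|) with hx
    set y := c * w * |α|
    set t := b * w ^ 2 * (|α| * β)
    have h8 : (x + y + t) ^ 2 ≤ 3 * (x ^ 2 + y ^ 2 + t ^ 2) := by
      nlinarith [sq_nonneg (x - y), sq_nonneg (x - t), sq_nonneg (y - t)]
    have h9 : 0 ≤ c ^ 2 * w ^ 4 * M := by positivity
    have h10 : 0 ≤ b ^ 2 * w ^ 2 * M := by positivity
    have h11 : x ^ 2 = a ^ 2 * (β⁻¹ * |α|) ^ 2 := by rw [hx]; ring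
    nlinarith

section Score

variable {d q : ℕ} {f : E q → E d → ℝ} {Θ Θ0 : Set (E q)} {θ0 : E q}

/-- A coordinate of `ψ_n` as a function of the centre and of the mass of the ball. -/
noncomputable def scoreB (h : ℝ → ℝ) (f : E q → E d → ℝ) (θ0 : E q) (j : Fin q) (n : ℕ) (θ : E q)
    (p : E d × ℝ) : ℝ :=
  v h (n * ballInt (law f θ0) (f θ) p) * (ballInt (law f θ0) (f θ) p)⁻¹ *
    ballInt (law f θ0) (fun y => gradF f θ y j) p

/-- `absAvg` as a function of the centre and of the mass of the ball. -/
noncomputable def absAvgB (f : E q → E d → ℝ) (θ0 : E q) (j : Fin q) (θ : E q)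
    (p : E d × ℝ) : ℝ :=
  (ballInt (law f θ0) (f θ) p)⁻¹ * ballInt (law f θ0) (fun y => |gradF f θ y j|) p

/-- The ball has positive mass under the true law, and the two densities have the same support up to
null sets. -/
theorem ballInt_pos (hM : IsModel f Θ Θ0 θ0) (hd : 0 < d) {θ : E q} (hθ : θ ∈ Θ0)
    {p : E d × ℝ} (hp : p.2 ∈ Set.Ioo (0 : ℝ) 1) : 0 < ballInt (law f θ0) (f θ) p := by
  have h0 : 0 < ballInt (law f θ0) (f θ0) p := by rw [hM.ballInt_self hd hp]; exact hp.1
  rw [ballInt, integral_pos_iff_support_of_nonneg (fun y => hM.nonneg_of_mem hM.mem y)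
    (hM.integrable hM.mem).integrableOn] at h0
  rw [ballInt, integral_pos_iff_support_of_nonneg (fun y => hM.nonneg_of_mem hθ y)
    (hM.integrable hθ).integrableOn]
  refine h0.trans_le (measure_mono_ae (ae_restrict_of_ae ?_))
  filter_upwards [hM.support θ hθ] with y hy h1 h2
  exact h1 (hy.1 h2)

theorem abs_ballInt_le_abs (f : E q → E d → ℝ) (θ0 θ : E q) (j : Fin q)
    (p : E d × ℝ) : |ballInt (law f θ0) (fun y => gradF f θ y j) p| ≤
      ballInt (law f θ0) (fun y => |gradF f θ y j|) p :=
  norm_integral_le_integral_norm (μ := volume.restrict (qBall (law f θ0) p))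
    (fun y => gradF f θ y j)

theorem abs_scoreB_le (hM : IsModel f Θ Θ0 θ0) (hd : 0 < d) (hA2 : A2 f Θ0) {h : ℝ → ℝ}
    {a c b D : ℝ} (hh : IsCrit h a c b D) {j : Fin q} {Ψ : E d → ℝ≥0∞}
    (hΨ : IsMajorant f Θ0 θ0 j (b ≠ 0) Ψ) {n : ℕ} (hn : 0 < n) {θ : E q} (hθ : θ ∈ interior Θ0)
    {p : E d × ℝ} (hp : p.2 ∈ Set.Ioo (0 : ℝ) 1) (hfin : avgB (law f θ0) Ψ p ≠ ∞) :
    |scoreB h f θ0 j n θ p| ≤ a * absAvgB f θ0 j θ p + (c + b) * (n * p.2 + (n * p.2) ^ 2) *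
        (1 + (avgB (law f θ0) Ψ p).toReal) ∧
      scoreB h f θ0 j n θ p ^ 2 ≤ 3 * a ^ 2 * absAvgB f θ0 j θ p ^ 2 +
        3 * (c ^ 2 + b ^ 2) * ((n * p.2) ^ 2 + (n * p.2) ^ 4) * (avgB (law f θ0) Ψ p).toReal := by
  have hθ' := interior_subset hθ
  have hpos := ballInt_pos hM hd hθ' hp
  have hu := hp.1
  have hg0 : ∀ᵐ y, f θ0 y = 0 → gradF f θ y j = 0 := by
    filter_upwards [hM.gradF_eq_zero hθ] with y hy h0
    rw [hy h0]; rfl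
  have hgm := (hA2.continuous_coord hθ' j).measurable
  set P := ballInt (law f θ0) (f θ) p with hP
  set G := ballInt (law f θ0) (fun y => gradF f θ y j) p with hG
  set K := ballInt (law f θ0) (fun y => |gradF f θ y j|) p with hK
  have hGK : |G| ≤ K := abs_ballInt_le_abs f θ0 θ j p
  set M := (avgB (law f θ0) Ψ p).toReal with hMM
  have hα : (G / p.2) ^ 2 ≤ M :=
    hM.sq_ballInt_div_le hd hgm hg0 (hΨ.sq_le θ hθ') hp hfin
  -- The square of the product is at most the mean of the two fourth powers.
  have hαβ : b ≠ 0 → (G / p.2 * (P / p.2)) ^ 2 ≤ M := fun hb => by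
    have h1 : (G / p.2) ^ 4 ≤ M :=
      hM.pow_four_ballInt_div_le hd hgm hg0 (hΨ.grad_le hb θ hθ') hp hfin
    have h2 : (P / p.2) ^ 4 ≤ M :=
      hM.pow_four_ballInt_div_le hd (hM.measurable_of_mem hθ') (hM.support_imp hθ')
        (hΨ.dens_le hb θ hθ') hp hfin
    nlinarith [sq_nonneg ((G / p.2) ^ 2 - (P / p.2) ^ 2)]
  have hn' : (0 : ℝ) < n := by exact_mod_cast hn
  have hw : 0 ≤ n * p.2 := by positivity
  have hβ : 0 < P / p.2 := by positivity
  have hz : n * p.2 * (P / p.2) = n * P := by field_simp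
  have hV := hh.abs_v_le (n * P) (by positivity)
  rw [← hz] at hV
  obtain ⟨h1, h2⟩ := abs_score_le hh.c_nonneg hh.b_nonneg hw hβ hV hα hαβ
  have hs : scoreB h f θ0 j n θ p = v h (n * p.2 * (P / p.2)) * (P / p.2)⁻¹ * (G / p.2) := by
    rw [scoreB, hz, ← hP, ← hG]
    field_simp
  have ht : (P / p.2)⁻¹ * |G / p.2| ≤ absAvgB f θ0 j θ p := by
    rw [absAvgB, ← hP, ← hK, abs_div, abs_of_pos hu]
    calc (P / p.2)⁻¹ * (|G| / p.2) = P⁻¹ * |G| := by field_simp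
      _ ≤ _ := by gcongr
  rw [← hs] at h1 h2
  have ha := hh.a_nonneg
  constructor
  · exact h1.trans (by gcongr)
  · exact h2.trans (by gcongr)

end Score

/-! ### Pointwise limits -/

section PointwiseLimits

variable {d q : ℕ} {f : E q → E d → ℝ} {Θ Θ0 : Set (E q)} {θ0 : E q}

/-- Differentiation of measures, uniformly in the parameter. -/
theorem tendsto_ballInt_div (hM : IsModel f Θ Θ0 θ0) (hd : 0 < d) (hA2 : A2 f Θ0)
    {F : E q × E d → ℝ} (hF : ContinuousOn F (Θ0 ×ˢ Set.univ)) {ι : Type*} {l : Filter ι}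
    {θn : ι → E q} {θ : E q} (hθn : ∀ᶠ n in l, θn n ∈ Θ0) (hθ : θ ∈ Θ0)
    (hlim : Tendsto θn l (𝓝 θ)) {x : E d} (hx : 0 < f θ0 x) {s : ι → ℝ}
    (hs : ∀ᶠ n in l, s n ∈ Set.Ioo (0 : ℝ) 1) (hs0 : Tendsto s l (𝓝 0)) :
    Tendsto (fun n => ballInt (law f θ0) (fun y => F (θn n, y)) (x, s n) / s n) l
      (𝓝 (F (θ, x) / f θ0 x)) := by
  have hP := hM.isProbabilityMeasure_law
  have hμ : SpheresNull (law f θ0) := IsModel.spheresNull hd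
  have hr := hM.tendsto_radius hA2 hd hx hs hs0
  have hr0 : ∀ᶠ n in l, 0 < radius (law f θ0) x (s n) := by
    filter_upwards [hs] with n hn using hμ.radius_pos x hn
  have h1 := tendsto_average_ball hF hθn hθ hlim hr hr0 x
  have h2 := tendsto_average_ball hA2.continuousOn (θn := fun _ : ι => θ0) (.of_forall fun _ => hM.mem)
    hM.mem tendsto_const_nhds hr hr0 x
  refine (h1.div h2 hx.ne').congr' ?_
  filter_upwards [hs, hr0] with n hn hn0
  have hvol : volume.real (Metric.closedBall x (radius (law f θ0) x (s n))) ≠ 0 := by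
    rw [measureReal_def]
    exact (ENNReal.toReal_pos (Metric.measure_closedBall_pos _ _ hn0).ne'
      measure_closedBall_lt_top.ne).ne'
  have h3 := hM.ballInt_self hd (p := (x, s n)) hn
  simp only at h3
  conv_rhs => rw [← h3]
  simp only [Pi.div_apply, ballInt, qBall]
  rw [div_div_div_cancel_right₀ hvol]
  rw [ballInt, qBall] at h3
  simp only at h3
  rw [h3]

theorem eventually_expMass_mem {ι : Type*} {l : Filter ι} {N : ι → ℕ} (hN : Tendsto N l atTop)
    {t : ℝ} (ht : 0 < t) : ∀ᶠ n in l, expMass (N n - 1) t ∈ Set.Ioo (0 : ℝ) 1 := by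
  filter_upwards [hN.eventually (eventually_ge_atTop 2)] with n hn
  exact expMass_mem (by omega) ht

/-- The rescaled probabilities of the nearest neighbour balls. -/
theorem tendsto_mul_ballInt (hM : IsModel f Θ Θ0 θ0) (hd : 0 < d) (hA2 : A2 f Θ0) {ι : Type*}
    {l : Filter ι} {θn : ι → E q} {θ : E q} (hθn : ∀ᶠ n in l, θn n ∈ Θ0) (hθ : θ ∈ Θ0)
    (hlim : Tendsto θn l (𝓝 θ)) {N : ι → ℕ} (hN : Tendsto N l atTop) {x : E d}
    (hx : 0 < f θ0 x) {t : ℝ} (ht : 0 < t) :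
    Tendsto (fun n => (N n : ℝ) * ballInt (law f θ0) (f (θn n)) (x, expMass (N n - 1) t)) l
      (𝓝 (t * (f θ x / f θ0 x))) := by
  have hs := eventually_expMass_mem hN ht
  have h1 := tendsto_ballInt_div hM hd hA2 hA2.continuousOn hθn hθ hlim hx hs
    ((tendsto_expMass t).comp hN)
  have h2 := (tendsto_mul_expMass ht.le).comp hN
  refine (h2.mul h1).congr' ?_
  filter_upwards [hs] with n hn
  have := hn.1.ne'
  simp only [Function.comp_apply]
  field_simp

/-- Since the parameters tend to `θ0`, the relative probability of the ball tends to 1 and the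
argument of `v` to `t`; the relative gradient integral converges by differentiation of measures. -/
theorem tendsto_scoreB (hM : IsModel f Θ Θ0 θ0) (hd : 0 < d) (hA2 : A2 f Θ0) {h : ℝ → ℝ}
    {a c b D : ℝ} (hh : IsCrit h a c b D) (j : Fin q) {θn : ℕ → E q}
    (hθn : ∀ᶠ n in atTop, θn n ∈ Θ0) (hlim : Tendsto θn atTop (𝓝 θ0)) {x : E d}
    (hx : 0 < f θ0 x) {t : ℝ} (ht : 0 < t) :
    Tendsto (fun n => scoreB h f θ0 j n (θn n) (x, expMass (n - 1) t)) atTop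
      (𝓝 (v h t * (gradF f θ0 x j / f θ0 x))) := by
  have hs := eventually_expMass_mem tendsto_id ht
  have h0 := (tendsto_expMass t)
  have hz := tendsto_mul_ballInt hM hd hA2 hθn hM.mem hlim tendsto_id hx ht
  rw [div_self hx.ne', mul_one] at hz
  have hv := ((hh.continuousOn_v t ht).continuousAt (Ioi_mem_nhds ht)).tendsto.comp hz
  have hg := tendsto_ballInt_div hM hd hA2 (hA2.continuousOn_coord j) hθn hM.mem hlim hx hs h0
  have hp := tendsto_ballInt_div hM hd hA2 hA2.continuousOn hθn hM.mem hlim hx hs h0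
  rw [div_self hx.ne'] at hp
  have := hv.mul (hg.div hp one_ne_zero)
  rw [div_one] at this
  refine this.congr' ?_
  filter_upwards [hs] with n hn
  have := hn.1.ne'
  simp only [id_eq] at this
  simp only [Function.comp_apply, scoreB, Pi.div_apply, id_eq]
  rw [div_div_div_cancel_right₀ this, mul_assoc, div_eq_inv_mul]

end PointwiseLimits

/-! ### Domination up to a small integral -/

section AlmostDom

variable {α : Type*} [MeasurableSpace α] {τ : Measure α}

/-- Up to terms of small integral, the sequence is dominated by integrable functions. -/
def AlmostDom (τ : Measure α) (Y : ℕ → α → ℝ≥0∞) : Prop :=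
  ∀ ε : ℝ≥0∞, ε ≠ 0 → ∃ Z : α → ℝ≥0∞, AEMeasurable Z τ ∧ ∫⁻ a, Z a ∂τ ≠ ∞ ∧
    ∀ᶠ n in atTop, ∃ R : α → ℝ≥0∞, AEMeasurable R τ ∧ ∫⁻ a, R a ∂τ ≤ ε ∧
      ∀ᵐ a ∂τ, Y n a ≤ Z a + R a

namespace AlmostDom

variable {Y Y' : ℕ → α → ℝ≥0∞}

theorem mono (hY : AlmostDom τ Y) (h : ∀ᶠ n in atTop, ∀ᵐ a ∂τ, Y' n a ≤ Y n a) :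
    AlmostDom τ Y' := fun ε hε => by
  obtain ⟨Z, hZ, hZi, hR⟩ := hY ε hε
  refine ⟨Z, hZ, hZi, ?_⟩
  filter_upwards [hR, h] with n ⟨R, hR, hRi, hle⟩ hn
  refine ⟨R, hR, hRi, ?_⟩
  filter_upwards [hle, hn] with a h1 h2 using h2.trans h1

theorem of_integrable {Z : α → ℝ≥0∞} (hZ : AEMeasurable Z τ) (hZi : ∫⁻ a, Z a ∂τ ≠ ∞) :
    AlmostDom τ fun _ => Z := fun ε _ =>
  ⟨Z, hZ, hZi, .of_forall fun _ => ⟨0, aemeasurable_const, by simp, .of_forall fun a => by simp⟩⟩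

theorem add (hY : AlmostDom τ Y) (hY' : AlmostDom τ Y') :
    AlmostDom τ fun n a => Y n a + Y' n a := fun ε hε => by
  obtain ⟨Z, hZ, hZi, hR⟩ := hY (ε / 2) (by simpa using hε)
  obtain ⟨Z', hZ', hZi', hR'⟩ := hY' (ε / 2) (by simpa using hε)
  refine ⟨fun a => Z a + Z' a, hZ.add hZ', ?_, ?_⟩
  · rw [lintegral_add_left' hZ]
    exact ENNReal.add_ne_top.2 ⟨hZi, hZi'⟩
  filter_upwards [hR, hR'] with n ⟨R, hR, hRi, hle⟩ ⟨R', hR', hRi', hle'⟩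
  refine ⟨fun a => R a + R' a, hR.add hR', ?_, ?_⟩
  · rw [lintegral_add_left' hR, ← ENNReal.add_halves ε]
    exact add_le_add hRi hRi'
  · filter_upwards [hle, hle'] with a h1 h2
    calc Y n a + Y' n a ≤ (Z a + R a) + (Z' a + R' a) := add_le_add h1 h2
      _ = _ := by ring

theorem const_mul (hY : AlmostDom τ Y) {k : ℝ≥0∞} (hk : k ≠ ∞) :
    AlmostDom τ fun n a => k * Y n a := fun ε hε => by
  rcases eq_or_ne k 0 with rfl | hk0
  · exact ⟨0, aemeasurable_const, by simp, .of_forall fun n => ⟨0, aemeasurable_const, by simp,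
      .of_forall fun a => by simp⟩⟩
  obtain ⟨Z, hZ, hZi, hR⟩ := hY (ε / k) (ENNReal.div_ne_zero.2 ⟨hε, hk⟩)
  refine ⟨fun a => k * Z a, hZ.const_mul k, ?_, ?_⟩
  · rw [lintegral_const_mul' _ _ hk]
    exact ENNReal.mul_ne_top hk hZi
  filter_upwards [hR] with n ⟨R, hR, hRi, hle⟩
  refine ⟨fun a => k * R a, hR.const_mul k, ?_, ?_⟩
  · rw [lintegral_const_mul' _ _ hk]
    exact (mul_le_mul_right hRi k).trans ENNReal.mul_div_le
  · filter_upwards [hle] with a h1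
    rw [← mul_add]
    exact mul_le_mul_right h1 k

/-- Uniform integrability, in terms of tails. -/
theorem of_tail [IsFiniteMeasure τ] (hm : ∀ᶠ n in atTop, AEMeasurable (Y n) τ)
    (h : ∀ ε : ℝ≥0∞, ε ≠ 0 → ∃ C : ℝ≥0∞, C ≠ ∞ ∧ ∀ᶠ n in atTop,
      ∫⁻ a, (if C ≤ Y n a then Y n a else 0) ∂τ ≤ ε) : AlmostDom τ Y := fun ε hε => by
  obtain ⟨C, hC, hev⟩ := h ε hε
  refine ⟨fun _ => C, aemeasurable_const, ?_, ?_⟩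
  · rw [lintegral_const]
    exact ENNReal.mul_ne_top hC (measure_ne_top _ _)
  filter_upwards [hev, hm] with n hn hmn
  refine ⟨fun a => if C ≤ Y n a then Y n a else 0, ?_, hn, .of_forall fun a => ?_⟩
  · have : Measurable fun y : ℝ≥0∞ => if C ≤ y then y else 0 :=
      Measurable.ite measurableSet_Ici measurable_id measurable_const
    exact this.comp_aemeasurable hmn
  · change Y n a ≤ C + (if C ≤ Y n a then Y n a else 0)
    split_ifs with h
    · exact le_add_self
    · rw [add_zero]; exact (not_le.1 h).le

/-- A version of Vitali's convergence theorem. -/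
theorem tendsto_lintegral_zero (hY : AlmostDom τ Y) (hm : ∀ᶠ n in atTop, AEMeasurable (Y n) τ)
    (h0 : ∀ᵐ a ∂τ, Tendsto (fun n => Y n a) atTop (𝓝 0)) :
    Tendsto (fun n => ∫⁻ a, Y n a ∂τ) atTop (𝓝 0) := by
  rw [ENNReal.tendsto_nhds_zero]
  intro ε hε
  obtain ⟨Z, hZ, hZi, hR⟩ := hY (ε / 2) (by simpa using hε.ne')
  -- Truncation at `Z` allows dominated convergence; what `Y n` has in excess of `Z` is at most `R`.
  have h1 : Tendsto (fun n => ∫⁻ a, min (Y n a) (Z a) ∂τ) atTop (𝓝 0) := by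
    have := tendsto_lintegral_filter_of_dominated_convergence' (μ := τ) (l := atTop)
      (F := fun n a => min (Y n a) (Z a)) (f := fun _ => 0) Z
      (by filter_upwards [hm] with n hn using hn.min hZ)
      (.of_forall fun n => .of_forall fun a => min_le_right _ _) hZi (by
        filter_upwards [h0] with a ha
        have := ha.min (tendsto_const_nhds (x := Z a))
        rwa [min_eq_left zero_le] at this)
    simpa using this
  filter_upwards [ENNReal.tendsto_nhds_zero.1 h1 (ε / 2) (ENNReal.half_pos hε.ne'), hR, hm]
    with n h2 ⟨R, hR, hRi, hle⟩ hmn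
  calc ∫⁻ a, Y n a ∂τ ≤ ∫⁻ a, (min (Y n a) (Z a) + R a) ∂τ := by
        refine lintegral_mono_ae ?_
        filter_upwards [hle] with a ha
        rcases le_total (Y n a) (Z a) with h | h
        · rw [min_eq_left h]; exact le_self_add
        · rwa [min_eq_right h]
    _ = ∫⁻ a, min (Y n a) (Z a) ∂τ + ∫⁻ a, R a ∂τ := lintegral_add_right' _ hR
    _ ≤ ε / 2 + ε / 2 := add_le_add h2 hRi
    _ = ε := ENNReal.add_halves ε

end AlmostDom

variable {d : ℕ} {μ : Measure (E d)} [IsProbabilityMeasure μ]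

omit [IsProbabilityMeasure μ] in
theorem exists_lintegral_tsub_le {Ψ : E d → ℝ≥0∞} (hΨ : Measurable Ψ) (hi : ∫⁻ x, Ψ x ∂μ ≠ ∞)
    {ε : ℝ≥0∞} (hε : ε ≠ 0) : ∃ m : ℕ, ∫⁻ x, (Ψ x - m) ∂μ ≤ ε := by
  have h := tendsto_lintegral_of_dominated_convergence (μ := μ)
    (F := fun (m : ℕ) x => Ψ x - m) (f := fun _ => 0) Ψ (fun m => hΨ.sub measurable_const)
    (fun m => .of_forall fun x => tsub_le_self) hi (by
      filter_upwards [ae_lt_top hΨ hi] with x hx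
      obtain ⟨m, hm⟩ := ENNReal.exists_nat_gt hx.ne
      refine tendsto_const_nhds.congr' ?_
      filter_upwards [eventually_ge_atTop m] with k hk
      rw [tsub_eq_zero_of_le]
      exact hm.le.trans (by exact_mod_cast hk))
  rw [lintegral_zero, ENNReal.tendsto_nhds_zero] at h
  exact (h ε (pos_iff_ne_zero.2 hε)).exists

theorem lintegral_mul_avgB_le (hμ : SpheresNull μ) {γ : ℕ} {cell : E d → E d → Fin γ}
    (hc : IsCells cell) {Ψ : E d → ℝ≥0∞} (hΨ : Measurable Ψ) {k : ℝ → ℝ≥0∞} (hk : Measurable k)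
    {n : ℕ} (hn : 2 ≤ n) :
    ∫⁻ p, k p.2 * avgB μ Ψ (p.1, expMass (n - 1) p.2) ∂(μ.prod expo) ≤
      (∫⁻ t, k t ∂expo) * (γ * ∫⁻ x, Ψ x ∂μ) := by
  have hm : Measurable fun p : E d × ℝ => k p.2 * avgB μ Ψ (p.1, expMass (n - 1) p.2) :=
    (hk.comp measurable_snd).mul ((measurable_avgB hμ hΨ).comp
      (measurable_fst.prodMk ((measurable_expMass _).comp measurable_snd)))
  rw [lintegral_prod_symm' _ hm, ← lintegral_mul_const _ hk]
  refine lintegral_mono_ae ?_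
  filter_upwards [ae_expo_pos] with t ht
  have hs := expMass_mem (m := n - 1) (by omega) ht
  have hm2 : Measurable fun x => avgB μ Ψ (x, expMass (n - 1) t) :=
    (measurable_avgB hμ hΨ).comp (measurable_id.prodMk measurable_const)
  rw [lintegral_const_mul _ hm2]
  gcongr
  exact lintegral_avgB_le hμ hc hΨ hs

/-- Split `Ψ ≤ m + (Ψ - m)`. Averages of the constant stay below `m`, which gives the dominating
function; the averages of the excess have small integral, uniformly in `n`, by Stone's lemma. -/
theorem almostDom_mul_avgB (hμ : SpheresNull μ) {γ : ℕ} {cell : E d → E d → Fin γ}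
    (hc : IsCells cell) {Ψ : E d → ℝ≥0∞} (hΨ : Measurable Ψ) (hi : ∫⁻ x, Ψ x ∂μ ≠ ∞)
    {k : ℝ → ℝ≥0∞} (hk : Measurable k) (hki : ∫⁻ t, k t ∂expo ≠ ∞) :
    AlmostDom (μ.prod expo) fun n p => k p.2 * avgB μ Ψ (p.1, expMass (n - 1) p.2) := by
  intro ε hε
  have hfac : (∫⁻ t, k t ∂expo) * γ ≠ ∞ := ENNReal.mul_ne_top hki (ENNReal.natCast_ne_top γ)
  obtain ⟨m, hm⟩ := exists_lintegral_tsub_le hΨ hi (ENNReal.div_ne_zero.2 ⟨hε, hfac⟩)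
  have hmeas : Measurable fun x => Ψ x - m := hΨ.sub measurable_const
  have hkm : Measurable fun p : E d × ℝ => k p.2 * (m : ℝ≥0∞) :=
    (hk.comp measurable_snd).mul_const _
  refine ⟨fun p => k p.2 * m, hkm.aemeasurable, ?_, ?_⟩
  · rw [lintegral_prod _ hkm.aemeasurable]
    simp only [lintegral_const, measure_univ, mul_one]
    rw [lintegral_mul_const _ hk]
    exact ENNReal.mul_ne_top hki (ENNReal.natCast_ne_top m)
  filter_upwards [eventually_ge_atTop 2] with n hn
  refine ⟨fun p => k p.2 * avgB μ (fun x => Ψ x - m) (p.1, expMass (n - 1) p.2), ?_, ?_, ?_⟩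
  · exact ((hk.comp measurable_snd).mul ((measurable_avgB hμ hmeas).comp
      (measurable_fst.prodMk ((measurable_expMass _).comp measurable_snd)))).aemeasurable
  · refine (lintegral_mul_avgB_le hμ hc hmeas hk hn).trans ?_
    rw [← mul_assoc]
    exact (mul_le_mul_right hm _).trans ENNReal.mul_div_le
  · have hpos : ∀ᵐ p ∂(μ.prod expo), 0 < p.2 := by
      have := Measure.quasiMeasurePreserving_snd (μ := μ) (ν := expo)
      exact this.ae ae_expo_pos
    filter_upwards [hpos] with p hp
    have hs := expMass_mem (m := n - 1) (by omega) hp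
    rw [← mul_add]
    gcongr
    calc avgB μ Ψ (p.1, expMass (n - 1) p.2)
        ≤ avgB μ (fun x => (m : ℝ≥0∞) + (Ψ x - m)) (p.1, expMass (n - 1) p.2) :=
          avgB_mono (.of_forall fun x => le_add_tsub) _
      _ = _ := avgB_add measurable_const _
      _ ≤ _ := by gcongr; exact avgB_const_le hμ hs _

end AlmostDom

/-! ### From the sample to pairs of centre and mass -/

section Sample

variable {d : ℕ} {Ω : Type*} [MeasurableSpace Ω] {P : Measure Ω} {μ : Measure (E d)}
  {ξ : ℕ → Ω → E d}

/-- `ξ` is an i.i.d. sequence with distribution `μ`. -/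
structure IsSample (P : Measure Ω) (μ : Measure (E d)) (ξ : ℕ → Ω → E d) : Prop where
  measurable : ∀ i, Measurable (ξ i)
  indep : iIndepFun ξ P
  law : ∀ i, P.map (ξ i) = μ

/-- A sample point together with the mass of its nearest neighbour ball. -/
noncomputable def sampPair (μ : Measure (E d)) (ξ : ℕ → Ω → E d) (n i : ℕ) (ω : Ω) : E d × ℝ :=
  nnPair (distMass μ) n i fun k => ξ k ω

namespace IsSample

variable (hS : IsSample P μ ξ)
include hS

theorem measurable_seq : Measurable fun ω i => ξ i ω := measurable_pi_lambda _ hS.measurable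

theorem map_seq : P.map (fun ω i => ξ i ω) = seqLaw μ := by
  rw [hS.indep.map_fun_eq_infinitePi_map hS.measurable, seqLaw]
  congr
  funext i
  exact hS.law i

variable [IsProbabilityMeasure μ] {γ : ℕ} (hκ : IsNNKernel μ (distMass μ) γ)
include hκ

omit [IsProbabilityMeasure μ] in
theorem measurable_sampPair (n i : ℕ) : Measurable (sampPair μ ξ n i) :=
  (hκ.measurable_nnPair n i).comp hS.measurable_seq

theorem map_sampPair {n i : ℕ} (hn : 2 ≤ n) (hi : i < n) :
    P.map (sampPair μ ξ n i) = nnLaw μ (distMass μ) n := by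
  rw [← hκ.map_nnPair hn hi, ← hS.map_seq, Measure.map_map (hκ.measurable_nnPair n i)
    hS.measurable_seq]
  rfl

theorem lintegral_sampPair {n i : ℕ} (hn : 2 ≤ n) (hi : i < n) {G : E d × ℝ → ℝ≥0∞}
    (hG : Measurable G) : ∫⁻ ω, G (sampPair μ ξ n i ω) ∂P =
      ∫⁻ p, G (p.1, expMass (n - 1) p.2) ∂(μ.prod expo) := by
  have hm : Measurable fun p : E d × ℝ => (p.1, expMass (n - 1) p.2) :=
    measurable_fst.prodMk ((measurable_expMass _).comp measurable_snd)
  rw [← lintegral_map hG (hS.measurable_sampPair hκ n i), hS.map_sampPair hκ hn hi,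
    ← hκ.map_expMass hn, lintegral_map hG hm]

theorem ae_sampPair {n i : ℕ} (hn : 2 ≤ n) (hi : i < n) {p : E d × ℝ → Prop}
    (hp : MeasurableSet {x | p x})
    (h : ∀ᵐ x ∂(μ.prod expo), p (x.1, expMass (n - 1) x.2)) :
    ∀ᵐ ω ∂P, p (sampPair μ ξ n i ω) := by
  have hm : Measurable fun p : E d × ℝ => (p.1, expMass (n - 1) p.2) :=
    measurable_fst.prodMk ((measurable_expMass _).comp measurable_snd)
  rw [← ae_map_iff (hS.measurable_sampPair hκ n i).aemeasurable hp, hS.map_sampPair hκ hn hi,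
    ← hκ.map_expMass hn, ae_map_iff hm.aemeasurable hp]
  exact h

-- Almost surely the distances to all other points are recovered from the masses simultaneously, so
-- the radius of the nearest neighbour ball is recovered too.
omit hκ in
theorem ae_qBall (hμ : SpheresNull μ) {n i : ℕ} (hn : 2 ≤ n) :
    ∀ᵐ ω ∂P, qBall μ (sampPair μ ξ n i ω) = nnBall ξ n i ω := by
  have h : ∀ᵐ a ∂(seqLaw μ), ∀ j, i ≠ j →
      radius μ (a i) (distMass μ (a i) (a j)) = dist (a i) (a j) :=
    ae_all_iff.2 fun j => by
      by_cases hij : i = j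
      · exact .of_forall fun a h => absurd hij h
      · filter_upwards [hμ.ae_radius_seqLaw hij] with a ha _ using ha
  rw [← hS.map_seq] at h
  have h' := ae_of_ae_map hS.measurable_seq.aemeasurable h
  filter_upwards [h'] with ω hω
  exact congrArg (Metric.closedBall (ξ i ω)) (ballMass_iInf_dist (a := fun k => ξ k ω) hn hω).2

end IsSample

theorem ae_prod_expo_pos [IsProbabilityMeasure μ] : ∀ᵐ p ∂(μ.prod expo), 0 < p.2 :=
  (Measure.quasiMeasurePreserving_snd (μ := μ) (ν := expo)).ae ae_expo_pos

theorem ae_prod_of_ae_fst [IsProbabilityMeasure μ] {p : E d → Prop} (h : ∀ᵐ x ∂μ, p x) :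
    ∀ᵐ y ∂(μ.prod expo), p y.1 :=
  (Measure.quasiMeasurePreserving_fst (μ := μ) (ν := expo)).ae h

theorem integrable_expo_pow (k : ℕ) : Integrable (fun t : ℝ => t ^ k) expo := by
  have h := integrable_expo_rpow (p := k) (by
    have : (0 : ℝ) ≤ k := by positivity
    linarith)
  simpa using h

end Sample

/-! ### Second moments of the differences -/

section SecondMoment

variable {d q : ℕ} {f : E q → E d → ℝ} {Θ Θ0 : Set (E q)} {θ0 : E q} {Ω : Type*}
  [MeasurableSpace Ω] {P : Measure Ω} {ξ : ℕ → Ω → E d}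

theorem measurable_v {h : ℝ → ℝ} : Measurable (v h) := (measurable_deriv h).mul measurable_id

theorem measurable_scoreB (hM : IsModel f Θ Θ0 θ0) (hd : 0 < d) (hA2 : A2 f Θ0) (h : ℝ → ℝ)
    (j : Fin q) (n : ℕ) {θ : E q} (hθ : θ ∈ Θ0) : Measurable (scoreB h f θ0 j n θ) := by
  have hP := hM.isProbabilityMeasure_law
  have hμ : SpheresNull (law f θ0) := IsModel.spheresNull hd
  have h1 := measurable_ballInt hμ (hM.measurable_of_mem hθ)
  have h2 := measurable_ballInt hμ (hA2.continuous_coord hθ j).measurable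
  exact ((measurable_v.comp (h1.const_mul _)).mul h1.inv).mul h2

theorem measurable_absAvgB (hM : IsModel f Θ Θ0 θ0) (hd : 0 < d) (hA2 : A2 f Θ0) (j : Fin q)
    {θ : E q} (hθ : θ ∈ Θ0) : Measurable (absAvgB f θ0 j θ) := by
  have hP := hM.isProbabilityMeasure_law
  have hμ : SpheresNull (law f θ0) := IsModel.spheresNull hd
  have h1 := measurable_ballInt hμ (hM.measurable_of_mem hθ)
  have h2 := measurable_ballInt hμ (hA2.continuous_coord hθ j).abs.measurable
  exact h1.inv.mul h2

/-- Uniform integrability depends only on the laws of the variables, so the tail bounds of A5 carry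
over to exponential coordinates. -/
theorem almostDom_absAvgB (hM : IsModel f Θ Θ0 θ0) (hd : 0 < d) (hA2 : A2 f Θ0)
    (hS : IsSample P (law f θ0) ξ) {γ : ℕ} (hκ : IsNNKernel (law f θ0) (distMass (law f θ0)) γ)
    {θn : ℕ → E q} (hθn : ∀ᶠ n in atTop, θn n ∈ Θ0) (hA5 : A5 P f θn ξ) (j : Fin q) :
    AlmostDom ((law f θ0).prod expo) fun n p =>
      ENNReal.ofReal (absAvgB f θ0 j (θn n) (p.1, expMass (n - 1) p.2) ^ 2) := by
  have hP := hM.isProbabilityMeasure_law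
  have hμ : SpheresNull (law f θ0) := IsModel.spheresNull hd
  have hm : ∀ n, Measurable fun p : E d × ℝ => (p.1, expMass (n - 1) p.2) := fun n =>
    measurable_fst.prodMk ((measurable_expMass _).comp measurable_snd)
  have hA : ∀ n, θn n ∈ Θ0 → Measurable fun p => ENNReal.ofReal (absAvgB f θ0 j (θn n) p ^ 2) :=
    fun n hn => ((measurable_absAvgB hM hd hA2 j hn).pow_const 2).ennreal_ofReal
  refine AlmostDom.of_tail ?_ fun ε hε => ?_
  · filter_upwards [hθn] with n hn using ((hA n hn).comp (hm n)).aemeasurable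
  obtain ⟨ε', hε', hle⟩ : ∃ ε' : ℝ, 0 < ε' ∧ ENNReal.ofReal ε' ≤ ε := by
    rcases eq_or_ne ε ∞ with rfl | h
    · exact ⟨1, one_pos, le_top⟩
    · exact ⟨ε.toReal, ENNReal.toReal_pos hε h, ENNReal.ofReal_toReal_le⟩
  obtain ⟨C, hC⟩ := (hA5 j).spec one_ne_zero ENNReal.one_ne_top hε'
  refine ⟨C, ENNReal.coe_ne_top, ?_⟩
  filter_upwards [hθn, eventually_ge_atTop 2] with n hn hn2
  have hcut : Measurable fun y : ℝ≥0∞ => if (C : ℝ≥0∞) ≤ y then y else 0 :=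
    Measurable.ite measurableSet_Ici measurable_id measurable_const
  refine le_trans (le_of_eq ?_) ((hC ⟨n, hn2⟩).trans hle)
  rw [eLpNorm_one_eq_lintegral_enorm]
  refine (hS.lintegral_sampPair hκ hn2 (i := 0) (by omega) (hcut.comp (hA n hn))).symm.trans ?_
  refine lintegral_congr_ae ?_
  filter_upwards [hS.ae_qBall hμ hn2 (i := 0)] with ω hω
  have he : absAvgB f θ0 j (θn n) (sampPair (law f θ0) ξ n 0 ω) = absAvg f ξ j n 0 (θn n) ω := by
    rw [absAvgB, ballInt, ballInt, hω]; rfl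
  simp only [Function.comp_apply, he]
  have hn : ‖absAvg f ξ j n 0 (θn n) ω ^ 2‖ₑ = ENNReal.ofReal (absAvg f ξ j n 0 (θn n) ω ^ 2) :=
    Real.enorm_of_nonneg (sq_nonneg _)
  by_cases hc : (C : ℝ≥0∞) ≤ ENNReal.ofReal (absAvg f ξ j n 0 (θn n) ω ^ 2)
  · rw [if_pos hc, Set.indicator_of_mem, hn]
    rw [← hn, enorm_eq_nnnorm] at hc
    exact ENNReal.coe_le_coe.1 hc
  · rw [if_neg hc, Set.indicator_of_notMem, enorm_zero]
    rw [← hn, enorm_eq_nnnorm] at hc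
    exact fun h => hc (ENNReal.coe_le_coe.2 h)

/-- The difference of coordinates of `ψ_n` and `ψ̃_n`, as a function of the centre and of the mass
of the ball. -/
noncomputable def diffB (h : ℝ → ℝ) (f : E q → E d → ℝ) (θ0 : E q) (j : Fin q) (n : ℕ) (θ : E q)
    (p : E d × ℝ) : ℝ :=
  scoreB h f θ0 j n θ p - v h (n * p.2) * (gradF f θ0 p.1 j / f θ0 p.1)

theorem measurable_diffB (hM : IsModel f Θ Θ0 θ0) (hd : 0 < d) (hA2 : A2 f Θ0) (h : ℝ → ℝ)
    (j : Fin q) (n : ℕ) {θ : E q} (hθ : θ ∈ Θ0) : Measurable (diffB h f θ0 j n θ) := by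
  have h1 : Measurable fun p : E d × ℝ => v h (n * p.2) := measurable_v.comp (by fun_prop)
  have h2 : Measurable fun x => gradF f θ0 x j / f θ0 x :=
    (hA2.continuous_coord hM.mem j).measurable.div (hM.measurable_of_mem hM.mem)
  exact (measurable_scoreB hM hd hA2 h j n hθ).sub (h1.mul (h2.comp measurable_fst))

theorem tendsto_diffB (hM : IsModel f Θ Θ0 θ0) (hd : 0 < d) (hA2 : A2 f Θ0) {h : ℝ → ℝ}
    {a c b D : ℝ} (hh : IsCrit h a c b D) (j : Fin q) {θn : ℕ → E q}
    (hθn : ∀ᶠ n in atTop, θn n ∈ Θ0) (hlim : Tendsto θn atTop (𝓝 θ0)) {x : E d}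
    (hx : 0 < f θ0 x) {t : ℝ} (ht : 0 < t) :
    Tendsto (fun n => diffB h f θ0 j n (θn n) (x, expMass (n - 1) t)) atTop (𝓝 0) := by
  have h1 := tendsto_scoreB hM hd hA2 hh j hθn hlim hx ht
  have h2 := ((hh.continuousOn_v t ht).continuousAt (Ioi_mem_nhds ht)).tendsto.comp
    (tendsto_mul_expMass ht.le)
  have h3 := h1.sub (h2.mul_const (gradF f θ0 x j / f θ0 x))
  rwa [sub_self] at h3

theorem IsCrit.abs_v_mul_expMass_le {h : ℝ → ℝ} {a c b D : ℝ} (hh : IsCrit h a c b D) {n : ℕ}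
    (hn : 2 ≤ n) {t : ℝ} (ht : 0 < t) :
    |v h (n * expMass (n - 1) t)| ≤ a + 2 * c * t + 4 * b * t ^ 2 := by
  have hs := expMass_mem (m := n - 1) (by omega) ht
  have hn' : (0 : ℝ) < n := by positivity
  have hw : 0 < n * expMass (n - 1) t := mul_pos hn' hs.1
  have h2 := mul_expMass_le hn ht.le
  have hc := hh.c_nonneg
  have hb := hh.b_nonneg
  calc |v h (n * expMass (n - 1) t)|
      ≤ a + c * (n * expMass (n - 1) t) + b * (n * expMass (n - 1) t) ^ 2 := hh.abs_v_le _ hw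
    _ ≤ a + c * (2 * t) + b * (2 * t) ^ 2 := by gcongr
    _ = _ := by ring

/-- The second moments of the differences vanish in the limit. -/
theorem tendsto_lintegral_diffB_sq (hM : IsModel f Θ Θ0 θ0) (hd : 0 < d) (hA2 : A2 f Θ0)
    {h : ℝ → ℝ} {a c b D : ℝ} (hh : IsCrit h a c b D) {j : Fin q} {Ψ : E d → ℝ≥0∞}
    (hΨ : IsMajorant f Θ0 θ0 j (b ≠ 0) Ψ) (hS : IsSample P (law f θ0) ξ) {θn : ℕ → E q}
    (hθn : ∀ᶠ n in atTop, θn n ∈ Θ0) (hlim : Tendsto θn atTop (𝓝 θ0))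
    (hA5 : a ≠ 0 → A5 P f θn ξ) :
    Tendsto (fun n => ∫⁻ p, ENNReal.ofReal
      (diffB h f θ0 j n (θn n) (p.1, expMass (n - 1) p.2) ^ 2) ∂((law f θ0).prod expo))
      atTop (𝓝 0) := by
  have hP := hM.isProbabilityMeasure_law
  have hμ : SpheresNull (law f θ0) := IsModel.spheresNull hd
  obtain ⟨γ, cell, hc⟩ := exists_cells (E d)
  have hcell : IsCells cell := hc
  have hκ := hμ.isNNKernel hcell
  have hm : ∀ n, Measurable fun p : E d × ℝ => (p.1, expMass (n - 1) p.2) := fun n =>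
    measurable_fst.prodMk ((measurable_expMass _).comp measurable_snd)
  have hpos := ae_prod_of_ae_fst (μ := law f θ0) hM.ae_pos
  have hint : θ0 ∈ interior Θ0 := mem_interior_iff_mem_nhds.2 hM.nhds
  have hθi : ∀ᶠ n in atTop, θn n ∈ interior Θ0 := hlim.eventually (isOpen_interior.mem_nhds hint)
  refine AlmostDom.tendsto_lintegral_zero ?_ ?_ ?_
  · set k : ℝ → ℝ≥0∞ := fun t =>
      ENNReal.ofReal (3 * (c ^ 2 + b ^ 2) * ((2 * t) ^ 2 + (2 * t) ^ 4)) with hk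
    have hkm : Measurable k := by fun_prop
    have hki : ∫⁻ t, k t ∂expo ≠ ∞ := by
      have h1 : Integrable (fun t : ℝ => 3 * (c ^ 2 + b ^ 2) * ((2 * t) ^ 2 + (2 * t) ^ 4)) expo := by
        simp only [mul_pow]
        exact (((integrable_expo_pow 2).const_mul _).add
          ((integrable_expo_pow 4).const_mul _)).const_mul _
      exact h1.lintegral_lt_top.ne
    set k' : ℝ → ℝ≥0∞ := fun t => ENNReal.ofReal ((a + 2 * c * t + 4 * b * t ^ 2) ^ 2) with hk'
    have hkm' : Measurable k' := by fun_prop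
    have hki' : ∫⁻ t, k' t ∂expo ≠ ∞ := by
      have h1 : Integrable (fun t : ℝ => (a + 2 * c * t + 4 * b * t ^ 2) ^ 2) expo := by
        have : (fun t : ℝ => (a + 2 * c * t + 4 * b * t ^ 2) ^ 2) = fun t : ℝ =>
            a ^ 2 + 4 * a * c * t ^ 1 + (4 * c ^ 2 + 8 * a * b) * t ^ 2 + 16 * c * b * t ^ 3 +
              16 * b ^ 2 * t ^ 4 := by
          funext t; ring
        rw [this]
        exact ((((integrable_const _).add ((integrable_expo_pow 1).const_mul _)).add
          ((integrable_expo_pow 2).const_mul _)).add ((integrable_expo_pow 3).const_mul _)).add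
          ((integrable_expo_pow 4).const_mul _)
      exact h1.lintegral_lt_top.ne
    -- There are three contributions: the `absAvg` term, covered by A5 or absent; ball averages of
    -- `Ψ`, covered by Stone's lemma; and the `ψ̃` term, dominated by a product of independent
    -- integrable factors.
    have hY1 : AlmostDom ((law f θ0).prod expo) fun n p => ENNReal.ofReal (3 * a ^ 2) *
        ENNReal.ofReal (absAvgB f θ0 j (θn n) (p.1, expMass (n - 1) p.2) ^ 2) := by
      rcases eq_or_ne a 0 with rfl | ha
      · refine (AlmostDom.of_integrable (Z := 0) aemeasurable_const (by simp)).mono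
          (.of_forall fun n => .of_forall fun p => by simp)
      · exact (almostDom_absAvgB hM hd hA2 hS hκ hθn (hA5 ha) j).const_mul ENNReal.ofReal_ne_top
    have hY2 := almostDom_mul_avgB hμ hcell hΨ.measurable hΨ.lintegral_ne_top hkm hki
    have hY3 : AlmostDom ((law f θ0).prod expo) fun _ p => Ψ p.1 * k' p.2 := by
      refine AlmostDom.of_integrable
        ((hΨ.measurable.comp measurable_fst).mul (hkm'.comp measurable_snd)).aemeasurable ?_
      rw [lintegral_prod_mul hΨ.measurable.aemeasurable hkm'.aemeasurable]
      exact ENNReal.mul_ne_top hΨ.lintegral_ne_top hki'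
    refine (((hY1.add hY2).add hY3).const_mul (k := 2) ENNReal.ofNat_ne_top).mono ?_
    filter_upwards [eventually_ge_atTop 2, hθi] with n hn hθ
    have hfin : ∀ᵐ p ∂((law f θ0).prod expo),
        avgB (law f θ0) Ψ (p.1, expMass (n - 1) p.2) < ∞ := by
      have h1 := lintegral_mul_avgB_le hμ hcell hΨ.measurable (k := fun _ => 1) measurable_const hn
      simp only [one_mul, lintegral_const, measure_univ] at h1
      exact ae_lt_top ((measurable_avgB hμ hΨ.measurable).comp (hm n))
        (h1.trans_lt (ENNReal.mul_ne_top (ENNReal.natCast_ne_top γ) hΨ.lintegral_ne_top).lt_top).ne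
    filter_upwards [ae_prod_expo_pos, hfin] with p hp hfin
    have hs := expMass_mem (m := n - 1) (by omega) hp
    have hn' : (0 : ℝ) < n := by positivity
    have hw2 := mul_expMass_le hn hp.le
    have hw : 0 ≤ n * expMass (n - 1) p.2 := (mul_pos hn' hs.1).le
    have h1 := (abs_scoreB_le hM hd hA2 hh hΨ (by omega : 0 < n) hθ
      (p := (p.1, expMass (n - 1) p.2)) hs hfin.ne).2
    simp only at h1
    set S := scoreB h f θ0 j n (θn n) (p.1, expMass (n - 1) p.2)
    set T := v h (n * expMass (n - 1) p.2) * (gradF f θ0 p.1 j / f θ0 p.1)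
    have h2 : (S - T) ^ 2 ≤ 2 * (S ^ 2 + T ^ 2) := by nlinarith [sq_nonneg (S + T)]
    have h3 : ENNReal.ofReal (S ^ 2) ≤ ENNReal.ofReal (3 * a ^ 2) *
        ENNReal.ofReal (absAvgB f θ0 j (θn n) (p.1, expMass (n - 1) p.2) ^ 2) +
        k p.2 * avgB (law f θ0) Ψ (p.1, expMass (n - 1) p.2) := by
      have hk2 : k p.2 * avgB (law f θ0) Ψ (p.1, expMass (n - 1) p.2) =
          ENNReal.ofReal (3 * (c ^ 2 + b ^ 2) * ((2 * p.2) ^ 2 + (2 * p.2) ^ 4) *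
            (avgB (law f θ0) Ψ (p.1, expMass (n - 1) p.2)).toReal) := by
        rw [ENNReal.ofReal_mul (by positivity), ENNReal.ofReal_toReal hfin.ne]
      rw [hk2, ← ENNReal.ofReal_mul (by positivity), ← ENNReal.ofReal_add (by positivity)
        (by positivity)]
      refine ENNReal.ofReal_le_ofReal (h1.trans ?_)
      gcongr
    have h4 : ENNReal.ofReal (T ^ 2) ≤ Ψ p.1 * k' p.2 := by
      have h5 := hh.abs_v_mul_expMass_le hn hp
      have h6 := hΨ.sq_le θ0 hM.mem p.1
      rw [mul_pow, mul_comm, ENNReal.ofReal_mul (sq_nonneg _)]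
      refine mul_le_mul' ?_ (ENNReal.ofReal_le_ofReal ?_)
      · rwa [← sq_abs, ENNReal.ofReal_pow (abs_nonneg _), ← Real.enorm_eq_ofReal_abs]
      · rw [← sq_abs]
        exact pow_le_pow_left₀ (abs_nonneg _) h5 2
    calc ENNReal.ofReal ((S - T) ^ 2) ≤ ENNReal.ofReal (2 * (S ^ 2 + T ^ 2)) :=
          ENNReal.ofReal_le_ofReal h2
      _ = 2 * (ENNReal.ofReal (S ^ 2) + ENNReal.ofReal (T ^ 2)) := by
          rw [ENNReal.ofReal_mul zero_le_two, ENNReal.ofReal_add (sq_nonneg _) (sq_nonneg _)]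
          simp
      _ ≤ _ := by gcongr
  · filter_upwards [hθn] with n hn
    exact (((measurable_diffB hM hd hA2 h j n hn).pow_const 2).ennreal_ofReal.comp
      (hm n)).aemeasurable
  · filter_upwards [hpos, ae_prod_expo_pos] with p hx ht
    have := (ENNReal.continuous_ofReal.tendsto 0).comp
      (by simpa using (tendsto_diffB hM hd hA2 hh j hθn hlim hx ht).pow 2)
    simpa [Function.comp_def] using this

end SecondMoment

/-! ### Convergence of the maximizers -/

section Consistency

variable {d q : ℕ} {f : E q → E d → ℝ} {Θ Θ0 : Set (E q)} {θ0 : E q} {Ω : Type*}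
  [MeasurableSpace Ω] {P : Measure Ω} {ξ : ℕ → Ω → E d} {h : ℝ → ℝ} {a c b D : ℝ}

/-- The negative of the expected criterion. -/
noncomputable def critI (h : ℝ → ℝ) (f : E q → E d → ℝ) (θ0 : E q) (n : ℕ) (θ : E q) : ℝ≥0∞ :=
  ∫⁻ p, ENNReal.ofReal (-h (n * ballInt (law f θ0) (f θ) (p.1, expMass (n - 1) p.2)))
    ∂((law f θ0).prod expo)

theorem measurable_crit (hM : IsModel f Θ Θ0 θ0) (hd : 0 < d) (hh : IsCrit h a c b D) (n : ℕ)
    {θ : E q} (hθ : θ ∈ Θ0) :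
    Measurable fun p => ENNReal.ofReal (-h (n * ballInt (law f θ0) (f θ) p)) := by
  have hP := hM.isProbabilityMeasure_law
  have hμ : SpheresNull (law f θ0) := IsModel.spheresNull hd
  exact (hh.measurable.comp
    ((measurable_ballInt hμ (hM.measurable_of_mem hθ)).const_mul _)).neg.ennreal_ofReal

theorem expectedH_eq (hM : IsModel f Θ Θ0 θ0) (hd : 0 < d) (hh : IsCrit h a c b D)
    (hS : IsSample P (law f θ0) ξ) {γ : ℕ} (hκ : IsNNKernel (law f θ0) (distMass (law f θ0)) γ)
    {n : ℕ} (hn : 2 ≤ n) {θ : E q} (hθ : θ ∈ Θ0) :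
    expectedH P h f ξ n θ = -(critI h f θ0 n θ : EReal) := by
  have hP := hM.isProbabilityMeasure_law
  have hμ : SpheresNull (law f θ0) := IsModel.spheresNull hd
  rw [expectedH, critI, ← hS.lintegral_sampPair hκ hn (i := 0) (by omega)
    (measurable_crit hM hd hh n hθ)]
  congr 2
  refine lintegral_congr_ae ?_
  filter_upwards [hS.ae_qBall hμ hn (i := 0)] with ω hω
  rw [ballInt, hω, z, ballProb]

theorem ae_pos_of_mem (hM : IsModel f Θ Θ0 θ0) {θ : E q} (hθ : θ ∈ Θ0) :
    ∀ᵐ x ∂(law f θ0), 0 < f θ x := by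
  filter_upwards [hM.ae_pos, IsModel.law_absolutelyContinuous.ae_le (hM.support _ hθ)] with x h1 h2
  exact (hM.nonneg_of_mem hθ x).lt_of_ne fun h => h1.ne' (h2.1 h.symm)

theorem integrable_ratio (hM : IsModel f Θ Θ0 θ0) {θ : E q} (hθ : θ ∈ Θ0) :
    Integrable (fun x => f θ x / f θ0 x) (law f θ0) := by
  refine ⟨((hM.measurable_of_mem hθ).div (hM.measurable_of_mem hM.mem)).aestronglyMeasurable, ?_⟩
  have h1 := hM.setLIntegral_div (hM.support_imp hθ) (hM.measurable_of_mem hθ) Set.univ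
    MeasurableSet.univ
  rw [Measure.restrict_univ, Measure.restrict_univ] at h1
  rw [hasFiniteIntegral_iff_enorm, h1]
  exact (hM.integrable hθ).2

theorem integral_ratio (hM : IsModel f Θ Θ0 θ0) {θ : E q} (hθ : θ ∈ Θ0) :
    ∫ x, f θ x / f θ0 x ∂(law f θ0) = 1 := by
  have h1 := hM.setIntegral_div (hM.support_imp hθ) Set.univ MeasurableSet.univ
  rw [Measure.restrict_univ, Measure.restrict_univ] at h1
  rw [h1, hM.integral_eq_one hθ]

theorem IsCrit.integrable_h (hh : IsCrit h a c b D) : Integrable h expo := by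
  have h1 : Integrable (fun t : ℝ => D * (t ^ (-(1 / 2) : ℝ) + 1 + t ^ 2)) expo :=
    (((integrable_expo_rpow (by norm_num)).add (integrable_const _)).add
      (integrable_expo_pow 2)).const_mul _
  refine h1.mono' hh.measurable.aestronglyMeasurable ?_
  filter_upwards [ae_expo_pos] with t ht using hh.abs_le t ht

theorem IsCrit.integrable_v (hh : IsCrit h a c b D) : Integrable (v h) expo := by
  have h1 : Integrable (fun t : ℝ => a + c * t ^ 1 + b * t ^ 2) expo :=
    ((integrable_const _).add ((integrable_expo_pow 1).const_mul _)).add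
      ((integrable_expo_pow 2).const_mul _)
  refine h1.mono' measurable_v.aestronglyMeasurable ?_
  filter_upwards [ae_expo_pos] with t ht
  simpa using hh.abs_v_le t ht

/-- The limiting expected criterion has its strict maximum at the true density. -/
theorem ratio_eq_one_of_limit_le (hM : IsModel f Θ Θ0 θ0) (hh : IsCrit h a c b D) {θ : E q}
    (hθ : θ ∈ Θ0)
    (hle : ∫⁻ p, ENNReal.ofReal (-h (p.2 * (f θ p.1 / f θ0 p.1))) ∂((law f θ0).prod expo) ≤
      ∫⁻ p : E d × ℝ, ENNReal.ofReal (-h p.2) ∂((law f θ0).prod expo)) :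
    ∀ᵐ x ∂(law f θ0), f θ x / f θ0 x = 1 := by
  have hP := hM.isProbabilityMeasure_law
  set τ := (law f θ0).prod expo with hτ
  have hYm : Measurable fun x => f θ x / f θ0 x :=
    (hM.measurable_of_mem hθ).div (hM.measurable_of_mem hM.mem)
  have hHm : Measurable fun p : E d × ℝ => h (p.2 * (f θ p.1 / f θ0 p.1)) :=
    hh.measurable.comp (measurable_snd.mul (hYm.comp measurable_fst))
  have hposY : ∀ᵐ p ∂τ, 0 < f θ p.1 / f θ0 p.1 := by
    refine ae_prod_of_ae_fst (p := fun x => 0 < f θ x / f θ0 x) ?_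
    filter_upwards [hM.ae_pos, ae_pos_of_mem hM hθ] with x h1 h2 using div_pos h2 h1
  have hposT : ∀ᵐ p ∂τ, 0 < p.2 := ae_prod_expo_pos
  have i1 : Integrable (fun p : E d × ℝ => h p.2) τ := hh.integrable_h.comp_snd _
  have i2 : Integrable (fun p : E d × ℝ => (f θ p.1 / f θ0 p.1 - 1) * v h p.2) τ :=
    ((integrable_ratio hM hθ).sub (integrable_const 1)).mul_prod hh.integrable_v
  have hfin : ∫⁻ p, ENNReal.ofReal (-h p.2) ∂τ < ∞ := i1.neg.lintegral_lt_top
  have hn1 : 0 ≤ᵐ[τ] fun p => -h (p.2 * (f θ p.1 / f θ0 p.1)) := by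
    filter_upwards [hposY, hposT] with p h1 h2
    have := hh.nonpos _ (mul_pos h2 h1)
    simpa using this
  have hn2 : 0 ≤ᵐ[τ] fun p => -h p.2 := by
    filter_upwards [hposT] with p h2
    have := hh.nonpos _ h2
    simpa using this
  have i3 : Integrable (fun p : E d × ℝ => -h (p.2 * (f θ p.1 / f θ0 p.1))) τ :=
    ⟨hHm.neg.aestronglyMeasurable, (hasFiniteIntegral_iff_ofReal hn1).2 (hle.trans_lt hfin)⟩
  have e1 : ∫ p, -h (p.2 * (f θ p.1 / f θ0 p.1)) ∂τ ≤ ∫ p, -h p.2 ∂τ := by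
    rw [integral_eq_lintegral_of_nonneg_ae hn1 hHm.neg.aestronglyMeasurable,
      integral_eq_lintegral_of_nonneg_ae hn2 i1.neg.aestronglyMeasurable]
    exact ENNReal.toReal_mono hfin.ne hle
  -- The linear term of the tangent inequality drops out, by independence and because the density
  -- ratio has mean 1.
  have e2 : ∫ p, (f θ p.1 / f θ0 p.1 - 1) * v h p.2 ∂τ = 0 := by
    have := integral_prod_mul (μ := law f θ0) (ν := expo) (fun x => f θ x / f θ0 x - 1) (v h)
    rw [this, integral_sub (integrable_ratio hM hθ) (integrable_const 1), integral_ratio hM hθ]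
    simp
  -- The gap between tangent and function is nonnegative, positive wherever the ratio differs from
  -- 1, and has integral at most 0.
  set Δ : E d × ℝ → ℝ := fun p => -h (p.2 * (f θ p.1 / f θ0 p.1)) -
    (-h p.2 - (f θ p.1 / f θ0 p.1 - 1) * v h p.2) with hΔ
  have i4 : Integrable (fun p : E d × ℝ => -h p.2 - (f θ p.1 / f θ0 p.1 - 1) * v h p.2) τ :=
    i1.neg.sub i2
  have iΔ : Integrable Δ τ := i3.sub i4
  have eΔ : ∫ p, Δ p ∂τ ≤ 0 := by
    have i5 : Integrable (fun p : E d × ℝ => -h p.2) τ := i1.neg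
    rw [hΔ, integral_sub i3 i4, integral_sub i5 i2, e2]
    linarith
  have hlt : ∀ᵐ p ∂τ, (f θ p.1 / f θ0 p.1 ≠ 1 → 0 < Δ p) ∧ 0 ≤ Δ p := by
    filter_upwards [hposY, hposT] with p h1 h2
    have key : f θ p.1 / f θ0 p.1 ≠ 1 → 0 < Δ p := fun hne => by
      have := hh.lt_tangent p.2 _ h2 h1 hne
      simp only [hΔ]
      linarith
    refine ⟨key, ?_⟩
    by_cases hne : f θ p.1 / f θ0 p.1 = 1
    · simp only [hΔ, hne]; simp
    · exact (key hne).le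
  have hΔ0 : Δ =ᵐ[τ] 0 := by
    refine (integral_eq_zero_iff_of_nonneg_ae ?_ iΔ).1 (le_antisymm eΔ (integral_nonneg_of_ae ?_)) <;>
    · filter_upwards [hlt] with p hp using hp.2
  have hτ1 : ∀ᵐ p ∂τ, f θ p.1 / f θ0 p.1 = 1 := by
    filter_upwards [hΔ0, hlt] with p h1 h2
    by_contra hne
    exact (h2.1 hne).ne' h1
  filter_upwards [Measure.ae_ae_of_ae_prod hτ1] with x hx
  exact (eventually_const (f := ae expo)).1 hx

theorem eq_of_ratio_eq_one (hM : IsModel f Θ Θ0 θ0) (hident : Identifiable f Θ0 θ0) {θ : E q}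
    (hθ : θ ∈ Θ0) (h1 : ∀ᵐ x ∂(law f θ0), f θ x / f θ0 x = 1) : θ = θ0 := by
  by_contra hne
  refine (hident θ hθ hne).ne' ?_
  rw [measure_eq_zero_iff_ae_notMem]
  have h2 := (ae_withDensity_iff (p := fun x => f θ x / f θ0 x = 1) (μ := (volume : Measure (E d)))
    (hM.measurable_of_mem hM.mem).ennreal_ofReal).1 h1
  filter_upwards [h2, hM.support θ hθ] with x h3 h4
  rw [not_not]
  by_cases h0 : f θ0 x = 0
  · rw [h0, h4.2 h0]
  · have hpos := (hM.nonneg_of_mem hM.mem x).lt_of_ne (Ne.symm h0)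
    have := h3 (by simpa using hpos)
    rwa [div_eq_one_iff_eq h0] at this

/-- The power `-1/2` is decreasing, so it is bounded through `n * expMass (n - 1) t ≥ t e^(-t)`; the
square is bounded through `n * expMass (n - 1) t ≤ 2 t`. The resulting factor `e^(t/2)` is still
integrable against `e^(-t)`. -/
theorem IsCrit.neg_le_of_expMass (hh : IsCrit h a c b D) {n : ℕ} (hn : 2 ≤ n) {t : ℝ}
    (ht : 0 < t) : -h (n * expMass (n - 1) t) ≤
      D * (t ^ (-(1 / 2) : ℝ) * Real.exp (t / 2) + 1 + 4 * t ^ 2) := by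
  have hs := expMass_mem (m := n - 1) (by omega) ht
  have hn' : (0 : ℝ) < n := by positivity
  have hw : 0 < n * expMass (n - 1) t := mul_pos hn' hs.1
  have h1 := le_mul_expMass hn ht.le
  have h2 := mul_expMass_le hn ht.le
  have hm : (1 : ℝ) ≤ (n - 1 : ℕ) := by exact_mod_cast (by omega : 1 ≤ n - 1)
  have h3 : t * Real.exp (-t) ≤ n * expMass (n - 1) t := by
    refine le_trans ?_ h1
    gcongr
    rw [neg_div, neg_le_neg_iff]
    exact div_le_self ht.le hm
  have h4 : (n * expMass (n - 1) t) ^ (-(1 / 2) : ℝ) ≤ t ^ (-(1 / 2) : ℝ) * Real.exp (t / 2) := by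
    refine (Real.rpow_le_rpow_of_nonpos (by positivity) h3 (by norm_num)).trans (le_of_eq ?_)
    rw [Real.mul_rpow ht.le (Real.exp_pos _).le, ← Real.exp_mul]
    ring_nf
  have h5 := hh.abs_le _ hw
  have hD := hh.D_nonneg
  calc -h (n * expMass (n - 1) t) ≤ |h (n * expMass (n - 1) t)| := neg_le_abs _
    _ ≤ _ := h5
    _ ≤ D * (t ^ (-(1 / 2) : ℝ) * Real.exp (t / 2) + 1 + (2 * t) ^ 2) := by gcongr
    _ = _ := by ring

theorem integrable_expo_rpow_mul_exp :
    Integrable (fun t : ℝ => t ^ (-(1 / 2) : ℝ) * Real.exp (t / 2)) expo := by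
  rw [integrable_expo_iff]
  have h := integrableOn_rpow_mul_exp_neg_mul_rpow (p := 1) (s := -(1 / 2)) (b := 1 / 2)
    (by norm_num) one_pos (by norm_num)
  refine h.congr_fun (fun t _ => ?_) measurableSet_Ioi
  simp only [Real.rpow_one]
  rw [mul_left_comm, ← Real.exp_add]
  congr 2
  ring

/-- The expected criterion at the true parameter converges. -/
theorem tendsto_critI (hM : IsModel f Θ Θ0 θ0) (hd : 0 < d) (hh : IsCrit h a c b D) :
    Tendsto (fun n => critI h f θ0 n θ0) atTop
      (𝓝 (∫⁻ p : E d × ℝ, ENNReal.ofReal (-h p.2) ∂((law f θ0).prod expo))) := by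
  have hP := hM.isProbabilityMeasure_law
  set B : ℝ → ℝ := fun t => D * (t ^ (-(1 / 2) : ℝ) * Real.exp (t / 2) + 1 + 4 * t ^ 2) with hB
  have hBi : Integrable B expo :=
    ((integrable_expo_rpow_mul_exp.add (integrable_const _)).add
      ((integrable_expo_pow 2).const_mul _)).const_mul _
  have hBi' : Integrable (fun p : E d × ℝ => B p.2) ((law f θ0).prod expo) := hBi.comp_snd _
  have hm : ∀ n, Measurable fun p : E d × ℝ => (p.1, expMass (n - 1) p.2) := fun n =>
    measurable_fst.prodMk ((measurable_expMass _).comp measurable_snd)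
  have key : ∀ n, 2 ≤ n → ∀ p : E d × ℝ, 0 < p.2 →
      n * ballInt (law f θ0) (f θ0) (p.1, expMass (n - 1) p.2) = n * expMass (n - 1) p.2 :=
    fun n hn p hp => by
      rw [hM.ballInt_self hd (p := (p.1, expMass (n - 1) p.2)) (expMass_mem (by omega) hp)]
  refine tendsto_lintegral_filter_of_dominated_convergence
    (fun p => ENNReal.ofReal (B p.2)) ?_ ?_ hBi'.lintegral_lt_top.ne ?_
  · exact .of_forall fun n => (measurable_crit hM hd hh n hM.mem).comp (hm n)
  · filter_upwards [eventually_ge_atTop 2] with n hn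
    filter_upwards [ae_prod_expo_pos] with p hp
    rw [key n hn p hp]
    exact ENNReal.ofReal_le_ofReal (hh.neg_le_of_expMass hn hp)
  · filter_upwards [ae_prod_expo_pos] with p hp
    have h1 := ((hh.differentiableAt p.2 hp).continuousAt.tendsto.comp
      (tendsto_mul_expMass hp.le)).neg
    refine ((ENNReal.continuous_ofReal.tendsto _).comp h1).congr' ?_
    filter_upwards [eventually_ge_atTop 2] with n hn
    simp only [Function.comp_apply]
    rw [key n hn p hp]

/-- Maximizers of the expected criterion converge to the true parameter. -/
theorem tendsto_of_critI_le (hM : IsModel f Θ Θ0 θ0) (hd : 0 < d) (hA2 : A2 f Θ0)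
    (hident : Identifiable f Θ0 θ0) (hh : IsCrit h a c b D) {θn : ℕ → E q}
    (hθn : ∀ᶠ n in atTop, θn n ∈ Θ0 ∧ critI h f θ0 n (θn n) ≤ critI h f θ0 n θ0) :
    Tendsto θn atTop (𝓝 θ0) := by
  have hP := hM.isProbabilityMeasure_law
  refine hM.compact.tendsto_nhds_of_unique_mapClusterPt (hθn.mono fun n h => h.1)
    fun θ hθ hcl => ?_
  obtain ⟨φ, hφ, hlim⟩ := hcl.tendsto_subseq
  obtain ⟨N, hN⟩ := eventually_atTop.1 hθn
  have hφN : ∀ k, N ≤ φ (k + N) := fun k => (Nat.le_add_left N k).trans (hφ.le_apply)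
  have hφt : Tendsto (fun k => φ (k + N)) atTop atTop :=
    hφ.tendsto_atTop.comp (tendsto_add_atTop_nat N)
  have hlim' : Tendsto (fun k => θn (φ (k + N))) atTop (𝓝 θ) :=
    hlim.comp (tendsto_add_atTop_nat N)
  have hmem : ∀ k, θn (φ (k + N)) ∈ Θ0 := fun k => (hN _ (hφN k)).1
  have hm : ∀ n, Measurable fun p : E d × ℝ => (p.1, expMass (n - 1) p.2) := fun n =>
    measurable_fst.prodMk ((measurable_expMass _).comp measurable_snd)
  refine eq_of_ratio_eq_one hM hident hθ (ratio_eq_one_of_limit_le hM hh hθ ?_)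
  -- At the moving parameters only Fatou's lemma is used. The maximizing property then passes to
  -- `θ0`, where the masses are explicit and dominated convergence applies.
  have hfatou := lintegral_liminf_le (μ := (law f θ0).prod expo) (u := atTop)
    (f := fun k p => ENNReal.ofReal (-h ((φ (k + N) : ℕ) *
      ballInt (law f θ0) (f (θn (φ (k + N)))) (p.1, expMass (φ (k + N) - 1) p.2))))
    fun k => (measurable_crit hM hd hh _ (hmem k)).comp (hm _)
  calc ∫⁻ p, ENNReal.ofReal (-h (p.2 * (f θ p.1 / f θ0 p.1))) ∂((law f θ0).prod expo)
      = ∫⁻ p, liminf (fun k => ENNReal.ofReal (-h ((φ (k + N) : ℕ) *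
          ballInt (law f θ0) (f (θn (φ (k + N)))) (p.1, expMass (φ (k + N) - 1) p.2)))) atTop
          ∂((law f θ0).prod expo) := by
        refine lintegral_congr_ae ?_
        filter_upwards [ae_prod_expo_pos, ae_prod_of_ae_fst (p := fun x => 0 < f θ0 x) hM.ae_pos,
          ae_prod_of_ae_fst (p := fun x => 0 < f θ x) (ae_pos_of_mem hM hθ)] with p h1 h2 h3
        have h4 := tendsto_mul_ballInt hM hd hA2 (.of_forall hmem) hθ hlim' hφt h2 h1
        have h5 : 0 < p.2 * (f θ p.1 / f θ0 p.1) := by positivity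
        have h6 := ((hh.differentiableAt _ h5).continuousAt.tendsto.comp h4).neg
        exact (((ENNReal.continuous_ofReal.tendsto _).comp h6).liminf_eq).symm
    _ ≤ liminf (fun k => critI h f θ0 (φ (k + N)) (θn (φ (k + N)))) atTop := hfatou
    _ ≤ liminf (fun k => critI h f θ0 (φ (k + N)) θ0) atTop :=
        liminf_le_liminf (.of_forall fun k => (hN _ (hφN k)).2)
    _ = _ := ((tendsto_critI hM hd hh).comp hφt).liminf_eq

end Consistency

/-! ### The score has mean zero -/

section ZeroMean

variable {d q : ℕ} {f : E q → E d → ℝ} {Θ Θ0 : Set (E q)} {θ0 : E q} {Ω : Type*}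
  [MeasurableSpace Ω] {P : Measure Ω} {ξ : ℕ → Ω → E d} {h : ℝ → ℝ} {a c b D : ℝ}

theorem exists_bound_on_ball (hK : IsCompact Θ0) {F : E q × E d → ℝ}
    (hF : ContinuousOn F (Θ0 ×ˢ Set.univ)) (x : E d) (r : ℝ) :
    ∃ C, ∀ θ ∈ Θ0, ∀ y ∈ Metric.closedBall x r, ‖F (θ, y)‖ ≤ C := by
  obtain ⟨C, hC⟩ := (hK.prod (isCompact_closedBall x r)).exists_bound_of_continuousOn
    (hF.mono (Set.prod_mono_right (Set.subset_univ _)))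
  exact ⟨C, fun θ hθ y hy => hC (θ, y) ⟨hθ, hy⟩⟩

theorem continuous_slice {F : E q × E d → ℝ} (hF : ContinuousOn F (Θ0 ×ˢ Set.univ)) {θ : E q}
    (hθ : θ ∈ Θ0) : Continuous fun y => F (θ, y) := by
  rw [← continuousOn_univ]
  exact hF.comp (f := fun y : E d => (θ, y)) (by fun_prop) fun y _ => ⟨hθ, trivial⟩

theorem continuousOn_ballInt (hK : IsCompact Θ0) {F : E q × E d → ℝ}
    (hF : ContinuousOn F (Θ0 ×ˢ Set.univ)) (μ : Measure (E d)) (p : E d × ℝ) :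
    ContinuousOn (fun θ => ballInt μ (fun y => F (θ, y)) p) Θ0 := by
  obtain ⟨C, hC⟩ := exists_bound_on_ball hK hF p.1 (radius μ p.1 p.2)
  refine continuousOn_of_dominated (bound := fun _ => C)
    (fun θ hθ => (continuous_slice hF hθ).aestronglyMeasurable) (fun θ hθ => ?_)
    (integrableOn_const measure_closedBall_lt_top.ne) (.of_forall fun y => ?_)
  · filter_upwards [ae_restrict_mem (measurableSet_qBall p)] with y hy using hC θ hθ y hy
  · exact hF.comp (f := fun θ : E q => (θ, y)) (by fun_prop) fun θ hθ => ⟨hθ, trivial⟩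

/-- Differentiation under the integral sign: the continuous derivative is bounded on the product of
`Θ0` with the ball, which is compact. -/
theorem hasDerivAt_ballInt (hK : IsCompact Θ0) (hA2 : A2 f Θ0) (μ : Measure (E d)) (p : E d × ℝ)
    {θ : E q} {j : Fin q} {S : Set ℝ} {t : ℝ} (hS : S ∈ 𝓝 t)
    (hmem : ∀ u ∈ S, θ + u • EuclideanSpace.single j (1 : ℝ) ∈ Θ0) :
    HasDerivAt (fun u : ℝ => ballInt μ (f (θ + u • EuclideanSpace.single j (1 : ℝ))) p)
      (ballInt μ (fun y => gradF f (θ + t • EuclideanSpace.single j (1 : ℝ)) y j) p) t := by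
  obtain ⟨C, hC⟩ := exists_bound_on_ball hK (hA2.continuousOn_coord j) p.1 (radius μ p.1 p.2)
  have ht := hmem t (mem_of_mem_nhds hS)
  refine (hasDerivAt_integral_of_dominated_loc_of_deriv_le (bound := fun _ => C)
    (F' := fun u y => gradF f (θ + u • EuclideanSpace.single j (1 : ℝ)) y j) hS ?_ ?_ ?_ ?_ ?_ ?_).2
  · filter_upwards [hS] with u hu using (hA2.continuous (hmem u hu)).aestronglyMeasurable
  · exact (hA2.continuous ht).continuousOn.integrableOn_compact (isCompact_closedBall _ _)
  · exact (hA2.continuous_coord ht j).aestronglyMeasurable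
  · filter_upwards [ae_restrict_mem (measurableSet_qBall p)] with y hy u hu
    exact hC _ (hmem u hu) y hy
  · exact integrableOn_const measure_closedBall_lt_top.ne
  · exact .of_forall fun y u hu => hA2.hasDerivAt_line y j (hmem u hu)

theorem hasDerivAt_h_ballInt (hM : IsModel f Θ Θ0 θ0) (hd : 0 < d) (hA2 : A2 f Θ0)
    (hh : IsCrit h a c b D) {n : ℕ} (hn : 0 < n) {p : E d × ℝ} (hp : p.2 ∈ Set.Ioo (0 : ℝ) 1)
    {θ : E q} {j : Fin q} {S : Set ℝ} {t : ℝ} (hS : S ∈ 𝓝 t)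
    (hmem : ∀ u ∈ S, θ + u • EuclideanSpace.single j (1 : ℝ) ∈ Θ0) :
    HasDerivAt (fun u : ℝ =>
        h (n * ballInt (law f θ0) (f (θ + u • EuclideanSpace.single j (1 : ℝ))) p))
      (scoreB h f θ0 j n (θ + t • EuclideanSpace.single j (1 : ℝ)) p) t := by
  have ht := hmem t (mem_of_mem_nhds hS)
  have h1 := (hasDerivAt_ballInt hM.compact hA2 (law f θ0) p hS hmem).const_mul (n : ℝ)
  have hpos := ballInt_pos hM hd ht hp
  have hn' : (0 : ℝ) < n := by exact_mod_cast hn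
  have h2 := (hh.differentiableAt _ (mul_pos hn' hpos)).hasDerivAt
  refine (h2.comp t h1).congr_deriv ?_
  rw [scoreB, v]
  field_simp

/-- A real supremum has the default value 0 on unbounded families; here continuity on the compact
set `Θ0` excludes this. -/
theorem absAvgB_le_iSup (hM : IsModel f Θ Θ0 θ0) (hd : 0 < d) (hA2 : A2 f Θ0) (j : Fin q)
    {p : E d × ℝ} (hp : p.2 ∈ Set.Ioo (0 : ℝ) 1) {θ : E q} (hθ : θ ∈ Θ0) :
    absAvgB f θ0 j θ p ≤ ⨆ θ : Θ0, absAvgB f θ0 j θ p := by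
  have h1 := continuousOn_ballInt hM.compact hA2.continuousOn (law f θ0) p
  have h2 := continuousOn_ballInt hM.compact (hA2.continuousOn_coord j).abs (law f θ0) p
  have h3 : ContinuousOn (fun θ => absAvgB f θ0 j θ p) Θ0 :=
    (h1.inv₀ fun θ hθ => (ballInt_pos hM hd hθ hp).ne').mul h2
  have h4 := (hM.compact.image_of_continuousOn h3).bddAbove
  rw [Set.image_eq_range] at h4
  exact le_ciSup (f := fun θ : Θ0 => absAvgB f θ0 j θ p) h4 ⟨θ, hθ⟩

theorem critI_self_ne_top (hM : IsModel f Θ Θ0 θ0) (hd : 0 < d) (hh : IsCrit h a c b D) {n : ℕ}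
    (hn : 2 ≤ n) : critI h f θ0 n θ0 ≠ ∞ := by
  have hP := hM.isProbabilityMeasure_law
  have hBi : Integrable (fun p : E d × ℝ =>
      D * (p.2 ^ (-(1 / 2) : ℝ) * Real.exp (p.2 / 2) + 1 + 4 * p.2 ^ 2)) ((law f θ0).prod expo) :=
    Integrable.comp_snd (((integrable_expo_rpow_mul_exp.add (integrable_const 1)).add
      ((integrable_expo_pow 2).const_mul 4)).const_mul D) _
  refine ((lintegral_mono_ae ?_).trans_lt hBi.lintegral_lt_top).ne
  filter_upwards [ae_prod_expo_pos] with p hp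
  rw [hM.ballInt_self hd (p := (p.1, expMass (n - 1) p.2)) (expMass_mem (by omega) hp)]
  exact ENNReal.ofReal_le_ofReal (hh.neg_le_of_expMass hn hp)

theorem ae_avgB_lt_top {μ : Measure (E d)} [IsProbabilityMeasure μ] (hμ : SpheresNull μ) {γ : ℕ}
    {cell : E d → E d → Fin γ} (hc : IsCells cell) {Ψ : E d → ℝ≥0∞} (hΨ : Measurable Ψ)
    (hi : ∫⁻ x, Ψ x ∂μ ≠ ∞) {n : ℕ} (hn : 2 ≤ n) :
    ∀ᵐ p ∂(μ.prod expo), avgB μ Ψ (p.1, expMass (n - 1) p.2) < ∞ := by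
  have hm : Measurable fun p : E d × ℝ => (p.1, expMass (n - 1) p.2) :=
    measurable_fst.prodMk ((measurable_expMass _).comp measurable_snd)
  have h1 := lintegral_mul_avgB_le hμ hc hΨ (k := fun _ => 1) measurable_const hn
  simp only [one_mul, lintegral_const, measure_univ] at h1
  exact ae_lt_top ((measurable_avgB hμ hΨ).comp hm)
    (h1.trans_lt (ENNReal.mul_ne_top (ENNReal.natCast_ne_top γ) hi).lt_top).ne

/-- The part of the bound of the score which does not involve `absAvgB` is integrable. -/
theorem integrable_avgB_sampPair {μ : Measure (E d)} [IsProbabilityMeasure μ]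
    (hμ : SpheresNull μ) (hS : IsSample P μ ξ) {γ : ℕ} {cell : E d → E d → Fin γ}
    (hc : IsCells cell) {Ψ : E d → ℝ≥0∞} (hΨ : Measurable Ψ) (hi : ∫⁻ x, Ψ x ∂μ ≠ ∞) {n : ℕ}
    (hn : 2 ≤ n) {κ : ℝ} (hκ : 0 ≤ κ) :
    Integrable (fun ω => κ * (n * (sampPair μ ξ n 0 ω).2 + (n * (sampPair μ ξ n 0 ω).2) ^ 2) *
      (1 + (avgB μ Ψ (sampPair μ ξ n 0 ω)).toReal)) P := by
  have hker := hμ.isNNKernel hc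
  set G : E d × ℝ → ℝ := fun p => κ * (n * p.2 + (n * p.2) ^ 2) * (1 + (avgB μ Ψ p).toReal) with hG
  have hGm : Measurable G :=
    (by fun_prop : Measurable fun p : E d × ℝ => κ * (n * p.2 + (n * p.2) ^ 2)).mul
      ((measurable_avgB hμ hΨ).ennreal_toReal.const_add 1)
  refine ⟨(hGm.comp (hS.measurable_sampPair hker n 0)).aestronglyMeasurable, ?_⟩
  rw [hasFiniteIntegral_iff_enorm]
  change ∫⁻ ω, ‖G (sampPair μ ξ n 0 ω)‖ₑ ∂P < ∞
  rw [hS.lintegral_sampPair hker hn (by omega) hGm.enorm]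
  set k : ℝ → ℝ≥0∞ := fun t => ENNReal.ofReal (κ * (2 * t + (2 * t) ^ 2)) with hk
  have hkm : Measurable k := by fun_prop
  have hki : ∫⁻ t, k t ∂expo ≠ ∞ := by
    have h1 : Integrable (fun t : ℝ => κ * (2 * t ^ 1 + 2 ^ 2 * t ^ 2)) expo :=
      (((integrable_expo_pow 1).const_mul _).add ((integrable_expo_pow 2).const_mul _)).const_mul _
    have h2 := h1.lintegral_lt_top.ne
    simpa only [hk, mul_pow, pow_one] using h2
  have hkp : Measurable fun p : E d × ℝ => k p.2 := hkm.comp measurable_snd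
  have hle : ∫⁻ p, ‖G (p.1, expMass (n - 1) p.2)‖ₑ ∂(μ.prod expo) ≤
      ∫⁻ p, (k p.2 + k p.2 * avgB μ Ψ (p.1, expMass (n - 1) p.2)) ∂(μ.prod expo) := by
    refine lintegral_mono_ae ?_
    filter_upwards [ae_prod_expo_pos, ae_avgB_lt_top hμ hc hΨ hi hn] with p hp hfin
    have hs := expMass_mem (m := n - 1) (by omega) hp
    have hn' : (0 : ℝ) < n := by positivity
    have hw : 0 ≤ n * expMass (n - 1) p.2 := (mul_pos hn' hs.1).le
    have hw2 := mul_expMass_le hn hp.le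
    have hk2 : k p.2 + k p.2 * avgB μ Ψ (p.1, expMass (n - 1) p.2) =
        ENNReal.ofReal (κ * (2 * p.2 + (2 * p.2) ^ 2) *
          (1 + (avgB μ Ψ (p.1, expMass (n - 1) p.2)).toReal)) := by
      rw [ENNReal.ofReal_mul (by positivity), ENNReal.ofReal_add zero_le_one (by positivity),
        ENNReal.ofReal_toReal hfin.ne, ENNReal.ofReal_one, mul_add, mul_one]
    rw [hk2, Real.enorm_of_nonneg (by positivity)]
    refine ENNReal.ofReal_le_ofReal ?_
    simp only [hG]
    gcongr
  refine hle.trans_lt ?_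
  rw [lintegral_add_left hkp]
  refine ENNReal.add_lt_top.2 ⟨?_, ?_⟩
  · have : ∫⁻ p : E d × ℝ, k p.2 ∂(μ.prod expo) = ∫⁻ t, k t ∂expo := by
      rw [lintegral_prod _ hkp.aemeasurable]
      simp
    rw [this]
    exact hki.lt_top
  · exact (lintegral_mul_avgB_le hμ hc hΨ hkm hn).trans_lt
      (ENNReal.mul_ne_top hki (ENNReal.mul_ne_top (ENNReal.natCast_ne_top γ) hi)).lt_top

/-- The score has mean zero at an interior maximizer of the expected criterion. -/
theorem integral_scoreB_eq_zero (hM : IsModel f Θ Θ0 θ0) (hd : 0 < d) (hA2 : A2 f Θ0)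
    (hh : IsCrit h a c b D) {j : Fin q} {Ψ : E d → ℝ≥0∞} (hΨ : IsMajorant f Θ0 θ0 j (b ≠ 0) Ψ)
    (hS : IsSample P (law f θ0) ξ) (hA4 : a ≠ 0 → A4 P f Θ0 ξ) {n : ℕ} (hn : 2 ≤ n) {θ : E q}
    (hθ : θ ∈ interior Θ0) (hmax : ∀ θ' ∈ Θ0, critI h f θ0 n θ ≤ critI h f θ0 n θ') :
    Integrable (fun ω => scoreB h f θ0 j n θ (sampPair (law f θ0) ξ n 0 ω)) P ∧
      ∫ ω, scoreB h f θ0 j n θ (sampPair (law f θ0) ξ n 0 ω) ∂P = 0 := by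
  have hP := hM.isProbabilityMeasure_law
  have hμ : SpheresNull (law f θ0) := IsModel.spheresNull hd
  obtain ⟨γ, cell, hc⟩ := exists_cells (E d)
  have hcell : IsCells cell := hc
  have hκ := hμ.isNNKernel hcell
  set e : E q := EuclideanSpace.single j (1 : ℝ) with he
  have hcont : Continuous fun u : ℝ => θ + u • e := by fun_prop
  have hopen : IsOpen {u : ℝ | θ + u • e ∈ interior Θ0} := isOpen_interior.preimage hcont
  -- The whole segment is kept in the interior, where gradients vanish together with the true
  -- density and the score bound is valid.
  obtain ⟨δ, hδ, hball⟩ := Metric.isOpen_iff.1 hopen 0 (by simpa using hθ)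
  have hmemi : ∀ u ∈ Metric.ball (0 : ℝ) δ, θ + u • e ∈ interior Θ0 := fun u hu => hball hu
  have hmem : ∀ u ∈ Metric.ball (0 : ℝ) δ, θ + u • e ∈ Θ0 := fun u hu =>
    interior_subset (hmemi u hu)
  have h0 : (0 : ℝ) ∈ Metric.ball (0 : ℝ) δ := Metric.mem_ball_self hδ
  set X := sampPair (law f θ0) ξ n 0 with hX
  have hXm : Measurable X := hS.measurable_sampPair hκ n 0
  have hu : ∀ᵐ ω ∂P, (X ω).2 ∈ Set.Ioo (0 : ℝ) 1 := by
    refine hS.ae_sampPair hκ hn (by omega) (p := fun p => p.2 ∈ Set.Ioo (0 : ℝ) 1)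
      (measurable_snd measurableSet_Ioo) ?_
    filter_upwards [ae_prod_expo_pos] with p hp using expMass_mem (by omega) hp
  have hfin : ∀ᵐ ω ∂P, avgB (law f θ0) Ψ (X ω) < ∞ :=
    hS.ae_sampPair hκ hn (by omega) (p := fun p => avgB (law f θ0) Ψ p < ∞)
      (measurableSet_lt (measurable_avgB hμ hΨ.measurable) measurable_const)
      (ae_avgB_lt_top hμ hcell hΨ.measurable hΨ.lintegral_ne_top hn)
  set F : ℝ → Ω → ℝ := fun u ω => h (n * ballInt (law f θ0) (f (θ + u • e)) (X ω)) with hF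
  set F' : ℝ → Ω → ℝ := fun u ω => scoreB h f θ0 j n (θ + u • e) (X ω) with hF'
  set bound : Ω → ℝ := fun ω => a * (⨆ θ : Θ0, absAvg f ξ j n 0 θ ω) +
    (c + b) * (n * (X ω).2 + (n * (X ω).2) ^ 2) * (1 + (avgB (law f θ0) Ψ (X ω)).toReal) with hbd
  have hbi : Integrable bound P := by
    refine Integrable.add ?_ (integrable_avgB_sampPair hμ hS hcell hΨ.measurable
      hΨ.lintegral_ne_top hn (add_nonneg hh.c_nonneg hh.b_nonneg))
    rcases eq_or_ne a 0 with ha | ha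
    · simp [ha]
    · exact (memLp_one_iff_integrable.1 ((hA4 ha j).memLp ⟨n, hn⟩)).const_mul a
  have hderiv : ∀ᵐ ω ∂P, ∀ u ∈ Metric.ball (0 : ℝ) δ, HasDerivAt (F · ω) (F' u ω) u := by
    filter_upwards [hu] with ω hω u hu
    exact hasDerivAt_h_ballInt hM hd hA2 hh (by omega) hω (Metric.isOpen_ball.mem_nhds hu) hmem
  have hbound : ∀ᵐ ω ∂P, ∀ u ∈ Metric.ball (0 : ℝ) δ, ‖F' u ω‖ ≤ bound ω := by
    filter_upwards [hu, hfin, hS.ae_qBall hμ hn (i := 0)] with ω hω hfω hq u hu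
    have h1 := (abs_scoreB_le hM hd hA2 hh hΨ (by omega : 0 < n) (hmemi u hu) hω hfω.ne).1
    have h2 := absAvgB_le_iSup hM hd hA2 j hω (hmem u hu)
    have h3 : ∀ θ : E q, absAvgB f θ0 j θ (X ω) = absAvg f ξ j n 0 θ ω := fun θ => by
      rw [absAvgB, ballInt, ballInt, hq]; rfl
    simp only [h3] at h1 h2
    refine h1.trans ?_
    simp only [hbd]
    have := hh.a_nonneg
    gcongr
  have hFm : ∀ u ∈ Metric.ball (0 : ℝ) δ, Measurable (F u) := fun u hu =>
    hh.measurable.comp (((measurable_ballInt hμ (hM.measurable_of_mem (hmem u hu))).comp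
      hXm).const_mul _)
  have hneg : ∀ u ∈ Metric.ball (0 : ℝ) δ, 0 ≤ᵐ[P] fun ω => -F u ω := fun u hu' => by
    filter_upwards [hu] with ω hω
    have hn' : (0 : ℝ) < n := by positivity
    have := hh.nonpos _ (mul_pos hn' (ballInt_pos hM hd (hmem u hu') hω))
    simpa [hF] using this
  have hcrit : ∀ u ∈ Metric.ball (0 : ℝ) δ,
      ∫⁻ ω, ENNReal.ofReal (-F u ω) ∂P = critI h f θ0 n (θ + u • e) := fun u hu =>
    hS.lintegral_sampPair hκ hn (by omega) (measurable_crit hM hd hh n (hmem u hu))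
  -- The criterion at the maximizer is no worse than at `θ0`, where it is finite.
  have hF0 : Integrable (F 0) P := by
    have : Integrable (fun ω => -F 0 ω) P := by
      refine ⟨(hFm 0 h0).neg.aestronglyMeasurable, ?_⟩
      rw [hasFiniteIntegral_iff_ofReal (hneg 0 h0), hcrit 0 h0, zero_smul, add_zero]
      exact (hmax θ0 hM.mem).trans_lt (critI_self_ne_top hM hd hh hn).lt_top
    simpa using this.neg
  -- Integrability spreads along the segment by the mean value inequality, so the extended-valued
  -- criterion may be compared as a real number.
  have hFi : ∀ u ∈ Metric.ball (0 : ℝ) δ, Integrable (F u) P := fun u hu => by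
    have h1 : Integrable (fun ω => ‖F 0 ω‖ + bound ω * ‖u - 0‖) P :=
      hF0.norm.add (hbi.mul_const _)
    refine h1.mono' (hFm u hu).aestronglyMeasurable ?_
    filter_upwards [hderiv, hbound] with ω h2 h3
    have h4 := (convex_ball (0 : ℝ) δ).norm_image_sub_le_of_norm_hasDerivWithin_le
      (fun x hx => (h2 x hx).hasDerivWithinAt) h3 h0 hu
    calc ‖F u ω‖ = ‖F 0 ω + (F u ω - F 0 ω)‖ := by rw [add_sub_cancel]
      _ ≤ _ := (norm_add_le _ _).trans (by gcongr)
  obtain ⟨hi, hD⟩ := hasDerivAt_integral_of_dominated_loc_of_deriv_le (μ := P) (F := F) (F' := F')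
    (Metric.ball_mem_nhds (0 : ℝ) hδ) (by
      filter_upwards [Metric.ball_mem_nhds (0 : ℝ) hδ] with u hu
      exact (hFm u hu).aestronglyMeasurable) hF0
    ((measurable_scoreB hM hd hA2 h j n (hmem 0 h0)).comp hXm).aestronglyMeasurable
    hbound hbi hderiv
  have hloc : IsLocalMax (fun u => ∫ ω, F u ω ∂P) 0 := by
    filter_upwards [Metric.ball_mem_nhds (0 : ℝ) hδ] with u hu
    have h1 : ∀ w ∈ Metric.ball (0 : ℝ) δ,
        ∫ ω, F w ω ∂P = -(critI h f θ0 n (θ + w • e)).toReal := fun w hw => by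
      rw [← hcrit w hw, ← integral_eq_lintegral_of_nonneg_ae (hneg w hw)
        (hFm w hw).neg.aestronglyMeasurable, integral_neg, neg_neg]
    have hne : critI h f θ0 n (θ + u • e) ≠ ∞ := by
      rw [← hcrit u hu]
      exact (hFi u hu).neg.lintegral_lt_top.ne
    rw [h1 u hu, h1 0 h0, neg_le_neg_iff, zero_smul, add_zero]
    exact ENNReal.toReal_mono hne (hmax _ (hmem u hu))
  have hz := hloc.hasDerivAt_eq_zero hD
  simp only [hF', zero_smul, add_zero] at hi hz
  exact ⟨hi, hz⟩

/-- Densities integrate to 1 for every parameter, so the derivative of the integral is zero; `1 + Ψ`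
justifies differentiating inside. The zero derivative is read off by viewing a constant function as
having a local maximum. -/
theorem integrable_relGrad (hM : IsModel f Θ Θ0 θ0) (hA2 : A2 f Θ0) {j : Fin q} {four : Prop}
    {Ψ : E d → ℝ≥0∞} (hΨ : IsMajorant f Θ0 θ0 j four Ψ) :
    Integrable (fun x => gradF f θ0 x j / f θ0 x) (law f θ0) ∧
      ∫ x, gradF f θ0 x j / f θ0 x ∂(law f θ0) = 0 := by
  have hP := hM.isProbabilityMeasure_law
  set e : E q := EuclideanSpace.single j (1 : ℝ) with he
  have hcont : Continuous fun u : ℝ => θ0 + u • e := by fun_prop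
  have hopen : IsOpen {u : ℝ | θ0 + u • e ∈ interior Θ0} := isOpen_interior.preimage hcont
  obtain ⟨δ, hδ, hball⟩ := Metric.isOpen_iff.1 hopen 0 (by
    have : θ0 ∈ interior Θ0 := mem_interior_iff_mem_nhds.2 hM.nhds
    simpa using this)
  have hmem : ∀ u ∈ Metric.ball (0 : ℝ) δ, θ0 + u • e ∈ Θ0 := fun u hu =>
    interior_subset (hball hu)
  have h0 : (0 : ℝ) ∈ Metric.ball (0 : ℝ) δ := Metric.mem_ball_self hδ
  have hg := hM.measurable_of_mem hM.mem
  set F : ℝ → E d → ℝ := fun u x => f (θ0 + u • e) x / f θ0 x with hF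
  set F' : ℝ → E d → ℝ := fun u x => gradF f (θ0 + u • e) x j / f θ0 x with hF'
  have hb : ∀ᵐ x ∂(law f θ0), ∀ u ∈ Metric.ball (0 : ℝ) δ, ‖F' u x‖ ≤ 1 + (Ψ x).toReal := by
    filter_upwards [ae_lt_top hΨ.measurable hΨ.lintegral_ne_top] with x hx u hu
    have h1 : ‖F' u x‖ₑ ^ 2 ≤ Ψ x := hΨ.sq_le _ (hmem u hu) x
    have h2 : ‖F' u x‖ ^ 2 ≤ (Ψ x).toReal := by
      rw [← ENNReal.ofReal_le_iff_le_toReal hx.ne, ENNReal.ofReal_pow (norm_nonneg _),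
        ofReal_norm]
      exact h1
    nlinarith [sq_nonneg (‖F' u x‖ - 1)]
  have hbi : Integrable (fun x => 1 + (Ψ x).toReal) (law f θ0) :=
    (integrable_const _).add (integrable_toReal_of_lintegral_ne_top
      hΨ.measurable.aemeasurable hΨ.lintegral_ne_top)
  have hd : ∀ᵐ x ∂(law f θ0), ∀ u ∈ Metric.ball (0 : ℝ) δ, HasDerivAt (F · x) (F' u x) u :=
    .of_forall fun x u hu => (hA2.hasDerivAt_line x j (hmem u hu)).div_const _
  have hFm : ∀ᶠ u in 𝓝 (0 : ℝ), AEStronglyMeasurable (F u) (law f θ0) := by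
    filter_upwards [Metric.ball_mem_nhds (0 : ℝ) hδ] with u hu
    exact ((hM.measurable_of_mem (hmem u hu)).div hg).aestronglyMeasurable
  have hF0 : Integrable (F 0) (law f θ0) := integrable_ratio hM (hmem 0 h0)
  have hFm' : AEStronglyMeasurable (F' 0) (law f θ0) :=
    ((hA2.continuous_coord (hmem 0 h0) j).measurable.div hg).aestronglyMeasurable
  obtain ⟨hi, hD⟩ := hasDerivAt_integral_of_dominated_loc_of_deriv_le
    (Metric.ball_mem_nhds (0 : ℝ) hδ) hFm hF0 hFm' hb hbi hd
  have hloc : IsLocalMax (fun u => ∫ x, F u x ∂(law f θ0)) 0 := by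
    filter_upwards [Metric.ball_mem_nhds (0 : ℝ) hδ] with u hu
    rw [integral_ratio hM (hmem u hu), integral_ratio hM (hmem 0 h0)]
  have hz := hloc.hasDerivAt_eq_zero hD
  simp only [hF', zero_smul, add_zero] at hi hz
  exact ⟨hi, hz⟩

end ZeroMean

/-! ### Convergence in probability -/

/-- Normalized sums over nearest neighbour pairs of centred functions with vanishing second moments
converge to zero in probability. -/
theorem IsNNKernel.tendsto_measure_abs_nnSum {X : Type*} [MeasurableSpace X] {μ : Measure X}
    [IsProbabilityMeasure μ] {κ : X → X → ℝ} {γ : ℕ} (hκ : IsNNKernel μ κ γ)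
    {F : ℕ → X × ℝ → ℝ} (hF : ∀ᶠ n in atTop, Measurable (F n))
    (h2 : Tendsto (fun n => ∫⁻ p, ENNReal.ofReal (F n p ^ 2) ∂(nnLaw μ κ n)) atTop (𝓝 0))
    (hmean : ∀ᶠ n in atTop, ∫ p, F n p ∂(nnLaw μ κ n) = 0) {ε : ℝ} (hε : 0 < ε) :
    Tendsto (fun n : ℕ => (seqLaw μ).real {a | ε ≤ |(√(n : ℝ))⁻¹ *
      ∑ i ∈ Finset.range n, F n (nnPair κ n i a)|}) atTop (𝓝 0) := by
  have hnn : ∀ n : ℕ, 0 ≤ᵐ[nnLaw μ κ n] fun p => F n p ^ 2 := fun n =>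
    .of_forall fun p => sq_nonneg _
  set m : ℕ → ℝ := fun n => (∫⁻ p, ENNReal.ofReal (F n p ^ 2) ∂(nnLaw μ κ n)).toReal with hm
  have hm0 : Tendsto m atTop (𝓝 0) := (ENNReal.tendsto_toReal ENNReal.zero_ne_top).comp h2
  have hgeo : Tendsto (fun n : ℕ => (n : ℝ) * (1 / 2) ^ (n - 1)) atTop (𝓝 0) := by
    have h := (tendsto_self_mul_const_pow_of_lt_one (r := 1 / 2) (by norm_num)
      (by norm_num)).const_mul 2
    rw [mul_zero] at h
    refine h.congr' ?_
    filter_upwards [eventually_ge_atTop 1] with n hn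
    obtain ⟨k, rfl⟩ := Nat.exists_eq_add_of_le' hn
    simp only [Nat.add_sub_cancel, pow_succ]
    ring
  have hb : Tendsto (fun n : ℕ => 2 * (m n + n * (1 / 2) ^ (n - 1))) atTop (𝓝 0) := by
    simpa using (hm0.add hgeo).const_mul 2
  have hub : Tendsto (fun n : ℕ => m n + n * (1 / 2) ^ (n - 1) + 32 * (2 + 45 * γ) * m n / ε ^ 2)
      atTop (𝓝 0) := by
    simpa using (hm0.add hgeo).add ((hm0.const_mul (32 * (2 + 45 * γ : ℝ))).div_const (ε ^ 2))
  refine squeeze_zero' (.of_forall fun n => measureReal_nonneg) ?_ hub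
  filter_upwards [hF, hmean, eventually_ge_atTop 6, hb.eventually (ge_mem_nhds hε),
    h2.eventually (gt_mem_nhds one_pos)] with n h3 h4 h5 h6 h7
  have hi : Integrable (fun p => F n p ^ 2) (nnLaw μ κ n) :=
    ⟨(h3.pow_const 2).aestronglyMeasurable,
      (hasFiniteIntegral_iff_ofReal (hnn n)).2 (h7.trans ENNReal.one_lt_top)⟩
  exact hκ.measure_abs_nnSum_ge_le h5 (F := fun x u => F n (x, u)) h3 hi h4
    (integral_eq_lintegral_of_nonneg_ae (hnn n) (h3.pow_const 2).aestronglyMeasurable).symm hε h6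

theorem norm_le_sum_abs {q : ℕ} (x : E q) : ‖x‖ ≤ ∑ j, |x j| := by
  rw [EuclideanSpace.norm_eq]
  refine Real.sqrt_le_iff.2 ⟨Finset.sum_nonneg fun j _ => abs_nonneg _, ?_⟩
  exact Finset.sum_sq_le_sq_sum_of_nonneg fun j _ => norm_nonneg _

theorem tendstoInMeasure_of_coord {Ω : Type*} [MeasurableSpace Ω] {P : Measure Ω} {q : ℕ}
    {X : ℕ → Ω → E q}
    (hX : ∀ j : Fin q, ∀ ε : ℝ, 0 < ε → Tendsto (fun n => P {ω | ε ≤ |X n ω j|}) atTop (𝓝 0)) :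
    TendstoInMeasure P X atTop fun _ => 0 := by
  rw [tendstoInMeasure_iff_norm]
  intro ε hε
  -- Using `q + 1` keeps the division meaningful for `q = 0` and makes the final comparison strict.
  have hδ : 0 < ε / (q + 1) := by positivity
  have h1 : Tendsto (fun n => ∑ j : Fin q, P {ω | ε / (q + 1) ≤ |X n ω j|}) atTop (𝓝 0) := by
    simpa using tendsto_finsetSum Finset.univ fun j (_ : j ∈ Finset.univ) => hX j _ hδ
  refine tendsto_of_tendsto_of_tendsto_of_le_of_le tendsto_const_nhds h1 (fun _ => zero_le)
    fun n => ?_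
  refine (measure_mono fun ω hω => ?_).trans (measure_iUnion_fintype_le P _)
  rw [Set.mem_iUnion]
  by_contra! hcon
  have hlt : ∀ j, |X n ω j| ≤ ε / (q + 1) := fun j => (not_le.1 (hcon j)).le
  have h2 : ε ≤ ‖X n ω - 0‖ := hω
  rw [sub_zero] at h2
  have h3 : ‖X n ω‖ ≤ q * (ε / (q + 1)) := by
    refine (norm_le_sum_abs _).trans ((Finset.sum_le_sum fun j _ => hlt j).trans (le_of_eq ?_))
    simp
  have h4 : q * (ε / (q + 1)) < ε := by
    rw [← mul_div_assoc, div_lt_iff₀ (by positivity)]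
    nlinarith
  linarith

/-! ### Assembling the approximation -/

section Approximation

variable {d q : ℕ} {f : E q → E d → ℝ} {Θ Θ0 : Set (E q)} {θ0 : E q} {Ω : Type*}
  [MeasurableSpace Ω] {P : Measure Ω} {ξ : ℕ → Ω → E d} {h : ℝ → ℝ} {a c b D : ℝ}

/-- The `ψ` part vanishes by the first order condition at the maximizer. The `ψ̃` part factorizes
because the mass is independent of the centre, and its gradient factor has mean zero. -/
theorem integral_diffB_eq_zero [IsProbabilityMeasure (law f θ0)] (hM : IsModel f Θ Θ0 θ0) (hd : 0 < d) (hA2 : A2 f Θ0)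
    (hh : IsCrit h a c b D) {j : Fin q} {Ψ : E d → ℝ≥0∞} (hΨ : IsMajorant f Θ0 θ0 j (b ≠ 0) Ψ)
    (hS : IsSample P (law f θ0) ξ) (hA4 : a ≠ 0 → A4 P f Θ0 ξ) {γ : ℕ}
    (hκ : IsNNKernel (law f θ0) (distMass (law f θ0)) γ) {n : ℕ} (hn : 2 ≤ n) {θ : E q}
    (hθ : θ ∈ interior Θ0) (hmax : ∀ θ' ∈ Θ0, critI h f θ0 n θ ≤ critI h f θ0 n θ') :
    ∫ p, diffB h f θ0 j n θ p ∂(nnLaw (law f θ0) (distMass (law f θ0)) n) = 0 := by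
  have hm : Measurable fun p : E d × ℝ => (p.1, expMass (n - 1) p.2) :=
    measurable_fst.prodMk ((measurable_expMass _).comp measurable_snd)
  have hXm := hS.measurable_sampPair hκ n 0
  have hsm := measurable_scoreB hM hd hA2 h j n (interior_subset hθ)
  obtain ⟨i1, e1⟩ := integral_scoreB_eq_zero hM hd hA2 hh hΨ hS hA4 hn hθ hmax
  have hmap := hS.map_sampPair hκ hn (i := 0) (by omega)
  have i1' : Integrable (scoreB h f θ0 j n θ) (nnLaw (law f θ0) (distMass (law f θ0)) n) := by
    rw [← hmap]
    exact (integrable_map_measure hsm.aestronglyMeasurable hXm.aemeasurable).2 i1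
  have e1' : ∫ p, scoreB h f θ0 j n θ p ∂(nnLaw (law f θ0) (distMass (law f θ0)) n) = 0 := by
    rw [← hmap, integral_map hXm.aemeasurable hsm.aestronglyMeasurable]
    exact e1
  obtain ⟨i2, e2⟩ := integrable_relGrad hM hA2 hΨ
  have iv : Integrable (fun t => v h (n * expMass (n - 1) t)) expo := by
    have h1 : Integrable (fun t : ℝ => a + 2 * c * t ^ 1 + 4 * b * t ^ 2) expo :=
      ((integrable_const _).add ((integrable_expo_pow 1).const_mul _)).add
        ((integrable_expo_pow 2).const_mul _)
    refine h1.mono' ((measurable_v.comp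
      ((measurable_expMass _).const_mul _)).aestronglyMeasurable) ?_
    filter_upwards [ae_expo_pos] with t ht
    simpa using hh.abs_v_mul_expMass_le hn ht
  have hTm : Measurable fun p : E d × ℝ => v h (n * p.2) * (gradF f θ0 p.1 j / f θ0 p.1) := by
    have h1 : Measurable fun p : E d × ℝ => v h (n * p.2) := measurable_v.comp (by fun_prop)
    have h2 : Measurable fun x => gradF f θ0 x j / f θ0 x :=
      (hA2.continuous_coord hM.mem j).measurable.div (hM.measurable_of_mem hM.mem)
    exact h1.mul (h2.comp measurable_fst)
  have i3 : Integrable (fun p : E d × ℝ => v h (n * p.2) * (gradF f θ0 p.1 j / f θ0 p.1))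
      (nnLaw (law f θ0) (distMass (law f θ0)) n) := by
    rw [← hκ.map_expMass hn]
    refine (integrable_map_measure hTm.aestronglyMeasurable hm.aemeasurable).2 ?_
    have := i2.mul_prod iv
    refine this.congr (.of_forall fun p => ?_)
    exact mul_comm _ _
  have e3 : ∫ p : E d × ℝ, v h (n * p.2) * (gradF f θ0 p.1 j / f θ0 p.1)
      ∂(nnLaw (law f θ0) (distMass (law f θ0)) n) = 0 := by
    rw [← hκ.map_expMass hn, integral_map hm.aemeasurable hTm.aestronglyMeasurable]
    have := integral_prod_mul (μ := law f θ0) (ν := expo) (fun x => gradF f θ0 x j / f θ0 x)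
      fun t => v h (n * expMass (n - 1) t)
    rw [e2, zero_mul] at this
    rw [← this]
    exact integral_congr_ae (.of_forall fun p => mul_comm _ _)
  simp only [diffB]
  rw [integral_sub i1' i3, e1', e3, sub_zero]

/-- The coordinates of the difference of `ψ_n` and `ψ̃_n`. -/
theorem ae_psi_sub_psiTilde (hM : IsModel f Θ Θ0 θ0) (hd : 0 < d) (hA2 : A2 f Θ0)
    (hS : IsSample P (law f θ0) ξ) {γ : ℕ} (hκ : IsNNKernel (law f θ0) (distMass (law f θ0)) γ)
    {n i : ℕ} (hn : 2 ≤ n) (hi : i < n) {θ : E q} (hθ : θ ∈ Θ0) (j : Fin q) :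
    ∀ᵐ ω ∂P, psi h f ξ n i θ ω j - psiTilde h f θ0 ξ n i θ0 ω j =
      diffB h f θ0 j n θ (sampPair (law f θ0) ξ n i ω) := by
  have hP := hM.isProbabilityMeasure_law
  have hμ : SpheresNull (law f θ0) := IsModel.spheresNull hd
  have hu : ∀ᵐ ω ∂P, (sampPair (law f θ0) ξ n i ω).2 ∈ Set.Ioo (0 : ℝ) 1 := by
    refine hS.ae_sampPair hκ hn hi (p := fun p => p.2 ∈ Set.Ioo (0 : ℝ) 1)
      (measurable_snd measurableSet_Ioo) ?_
    filter_upwards [ae_prod_expo_pos] with p hp using expMass_mem (by omega) hp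
  have hg : ∀ᵐ ω ∂P, 0 < f θ0 (ξ i ω) := by
    have h1 := hM.ae_pos
    rw [← hS.law i] at h1
    exact ae_of_ae_map (hS.measurable i).aemeasurable h1
  filter_upwards [hu, hg, hS.ae_qBall hμ hn (i := i)] with ω h1 h2 h3
  have hb : ∀ φ : E d → ℝ, ballInt (law f θ0) φ (sampPair (law f θ0) ξ n i ω) =
      ∫ y in nnBall ξ n i ω, φ y := fun φ => by rw [ballInt, h3]
  have hp0 : ballProb f ξ n i θ0 ω = (sampPair (law f θ0) ξ n i ω).2 := by
    rw [ballProb, ← hb, hM.ballInt_self hd h1]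
  have hint : Integrable (gradF f θ) (volume.restrict (nnBall ξ n i ω)) :=
    (hA2.continuous_grad hθ).continuousOn.integrableOn_compact (isCompact_closedBall _ _)
  have hc : (∫ y in nnBall ξ n i ω, gradF f θ y) j = ∫ y in nnBall ξ n i ω, gradF f θ y j :=
    ((EuclideanSpace.proj (𝕜 := ℝ) j).integral_comp_comm hint).symm
  have hfst : (sampPair (law f θ0) ξ n i ω).1 = ξ i ω := rfl
  simp only [psi, psiTilde, PiLp.smul_apply, smul_eq_mul, hc, diffB, scoreB, hb, z, hp0, hfst]
  rw [div_self h2.ne', mul_one, ballProb, mul_assoc (v h (n * _)) (f θ0 (ξ i ω))⁻¹,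
    div_eq_inv_mul]

/-- The score at the maximizers is approximated by its local version, for all divergence functions
with the growth conditions of `IsCrit`. -/
theorem psiApprox_of_isCrit (hM : IsModel f Θ Θ0 θ0) (hd : 0 < d) (hident : Identifiable f Θ0 θ0)
    (hA2 : A2 f Θ0) (hA3 : A3 f Θ0 θ0) (hh : IsCrit h a c b D) (hS : IsSample P (law f θ0) ξ)
    {θn : ℕ → E q} (hmax : IsMaximizerSeq P h f Θ0 ξ θn) (hA4 : a ≠ 0 → A4 P f Θ0 ξ)
    (hA5 : a ≠ 0 → A5 P f θn ξ) (hA7 : b ≠ 0 → A7 f Θ0 θ0) : PsiApprox P h f θ0 ξ θn := by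
  have hP := hM.isProbabilityMeasure_law
  have hμ : SpheresNull (law f θ0) := IsModel.spheresNull hd
  obtain ⟨γ, cell, hc⟩ := exists_cells (E d)
  have hκ := hμ.isNNKernel (cell := cell) hc
  have hcrit : ∀ᶠ n in atTop, θn n ∈ Θ0 ∧ ∀ θ ∈ Θ0, critI h f θ0 n (θn n) ≤ critI h f θ0 n θ := by
    filter_upwards [hmax, eventually_ge_atTop 2] with n ⟨h1, h2⟩ hn
    refine ⟨h1, fun θ hθ => ?_⟩
    have h3 : expectedH P h f ξ n θ ≤ expectedH P h f ξ n (θn n) := h2 hθ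
    rwa [expectedH_eq hM hd hh hS hκ hn hθ, expectedH_eq hM hd hh hS hκ hn h1,
      EReal.neg_le_neg_iff, EReal.coe_ennreal_le_coe_ennreal_iff] at h3
  have hθn : ∀ᶠ n in atTop, θn n ∈ Θ0 := hcrit.mono fun n h => h.1
  have hlim : Tendsto θn atTop (𝓝 θ0) := tendsto_of_critI_le hM hd hA2 hident hh
    (hcrit.mono fun n h => ⟨h.1, h.2 θ0 hM.mem⟩)
  have hθi : ∀ᶠ n in atTop, θn n ∈ interior Θ0 :=
    hlim.eventually (isOpen_interior.mem_nhds (mem_interior_iff_mem_nhds.2 hM.nhds))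
  refine tendstoInMeasure_of_coord fun j ε hε => ?_
  obtain ⟨Ψ, hΨ⟩ := hM.exists_isMajorant hA2 hA3 hA7 j
  have hF : ∀ᶠ n in atTop, Measurable (diffB h f θ0 j n (θn n)) :=
    hθn.mono fun n hn => measurable_diffB hM hd hA2 h j n hn
  have h2 := tendsto_lintegral_diffB_sq hM hd hA2 hh hΨ hS hθn hlim hA5
  have h2' : Tendsto (fun n => ∫⁻ p, ENNReal.ofReal (diffB h f θ0 j n (θn n) p ^ 2)
      ∂(nnLaw (law f θ0) (distMass (law f θ0)) n)) atTop (𝓝 0) := by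
    refine h2.congr' ?_
    filter_upwards [hF, eventually_ge_atTop 2] with n h3 hn
    have hm : Measurable fun p : E d × ℝ => (p.1, expMass (n - 1) p.2) :=
      measurable_fst.prodMk ((measurable_expMass _).comp measurable_snd)
    rw [← hκ.map_expMass hn, lintegral_map (h3.pow_const 2).ennreal_ofReal hm]
  have hmean : ∀ᶠ n in atTop, ∫ p, diffB h f θ0 j n (θn n) p
      ∂(nnLaw (law f θ0) (distMass (law f θ0)) n) = 0 := by
    filter_upwards [hcrit, hθi, eventually_ge_atTop 2] with n h3 h4 hn
    exact integral_diffB_eq_zero hM hd hA2 hh hΨ hS hA4 hκ hn h4 h3.2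
  have hlimit := hκ.tendsto_measure_abs_nnSum hF h2' hmean hε
  have hseq : IsProbabilityMeasure (seqLaw (law f θ0)) := by rw [seqLaw]; infer_instance
  have hlimit' : Tendsto (fun n : ℕ => seqLaw (law f θ0) {a | ε ≤ |(√(n : ℝ))⁻¹ *
      ∑ i ∈ Finset.range n, diffB h f θ0 j n (θn n) (nnPair (distMass (law f θ0)) n i a)|})
      atTop (𝓝 0) := by
    have := (ENNReal.continuous_ofReal.tendsto 0).comp hlimit
    simpa [Function.comp_def, ofReal_measureReal] using this
  refine hlimit'.congr' ?_
  filter_upwards [hF, hθn, eventually_ge_atTop 2] with n h3 h4 hn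
  have hset : MeasurableSet {a : ℕ → E d | ε ≤ |(√(n : ℝ))⁻¹ *
      ∑ i ∈ Finset.range n, diffB h f θ0 j n (θn n) (nnPair (distMass (law f θ0)) n i a)|} :=
    measurableSet_le measurable_const (measurable_norm.comp
      ((Finset.measurable_fun_sum _ fun i _ => h3.comp (hκ.measurable_nnPair n i)).const_mul _))
  rw [← hS.map_seq, Measure.map_apply hS.measurable_seq hset]
  refine measure_congr ?_
  have hall : ∀ᵐ ω ∂P, ∀ i ∈ Finset.range n,
      psi h f ξ n i (θn n) ω j - psiTilde h f θ0 ξ n i θ0 ω j =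
        diffB h f θ0 j n (θn n) (sampPair (law f θ0) ξ n i ω) := by
    refine (Finset.eventually_all _).2 fun i hi => ?_
    exact ae_psi_sub_psiTilde hM hd hA2 hS hκ hn (Finset.mem_range.1 hi) h4 j
  filter_upwards [hall] with ω hω
  have : (√(n : ℝ))⁻¹ * ∑ i ∈ Finset.range n, diffB h f θ0 j n (θn n)
      (nnPair (distMass (law f θ0)) n i fun k => ξ k ω) =
      ((√(n : ℝ))⁻¹ • ∑ i ∈ Finset.range n, psi h f ξ n i (θn n) ω
        - (√(n : ℝ))⁻¹ • ∑ i ∈ Finset.range n, psiTilde h f θ0 ξ n i θ0 ω) j := by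
    rw [← smul_sub, ← Finset.sum_sub_distrib, PiLp.smul_apply, smul_eq_mul,
      WithLp.ofLp_sum, Finset.sum_apply]
    congr 1
    exact Finset.sum_congr rfl fun i hi => (hω i hi).symm
  exact congrArg (fun y : ℝ => ε ≤ |y|) this

end Approximation

/-! ### The divergence functions -/

theorem abs_log_le {x : ℝ} (hx : 0 < x) : |Real.log x| ≤ 2 * x ^ (-(1 / 2) : ℝ) + x := by
  have hy : 0 < x ^ (-(1 / 2) : ℝ) := Real.rpow_pos_of_pos hx _
  -- `log y ≤ y - 1` at `y = x^(-1/2)` bounds `-log x`; at `x` itself it bounds `log x`.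
  have h1 := Real.log_le_sub_one_of_pos hy
  rw [Real.log_rpow hx] at h1
  have h2 := Real.log_le_sub_one_of_pos hx
  exact abs_le.2 ⟨by linarith, by linarith⟩

theorem abs_mul_log_le {x : ℝ} (hx : 0 < x) : |x * Real.log x| ≤ 1 + x ^ 2 := by
  have h1 := Real.log_le_sub_one_of_pos (inv_pos.2 hx)
  rw [Real.log_inv] at h1
  have h2 := Real.log_le_sub_one_of_pos hx
  have h3 : x * -Real.log x ≤ x * (x⁻¹ - 1) := by gcongr
  rw [mul_sub, mul_inv_cancel₀ hx.ne'] at h3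
  have h4 : x * Real.log x ≤ x * (x - 1) := by gcongr
  exact abs_le.2 ⟨by nlinarith, by nlinarith⟩

theorem rpow_le_rpow_add_rpow {x p s t : ℝ} (hx : 0 < x) (hsp : s ≤ p) (hpt : p ≤ t) :
    x ^ p ≤ x ^ s + x ^ t := by
  have hs := Real.rpow_pos_of_pos hx s
  have ht := Real.rpow_pos_of_pos hx t
  rcases le_total x 1 with h | h
  · have := Real.rpow_le_rpow_of_exponent_ge hx h hsp
    linarith
  · have := Real.rpow_le_rpow_of_exponent_le h hpt
    linarith

theorem v_h1 {x : ℝ} (hx : 0 < x) : v h1 x = 1 - x := by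
  have h : HasDerivAt h1 (x⁻¹ - 1) x := by
    exact ((Real.hasDerivAt_log hx.ne').sub (hasDerivAt_id x)).add_const 1
  rw [v, h.deriv]
  field_simp

/-- Here `v(x) = 1 - x`, so `b = 0` and A7 is not needed. -/
theorem isCrit_h1 : IsCrit h1 1 1 0 4 where
  measurable := by unfold h1; fun_prop
  differentiableAt z hz := by
    unfold h1
    exact ((Real.differentiableAt_log hz.ne').sub differentiableAt_id).add_const 1
  continuousOn_v := (continuousOn_const.sub continuousOn_id).congr fun x hx => v_h1 hx
  nonpos z hz := by
    have := Real.log_le_sub_one_of_pos hz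
    unfold h1
    linarith
  lt_tangent x r hx hr hne := by
    have := Real.log_lt_sub_one_of_pos hr hne
    rw [v_h1 hx, h1, h1, Real.log_mul hx.ne' hr.ne']
    linarith
  abs_v_le z hz := by
    rw [v_h1 hz]
    exact abs_le.2 ⟨by linarith, by linarith⟩
  abs_le z hz := by
    have h1' := abs_le.1 (abs_log_le hz)
    have hy : 0 < z ^ (-(1 / 2) : ℝ) := Real.rpow_pos_of_pos hz _
    unfold h1
    exact abs_le.2 ⟨by nlinarith [sq_nonneg (z - 1)], by nlinarith [sq_nonneg (z - 1)]⟩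
  a_nonneg := zero_le_one
  c_nonneg := zero_le_one
  b_nonneg := le_rfl
  D_nonneg := by norm_num

theorem v_h2 {x : ℝ} (hx : 0 < x) : v h2 x = -(x * Real.log x) + 1 - x := by
  have h : HasDerivAt h2 (-1 * Real.log x + (1 - x) * x⁻¹) x :=
    ((hasDerivAt_id x).const_sub 1).mul (Real.hasDerivAt_log hx.ne')
  rw [v, h.deriv]
  field_simp
  ring

/-- The term `x log x` in `v` is bounded by `1 + x²`; both `a` and `b` are nonzero, and so A4, A5
and A7 all enter. -/
theorem isCrit_h2 : IsCrit h2 2 1 1 5 where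
  measurable := by unfold h2; fun_prop
  differentiableAt z hz := by
    unfold h2
    exact (differentiableAt_id.const_sub 1).mul (Real.differentiableAt_log hz.ne')
  continuousOn_v := by
    have : Continuous fun x : ℝ => -(x * Real.log x) + 1 - x :=
      ((Real.continuous_mul_log.neg).add continuous_const).sub continuous_id
    exact this.continuousOn.congr fun x hx => v_h2 hx
  nonpos z hz := by
    unfold h2
    rcases le_total z 1 with h | h
    · exact mul_nonpos_of_nonneg_of_nonpos (by linarith) (Real.log_nonpos hz.le h)
    · exact mul_nonpos_of_nonpos_of_nonneg (by linarith) (Real.log_nonneg h)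
  -- The gap is `(r - 1 - log r) + x (r log r - (r - 1))`, and both brackets are positive for `r ≠
  -- 1`.
  lt_tangent x r hx hr hne := by
    have h1 := Real.log_lt_sub_one_of_pos hr hne
    have h2' := Real.log_lt_sub_one_of_pos (inv_pos.2 hr) (by simpa using hne)
    rw [Real.log_inv] at h2'
    have h3 : r * -Real.log r < r * (r⁻¹ - 1) := by gcongr
    rw [mul_sub, mul_inv_cancel₀ hr.ne'] at h3
    rw [v_h2 hx, h2, h2, Real.log_mul hx.ne' hr.ne']
    have h4 : 0 < x * (r * Real.log r - (r - 1)) := mul_pos hx (by linarith)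
    nlinarith
  abs_v_le z hz := by
    have h1 := abs_le.1 (abs_mul_log_le hz)
    rw [v_h2 hz]
    exact abs_le.2 ⟨by nlinarith, by nlinarith⟩
  abs_le z hz := by
    have h1 := abs_log_le hz
    have hy : 0 < z ^ (-(1 / 2) : ℝ) := Real.rpow_pos_of_pos hz _
    have h3 : z * z ^ (-(1 / 2) : ℝ) ≤ 1 + z := by
      have h4 := rpow_le_rpow_add_rpow (p := 1 / 2) (s := 0) (t := 1) hz (by norm_num) (by norm_num)
      rw [Real.rpow_zero, Real.rpow_one] at h4
      calc z * z ^ (-(1 / 2) : ℝ) = z ^ (1 : ℝ) * z ^ (-(1 / 2) : ℝ) := by rw [Real.rpow_one]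
        _ = z ^ (1 / 2 : ℝ) := by rw [← Real.rpow_add hz]; norm_num
        _ ≤ _ := h4
    have h5 : |1 - z| ≤ 1 + z := abs_le.2 ⟨by linarith, by linarith⟩
    unfold h2
    rw [abs_mul]
    calc |1 - z| * |Real.log z| ≤ (1 + z) * (2 * z ^ (-(1 / 2) : ℝ) + z) := by gcongr
      _ ≤ _ := by nlinarith [sq_nonneg (z - 1)]
  a_nonneg := zero_le_two
  c_nonneg := zero_le_one
  b_nonneg := zero_le_one
  D_nonneg := by norm_num

theorem hasDerivAt_h5 (α : ℝ) {x : ℝ} (hx : 0 < x) :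
    HasDerivAt (h5 α) (Real.sign (1 - α) * (α * x ^ (α - 1) - α)) x := by
  have h1 := Real.hasDerivAt_rpow_const (p := α) (Or.inl hx.ne')
  have h2 : HasDerivAt (fun y : ℝ => α * y) α x := by simpa using (hasDerivAt_id x).const_mul α
  exact ((((h1.sub h2).add_const α).sub_const 1).const_mul _)

theorem v_h5 (α : ℝ) {x : ℝ} (hx : 0 < x) :
    v (h5 α) x = Real.sign (1 - α) * (α * (x ^ α - x)) := by
  rw [v, (hasDerivAt_h5 α hx).deriv, Real.rpow_sub_one hx.ne']
  field_simp

theorem abs_sign_le_one (x : ℝ) : |Real.sign x| ≤ 1 := by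
  rcases Real.sign_apply_eq x with h | h | h <;> simp [h]

/-- Strict Bernoulli inequality; the sign accounts for its reversal at `α = 1`. -/
theorem sign_mul_rpow_lt {α r : ℝ} (h0 : 0 < α) (h1 : α ≠ 1) (hr : 0 < r) (hne : r ≠ 1) :
    0 < Real.sign (1 - α) * (1 + α * (r - 1) - r ^ α) := by
  rcases lt_or_gt_of_ne h1 with h | h
  · have := rpow_one_add_lt_one_add_mul_self (s := r - 1) (p := α) (by linarith)
      (sub_ne_zero.2 hne) h0 h
    rw [add_sub_cancel] at this
    rw [Real.sign_of_pos (by linarith)]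
    linarith
  · have := one_add_mul_self_lt_rpow_one_add (s := r - 1) (p := α) (by linarith)
      (sub_ne_zero.2 hne) h
    rw [add_sub_cancel] at this
    rw [Real.sign_of_neg (by linarith)]
    linarith

theorem h5_lt_tangent {α : ℝ} (h0 : 0 < α) (h1 : α ≠ 1) {x r : ℝ} (hx : 0 < x) (hr : 0 < r)
    (hne : r ≠ 1) : h5 α (x * r) < h5 α x + v (h5 α) x * (r - 1) := by
  have h := mul_pos (Real.rpow_pos_of_pos hx α) (sign_mul_rpow_lt h0 h1 hr hne)
  rw [v_h5 α hx, h5, h5, Real.mul_rpow hx.le hr.le]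
  linarith

/-- The `h₅` family, up to the growth of the powers `z ^ α`. -/
theorem isCrit_h5 {α a c b : ℝ} (h0 : 0 < α) (h1 : α ≠ 1) (h2 : α ≤ 2) (ha : 0 ≤ a) (hc : 0 ≤ c)
    (hb : 0 ≤ b) (hpow : ∀ z : ℝ, 0 < z → α * (z ^ α + z) ≤ a + c * z + b * z ^ 2) :
    IsCrit (h5 α) a c b 6 where
  measurable := by unfold h5; fun_prop
  differentiableAt z hz := (hasDerivAt_h5 α hz).differentiableAt
  continuousOn_v := by
    have : ContinuousOn (fun x : ℝ => Real.sign (1 - α) * (α * (x ^ α - x))) (Set.Ioi 0) := by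
      have h := Real.continuous_rpow_const h0.le
      exact (continuous_const.mul (continuous_const.mul (h.sub continuous_id))).continuousOn
    exact this.congr fun x hx => v_h5 α hx
  nonpos z hz := by
    have he : h5 α 1 = 0 := by simp [h5]
    have hv : v (h5 α) 1 = 0 := by rw [v_h5 α one_pos]; simp
    rcases eq_or_ne z 1 with rfl | hne
    · exact he.le
    · have := h5_lt_tangent h0 h1 one_pos hz hne
      rw [he, hv, one_mul] at this
      linarith
  lt_tangent x r hx hr hne := h5_lt_tangent h0 h1 hx hr hne
  abs_v_le z hz := by
    have hp := Real.rpow_pos_of_pos hz α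
    have h3 : |z ^ α - z| ≤ z ^ α + z := abs_le.2 ⟨by linarith, by linarith⟩
    rw [v_h5 α hz, abs_mul, abs_mul, abs_of_pos h0]
    calc |Real.sign (1 - α)| * (α * |z ^ α - z|) ≤ 1 * (α * (z ^ α + z)) := by
          gcongr
          exact abs_sign_le_one _
      _ ≤ _ := by rw [one_mul]; exact hpow z hz
  abs_le z hz := by
    have hy : 0 < z ^ (-(1 / 2) : ℝ) := Real.rpow_pos_of_pos hz _
    have hp := Real.rpow_pos_of_pos hz α
    have h3 := rpow_le_rpow_add_rpow hz h0.le h2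
    rw [Real.rpow_zero, Real.rpow_two] at h3
    have h4 : α * z ≤ 2 * z := by gcongr
    have h5' : 0 ≤ α * z := by positivity
    have h6 : |z ^ α - α * z + α - 1| ≤ 6 * (z ^ (-(1 / 2) : ℝ) + 1 + z ^ 2) :=
      abs_le.2 ⟨by nlinarith [sq_nonneg (z - 1)], by nlinarith [sq_nonneg (z - 1)]⟩
    rw [h5, abs_mul]
    calc |Real.sign (1 - α)| * |z ^ α - α * z + α - 1|
        ≤ 1 * (6 * (z ^ (-(1 / 2) : ℝ) + 1 + z ^ 2)) := by
          gcongr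
          exact abs_sign_le_one _
      _ = _ := one_mul _
  a_nonneg := ha
  c_nonneg := hc
  b_nonneg := hb
  D_nonneg := by norm_num

/-- For `α < 1` the power is at most `1 + z`, so `b = 0`. -/
theorem isCrit_h5_of_lt_one {α : ℝ} (h0 : 0 < α) (h1 : α < 1) : IsCrit (h5 α) 1 2 0 6 :=
  isCrit_h5 h0 h1.ne (by linarith) zero_le_one zero_le_two le_rfl fun z hz => by
    have h3 := rpow_le_rpow_add_rpow hz h0.le h1.le
    rw [Real.rpow_zero, Real.rpow_one] at h3
    have hp := Real.rpow_pos_of_pos hz α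
    nlinarith

/-- For `1 < α ≤ 2` the power is at most `z + z²`, without a constant term. Thus `a = 0`, and A4 and
A5 can be dispensed with. -/
theorem isCrit_h5_of_one_lt {α : ℝ} (h1 : 1 < α) (h2 : α ≤ 2) : IsCrit (h5 α) 0 4 2 6 :=
  isCrit_h5 (by linarith) h1.ne' h2 le_rfl (by norm_num) zero_le_two fun z hz => by
    have h3 := rpow_le_rpow_add_rpow hz h1.le h2
    rw [Real.rpow_one, Real.rpow_two] at h3
    have hp := Real.rpow_pos_of_pos hz α
    nlinarith

end GMSP

theorem proposition6 {d q : ℕ} (hd : 0 < d) {Ω : Type*} [MeasurableSpace Ω] (P : Measure Ω)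
    [IsProbabilityMeasure P] (f : E q → E d → ℝ) (Θ Θ0 : Set (E q)) (θ0 : E q)
    (hmodel : IsModel f Θ Θ0 θ0) (hident : Identifiable f Θ0 θ0)
    (ξ : ℕ → Ω → E d) (hξ : ∀ i, Measurable (ξ i)) (hindep : iIndepFun ξ P)
    (hlaw : ∀ i, P.map (ξ i) = law f θ0)
    (hA2 : A2 f Θ0) (hA3 : A3 f Θ0 θ0) :
    (∀ θn : ℕ → E q, IsMaximizerSeq P h1 f Θ0 ξ θn → A4 P f Θ0 ξ → A5 P f θn ξ →
      PsiApprox P h1 f θ0 ξ θn) ∧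
    (∀ α : ℝ, 0 < α → α < 1 → ∀ θn : ℕ → E q, IsMaximizerSeq P (h5 α) f Θ0 ξ θn →
      A4 P f Θ0 ξ → A5 P f θn ξ → PsiApprox P (h5 α) f θ0 ξ θn) ∧
    (∀ θn : ℕ → E q, IsMaximizerSeq P h2 f Θ0 ξ θn → A4 P f Θ0 ξ → A5 P f θn ξ → A7 f Θ0 θ0 →
      PsiApprox P h2 f θ0 ξ θn) ∧
    (∀ α : ℝ, 1 < α → α ≤ 2 → ∀ θn : ℕ → E q, IsMaximizerSeq P (h5 α) f Θ0 ξ θn →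
      A7 f Θ0 θ0 → PsiApprox P (h5 α) f θ0 ξ θn) := by
  have hS : IsSample P (law f θ0) ξ := ⟨hξ, hindep, hlaw⟩
  -- The assumptions required in each case are dictated by which of the constants `a` and `b`
  -- vanish.
  refine ⟨fun θn hmax hA4 hA5 => ?_, fun α h0 h1 θn hmax hA4 hA5 => ?_,
    fun θn hmax hA4 hA5 hA7 => ?_, fun α h1 h2 θn hmax hA7 => ?_⟩
  · exact psiApprox_of_isCrit hmodel hd hident hA2 hA3 isCrit_h1 hS hmax (fun _ => hA4)
      (fun _ => hA5) fun h => absurd rfl h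
  · exact psiApprox_of_isCrit hmodel hd hident hA2 hA3 (isCrit_h5_of_lt_one h0 h1) hS hmax
      (fun _ => hA4) (fun _ => hA5) fun h => absurd rfl h
  · exact psiApprox_of_isCrit hmodel hd hident hA2 hA3 isCrit_h2 hS hmax (fun _ => hA4)
      (fun _ => hA5) fun _ => hA7
  · exact psiApprox_of_isCrit hmodel hd hident hA2 hA3 (isCrit_h5_of_one_lt h1 h2) hS hmax
      (fun h => absurd rfl h) (fun h => absurd rfl h) fun _ => hA7
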